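/- **Setting.** Let $n\ge 1$ and let $\Omega\subset\mathbb R^n$ be a nonempty bounded convex open set with strictly convex smooth boundary, i.e. $\partial\Omega$ is a smooth hypersurface with positive definite second fundamental form. Let $\sigma$ be a smooth positive measure on $\partial\Omega$; its smooth positive density with respect to the Euclidean surface measure is also denoted by $\sigma$. Let $A\in C^\infty(\overline\Omega)$, fix a point $p_o\in\Omega$, let $\mu$ be Lebesgue measure, and put $$\mathcal L_A(u)=\int_{\partial\Omega}u\,d\sigma-\int_\Omega A\,u\,d\mu,\qquad \|u\|_b=\int_{\partial\Omega}u\,d\sigma .$$ *The class $\mathcal S_{\Omega,\sigma}$.* Smooth local coordinates $(\xi,\eta_1,\dots,\eta_{n-1})$ near a point of $\partial\Omega$ are called adapted if $\partial\Omega$ is given by $\xi=0$ and $\Omega$ by $\xi>0$, and the inward normal derivative of $\xi$ on $\partial\Omega$ is $\sigma^{-1}$. Let $\alpha_1(t)=-\log t$, $\alpha_2(t)=t^{-1}$, $\alpha_3(t)=t^{-2}$. $\mathcal S_{\Omega,\sigma}$ is the set of continuous convex functions $u$ on $\overline\Omega$ that are smooth with positive definite Hessian $(u_{ij})$ in $\Omega$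 and such that near every point of $\partial\Omega$ there are adapted coordinates in which $u=\xi\log\xi+f$, where $|\nabla_\xi^p\nabla_\eta^q f|=o(\alpha_p(\xi))$ as $\xi\to0$, uniformly in $\eta$, for all integers $p\ge1$, $q\ge0$ with $p+q\le3$. *Stability.* Let $\tilde{\mathcal C}$ be the set of continuous convex functions $u$ on $\overline\Omega$ that are smooth in $\Omega$ and satisfy $u\ge u(p_o)=0$. Let $\mathcal C_*$ be the set of functions $u$ on $\Omega$ for which there are a constant $C>0$ and functions $u^{(k)}\in\tilde{\mathcal C}$ with $\|u^{(k)}\|_b<C$ that converge to $u$ locally uniformly in $\Omega$. Such a $u$ is given the boundary values $u(q)=\liminf_{\Omega\ni x\to q}u(x)$ for $q\in\partial\Omega$ (equivalently, the limit along the segment from $p_o$ to $q$); these are finite for $\sigma$-almost every $q$. For $P>0$ let $\mathcal C_*^P=\{u\in\mathcal C_*:\|u\|_b\le P\}$. The pair $(\Omega,A)$ is called - *relatively strong stable* (with respect to $\mathcal C_*^P$) if $\mathcal L_A(u)\ge0$ for all $u\in\mathcal C_*^P$, and every $u\in\mathcal C_*^P$ with $\mathcal L_A(u)=0$ is affine linear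 on $\Omega$; - *uniformly stable* if there is a constant $\lambda>0$ with $\mathcal L_A(u)\ge\lambda\int_{\partial\Omega}u\,d\sigma$ for all $u\in\tilde{\mathcal C}$. **Proposition.** If the Abreu equation $$\sum_{i,j}\frac{\partial^2u^{ij}}{\partial x_i\partial x_j}=-A\quad\text{on }\Omega,\qquad (u^{ij})=(u_{ij})^{-1},$$ has a solution $u\in\mathcal S_{\Omega,\sigma}$, then $(\Omega,A)$ is relatively strong stable with respect to $\mathcal C_*^P$ for every $P>0$, and $(\Omega,A)$ is uniformly stable. -/

import Mathlib

open Set Filter Topology MeasureTheory Asymptotics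
open scoped ContDiff

noncomputable section

namespace Abreu

/-- Euclidean space `ℝⁿ`. -/
abbrev E (n : ℕ) : Type := EuclideanSpace ℝ (Fin n)

/-- The `i`-th standard basis vector of `ℝⁿ`. -/
abbrev stdVec {n : ℕ} (i : Fin n) : E n := EuclideanSpace.single i (1 : ℝ)

/-- The partial derivative `∂g/∂xᵢ`. -/
def pderiv {n : ℕ} (i : Fin n) (g : E n → ℝ) (x : E n) : ℝ := fderiv ℝ g x (stdVec i)

/-- The Hessian matrix `(u_ij)`. -/
def hessian {n : ℕ} (u : E n → ℝ) (x : E n) : Matrix (Fin n) (Fin n) ℝ :=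
  Matrix.of fun i j => pderiv i (pderiv j u) x

/-- `u` solves the Abreu equation `∑ ∂²u^{ij}/∂xᵢ∂xⱼ = -A` on `Ω`, where `(u^{ij})` is the inverse
of the Hessian matrix `(u_ij)`. -/
def SolvesAbreu {n : ℕ} (Ω : Set (E n)) (A u : E n → ℝ) : Prop :=
  ∀ x ∈ Ω, ∑ i, ∑ j, pderiv i (pderiv j fun y => (hessian u y)⁻¹ i j) x = -A x

/-! ### Domains with strictly convex smooth boundary -/

/-- The boundary of the open set `Ω` is smooth and strictly convex: near every boundary point,
`Ω = {ρ > 0}` for a smooth function `ρ` with `dρ ≠ 0` on `{ρ = 0}` whose second derivative is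
negative definite on the tangent spaces `ker dρ` of the boundary (so the second fundamental form of
the boundary is positive definite). -/
def StrictlyConvexSmoothBoundary {n : ℕ} (Ω : Set (E n)) : Prop :=
  ∀ P ∈ frontier Ω, ∃ (U : Set (E n)) (ρ : E n → ℝ), IsOpen U ∧ P ∈ U ∧ ContDiffOn ℝ ∞ ρ U ∧
    (∀ x ∈ U, x ∈ Ω ↔ 0 < ρ x) ∧
    ∀ x ∈ U, ρ x = 0 → fderiv ℝ ρ x ≠ 0 ∧
      ∀ w : E n, w ≠ 0 → fderiv ℝ ρ x w = 0 → iteratedFDeriv ℝ 2 ρ x ![w, w] < 0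

/-- A bounded convex domain with strictly convex smooth boundary. -/
structure IsSmoothConvexDomain {n : ℕ} (Ω : Set (E n)) : Prop where
  isOpen : IsOpen Ω
  nonempty : Ω.Nonempty
  convex : Convex ℝ Ω
  isBounded : Bornology.IsBounded Ω
  boundary : StrictlyConvexSmoothBoundary Ω

/-- `s` is the density of a smooth positive measure on `∂Ω`. As `∂Ω` is a smooth hypersurface,
`ContDiffOn ℝ ∞ s (frontier Ω)` says that `s` is a smooth function on it. -/
structure IsSmoothPositiveDensity {n : ℕ} (Ω : Set (E n)) (s : E n → ℝ) : Prop where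
  smooth : ContDiffOn ℝ ∞ s (frontier Ω)
  pos : ∀ x ∈ frontier Ω, 0 < s x

/-- The measure `σ` on `∂Ω` with density `s` with respect to the Euclidean surface measure, that is,
the `(n-1)`-dimensional Hausdorff measure with the normalisation that agrees with Lebesgue measure
on `ℝⁿ⁻¹`. -/
def boundaryMeasure {n : ℕ} (Ω : Set (E n)) (s : E n → ℝ) : Measure (E n) :=
  ((Measure.euclideanHausdorffMeasure (n - 1) : Measure (E n)).restrict (frontier Ω)).withDensity
    fun x => ENNReal.ofReal (s x)

/-- `ν` is an inward unit normal of the convex domain `Ω` at its boundary point `x`. -/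
def IsInwardUnitNormal {n : ℕ} (Ω : Set (E n)) (x ν : E n) : Prop :=
  ‖ν‖ = 1 ∧ ∀ y ∈ Ω, 0 ≤ inner ℝ ν (y - x)

/-! ### The class `𝒮_{Ω,σ}` -/

/-- The functions `α₁(t) = -log t`, `α₂(t) = t⁻¹`, `α₃(t) = t⁻²` (other indices are not used). -/
def alpha : ℕ → ℝ → ℝ
  | 1, t => -Real.log t
  | 2, t => t⁻¹
  | 3, t => (t ^ 2)⁻¹
  | _, _ => 0

/-- `Φ` is a system of adapted local coordinates `(ξ, η₁, …, ηₙ₋₁)` near `P`, where `ξ` is the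
coordinate number `0`: the boundary is `{ξ = 0}`, the domain is `{ξ > 0}`, and the (inward) normal
derivative of `ξ` on the boundary is `σ⁻¹`. -/
structure IsAdapted {n : ℕ} [NeZero n] (Ω : Set (E n)) (s : E n → ℝ) (P : E n)
    (Φ : OpenPartialHomeomorph (E n) (E n)) : Prop where
  mem_source : P ∈ Φ.source
  smooth : ContDiffOn ℝ ∞ Φ Φ.source
  smooth_symm : ContDiffOn ℝ ∞ Φ.symm Φ.target
  mem_iff : ∀ x ∈ Φ.source, x ∈ Ω ↔ 0 < Φ x 0
  mem_frontier_iff : ∀ x ∈ Φ.source, x ∈ frontier Ω ↔ Φ x 0 = 0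
  normal_deriv : ∀ x ∈ Φ.source, x ∈ frontier Ω → ∀ ν, IsInwardUnitNormal Ω x ν →
    fderiv ℝ (fun y => Φ y 0) x ν = (s x)⁻¹

/-- The function `f` with `u = ξ log ξ + f`, written in the coordinates `Φ`. -/
def remainder {n : ℕ} [NeZero n] (Φ : OpenPartialHomeomorph (E n) (E n)) (u : E n → ℝ)
    (y : E n) : ℝ :=
  u (Φ.symm y) - y 0 * Real.log (y 0)

/-- The class `𝒮_{Ω,σ}`. In the last field, `|∇_ξ^p ∇_η^q f| = o(α_p(ξ))` as `ξ → 0` (uniformly in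
`η` in the coordinate neighbourhood) is required of every partial derivative of `f` that is taken
`p ≥ 1` times in the direction `ξ` and `q` times in directions `ηⱼ`, where `p + q ≤ 3`. -/
structure ClassS {n : ℕ} [NeZero n] (Ω : Set (E n)) (s : E n → ℝ) (u : E n → ℝ) : Prop where
  continuousOn : ContinuousOn u (closure Ω)
  convexOn : ConvexOn ℝ (closure Ω) u
  smooth : ContDiffOn ℝ ∞ u Ω
  strictlyConvex : ∀ x ∈ Ω, (hessian u x).PosDef
  boundary : ∀ P ∈ frontier Ω, ∃ Φ : OpenPartialHomeomorph (E n) (E n), IsAdapted Ω s P Φ ∧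
    ∀ p q : ℕ, 1 ≤ p → p + q ≤ 3 → ∀ η : Fin q → Fin n, (∀ k, η k ≠ 0) →
      (fun y => iteratedFDeriv ℝ (p + q) (remainder Φ u) y
          (Fin.append (fun _ : Fin p => stdVec 0) fun k => stdVec (η k)))
        =o[comap (fun y : E n => y 0) (𝓝[>] 0) ⊓ 𝓟 Φ.target] fun y => alpha p (y 0)

/-! ### Classes of normalised convex functions and stability -/

/-- `𝒞_∞`: continuous convex functions on the closure of `Ω` that are smooth in `Ω`. -/
structure ClassCInf {n : ℕ} (Ω : Set (E n)) (u : E n → ℝ) : Prop where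
  continuousOn : ContinuousOn u (closure Ω)
  convexOn : ConvexOn ℝ (closure Ω) u
  smooth : ContDiffOn ℝ ∞ u Ω

/-- `𝒞~`: the functions `u` in `𝒞_∞` with `u ≥ u(p₀) = 0`. -/
structure ClassCTilde {n : ℕ} (Ω : Set (E n)) (p₀ : E n) (u : E n → ℝ) : Prop where
  classCInf : ClassCInf Ω u
  nonneg : ∀ x ∈ closure Ω, 0 ≤ u x
  eq_zero : u p₀ = 0

/-- `‖u‖_b = ∫_{∂Ω} u dσ`. -/
def boundaryNorm {n : ℕ} (σ : Measure (E n)) (u : E n → ℝ) : ℝ := ∫ x, u x ∂σ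

/-- `ℒ_A(u) = ∫_{∂Ω} u dσ - ∫_Ω A u dμ`, for a function `u` on the closure of `Ω`. -/
def linFunctional {n : ℕ} (Ω : Set (E n)) (σ : Measure (E n)) (A u : E n → ℝ) : ℝ :=
  ∫ x, u x ∂σ - ∫ x in Ω, A x * u x

open Classical in
/-- The extension of a convex function `u` on `Ω` to the boundary of `Ω` by
`u(q) = lim inf u(x)` as `x → q` within `Ω`. This is the limit of `u` at `q` where the limit exists,
and always the limit along the segments of `Ω` that end in `q`. For the functions in `𝒞_*` it is
finite at `σ`-almost all `q`. -/
def extend {n : ℕ} (Ω : Set (E n)) (u : E n → ℝ) (q : E n) : ℝ :=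
  if q ∈ Ω then u q else (liminf (fun x => (u x : EReal)) (𝓝[Ω] q)).toReal

/-- `𝒞_*`: the locally uniform limits in `Ω` of sequences in `𝒞~` that are bounded in `‖·‖_b`.
Only the values of `u` on `Ω` matter; its boundary values are those of `extend Ω u`. -/
def ClassCStar {n : ℕ} (Ω : Set (E n)) (σ : Measure (E n)) (p₀ : E n) (u : E n → ℝ) : Prop :=
  ∃ (C : ℝ) (v : ℕ → E n → ℝ), 0 < C ∧
    (∀ k, ClassCTilde Ω p₀ (v k) ∧ boundaryNorm σ (v k) < C) ∧
    TendstoLocallyUniformlyOn v u atTop Ω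

/-- `𝒞_*^P`: the functions `u` in `𝒞_*` with `‖u‖_b ≤ P`. -/
def ClassCStarLE {n : ℕ} (Ω : Set (E n)) (σ : Measure (E n)) (p₀ : E n) (P : ℝ)
    (u : E n → ℝ) : Prop :=
  ClassCStar Ω σ p₀ u ∧ boundaryNorm σ (extend Ω u) ≤ P

/-- `u` is affine linear on `Ω`. -/
def IsAffineOn {n : ℕ} (Ω : Set (E n)) (u : E n → ℝ) : Prop :=
  ∃ a : E n →ᵃ[ℝ] ℝ, EqOn u a Ω

/-- `(Ω, A)` is relatively strong stable, with respect to the class `𝒞_*^P`: `ℒ_A ≥ 0` on `𝒞_*^P`,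
and `𝒞_*^P` contains no nontrivial (that is, not affine linear) extremal function. -/
def RelativelyStrongStable {n : ℕ} (Ω : Set (E n)) (σ : Measure (E n)) (A : E n → ℝ)
    (p₀ : E n) (P : ℝ) : Prop :=
  (∀ u, ClassCStarLE Ω σ p₀ P u → 0 ≤ linFunctional Ω σ A (extend Ω u)) ∧
    ¬ ∃ u, ClassCStarLE Ω σ p₀ P u ∧ linFunctional Ω σ A (extend Ω u) = 0 ∧ ¬ IsAffineOn Ω u

/-- `(Ω, A)` is uniformly stable. -/
def UniformlyStable {n : ℕ} (Ω : Set (E n)) (σ : Measure (E n)) (A : E n → ℝ) (p₀ : E n) : Prop :=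
  ∃ l : ℝ, 0 < l ∧ ∀ u, ClassCTilde Ω p₀ u → l * boundaryNorm σ u ≤ linFunctional Ω σ A u

end Abreu

end

namespace Abreu

open scoped NNReal ENNReal

/-! ### The area formula for a parametrised hypersurface -/

/-! Everything rests on the identity `∫_{∂Ω} ψ dσ - ∫_Ω A ψ = ∫_Ω u^{ij} ψ_{ij}` for smooth `ψ`
(`ClassS.integral_trHess`), which writes the stability functional as the integral of a quantity that
is nonnegative when `ψ` is convex, because `(u^{ij})` is positive definite.

The boundary term comes from the behaviour of `u = ξ log ξ + f`. Near the boundary `D²u(v,v)` is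
asymptotically `dξ(v)²/ξ + log ξ · D²ξ(v,v)`, and strict convexity of the boundary makes `D²ξ`
negative on tangential vectors, so `D²u` blows up in all directions, like `1/ξ` transversally and
like `|log ξ|` tangentially. Hence `u^{ij} → 0` and `u^{ij} ξ_i ξ_j = ξ (1 + o(1))`
(`RemainderDecay.eventually_inverse`). Now replace `ψ` by `step(ξ/δ) ψ`, which has compact support
in `Ω`, integrate by parts twice and let `δ → 0`: the only surviving new term is `δ⁻¹ (ξ/δ)
step''(ξ/δ) ψ`. Since the normal derivative of `ξ` is `σ⁻¹`, its integral tends to `(∫ r step''(r)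
dr) ∫ ψ dσ = -∫ ψ dσ` (`IsAdapted.eventually_collar`, which needs the area formula to express
Hausdorff measure on the boundary in coordinates).

Coercivity is then a convexity argument for `ψ ≥ ψ(p₀) = 0`. Write `L` for `∫ u^{ij} ψ_{ij}` and `b`
for `∫ ψ dσ`. On a compact subset of `Ω` the Laplacian is controlled by `u^{ij} ψ_{ij}`; a radial
integration by parts and the mean value inequality, chained along balls starting from `p₀`, give `ψ
≤ D L` there (`ClassS.exists_bound_compact`). The tangent plane inequality from `x` to the point
dilated by `1 - τ` gives `ψ(x) ≤ D L + τ dψ(x)(x - p₀)`, and the divergence theorem bounds the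
integral of the last derivative by `C b`. Therefore `b = L + ∫ A ψ ≤ const · L + b/2` for small `τ`,
so `b ≤ const · L` (`ClassS.exists_boundary_le`).

Functions in the larger classes are reached through dilations about `p₀`, which make them smooth up
to the boundary or at least continuous there, and which increase to the original function as the
factor tends to `1`. The estimate thus extends to the limit class, together with `∫_Ω w ≤ C ∫ w dσ`.
For an extremal function the first estimate makes the boundary integral vanish and the second makes
`w` vanish on `Ω`. -/

theorem euclideanHausdorffMeasure_image_le_of_edist_le {X Y Z : Type*} [EMetricSpace Y]
    [MeasurableSpace Y] [BorelSpace Y] [EMetricSpace Z] [MeasurableSpace Z] [BorelSpace Z]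
    {h : X → Y} {f : X → Z} {S : Set X} {K : ℝ≥0}
    (hK : ∀ x ∈ S, ∀ y ∈ S, edist (f x) (f y) ≤ K * edist (h x) (h y)) (d : ℕ) :
    μHE[d] (f '' S) ≤ (K : ℝ≥0∞) ^ d * μHE[d] (h '' S) := by
  rcases S.eq_empty_or_nonempty with rfl | ⟨x₀, hx₀⟩
  · simp
  have : Nonempty X := ⟨x₀⟩
  -- The hypothesis forces `f x = f y` whenever `h x = h y`, so `f` factors on `S` through `h` by a
  -- `K`-Lipschitz map, and Lipschitz maps scale `d`-dimensional measure by at most `K ^ d`.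
  set φ : Y → Z := fun y => f (Function.invFunOn h S y) with hφ
  have key : ∀ x ∈ S, φ (h x) = f x := by
    intro x hx
    have hm : h x ∈ h '' S := mem_image_of_mem h hx
    have h1 := Function.invFunOn_mem hm
    have h2 := Function.invFunOn_eq hm
    have h3 := hK _ h1 x hx
    rw [h2, edist_self, mul_zero] at h3
    exact edist_le_zero.1 h3
  have him : f '' S = φ '' (h '' S) := by
    rw [image_image]
    exact image_congr fun x hx => (key x hx).symm
  have hL : LipschitzOnWith K φ (h '' S) := by
    rintro _ ⟨x, hx, rfl⟩ _ ⟨y, hy, rfl⟩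
    rw [key x hx, key y hy]
    exact hK x hx y hy
  rw [him, Measure.euclideanHausdorffMeasure_def, Measure.euclideanHausdorffMeasure_def,
    Measure.smul_apply, Measure.smul_apply, ENNReal.smul_def, smul_eq_mul, ENNReal.smul_def,
    smul_eq_mul]
  have := hL.hausdorffMeasure_image_le (d := (d : ℝ)) (by positivity)
  rw [ENNReal.rpow_natCast] at this
  calc _ ≤ _ := mul_le_mul_right this _
    _ = _ := by ring

variable {m : ℕ} {F : Type*} [NormedAddCommGroup F] [InnerProductSpace ℝ F]
  [FiniteDimensional ℝ F] [MeasurableSpace F] [BorelSpace F]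

theorem euclideanHausdorffMeasure_linear_image (L : E m →L[ℝ] F) (S : Set (E m)) :
    μHE[m] (L '' S) = ENNReal.ofReal L.toLinearMap.normDet * volume S := by
  have := LinearMap.euclideanHausdorffMeasure_image_eq_normDet_mul_volume L.toLinearMap S
  rw [finrank_euclideanSpace_fin] at this
  exact this

/-- The ratio of the surface area of the image of a small ball to the volume of the ball tends to
the norm determinant of the derivative. -/
theorem tendsto_euclideanHausdorffMeasure_image_closedBall_div {g : E m → F} {L : E m →L[ℝ] F}
    {x : E m} (hg : HasStrictFDerivAt g L x) (hL : Function.Injective L) :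
    Tendsto (fun r => μHE[m] (g '' Metric.closedBall x r) / volume (Metric.closedBall x r))
      (𝓝[>] 0) (𝓝 (ENNReal.ofReal L.toLinearMap.normDet)) := by
  obtain ⟨K, hK0, hK⟩ := L.toLinearMap.exists_antilipschitzWith (LinearMap.ker_eq_bot.2 hL)
  set J := ENNReal.ofReal L.toLinearMap.normDet with hJ
  have hbound : ∀ ε : ℝ≥0, ε < 1 → 0 < ε → ∀ᶠ r in 𝓝[>] (0 : ℝ),
      μHE[m] (g '' Metric.closedBall x r) / volume (Metric.closedBall x r) ≤
        ((1 + ε : ℝ≥0) : ℝ≥0∞) ^ m * J ∧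
      J ≤ (((1 - ε)⁻¹ : ℝ≥0) : ℝ≥0∞) ^ m *
        (μHE[m] (g '' Metric.closedBall x r) / volume (Metric.closedBall x r)) := by
    intro ε hε1 hε0
    -- With accuracy `ε / K` the linearisation error is at most `ε ‖L (y - z)‖`. Distances under `g`
    -- and under `L` are then comparable with factors `1 + ε` and `(1 - ε)⁻¹`, and the Hausdorff
    -- measure comparison applies in both directions.
    have happ := hg.approximates_deriv_on_nhds (c := ε / K) (Or.inr (by positivity))
    obtain ⟨s, hs, happ⟩ := happ
    obtain ⟨r₀, hr₀, hball⟩ := Metric.nhds_basis_closedBall.mem_iff.1 hs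
    filter_upwards [Ioc_mem_nhdsGT hr₀] with r hr
    have hsub : Metric.closedBall x r ⊆ s := (Metric.closedBall_subset_closedBall hr.2).trans hball
    have hv0 : volume (Metric.closedBall x r) ≠ 0 :=
      (Metric.measure_closedBall_pos volume x hr.1).ne'
    have hvt : volume (Metric.closedBall x r) ≠ ⊤ := measure_closedBall_lt_top.ne
    have herr : ∀ y ∈ Metric.closedBall x r, ∀ z ∈ Metric.closedBall x r,
        ‖g y - g z - L (y - z)‖ ≤ ε * ‖L (y - z)‖ := by
      intro y hy z hz
      have h1 := happ y (hsub hy) z (hsub hz)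
      have h2 : ‖y - z‖ ≤ K * ‖L (y - z)‖ := by
        have := hK.le_mul_dist y z
        rw [dist_eq_norm, dist_eq_norm] at this
        simpa [map_sub] using this
      calc _ ≤ ((ε / K : ℝ≥0) : ℝ) * ‖y - z‖ := h1
        _ ≤ ((ε / K : ℝ≥0) : ℝ) * (K * ‖L (y - z)‖) := by gcongr
        _ = ε * ‖L (y - z)‖ := by
          push_cast
          field_simp
    have e1 : ∀ y z : E m, edist (g y) (g z) = ENNReal.ofReal ‖g y - g z‖ := fun y z => by
      rw [edist_dist, dist_eq_norm]
    have e2 : ∀ y z : E m, edist (L y) (L z) = ENNReal.ofReal ‖L (y - z)‖ := fun y z => by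
      rw [edist_dist, dist_eq_norm, map_sub]
    constructor
    · have h := euclideanHausdorffMeasure_image_le_of_edist_le (h := L) (f := g)
        (S := Metric.closedBall x r) (K := 1 + ε) (fun y hy z hz => by
          rw [e1, e2, ENNReal.coe_nnreal_eq, ← ENNReal.ofReal_mul (by positivity)]
          apply ENNReal.ofReal_le_ofReal
          have := herr y hy z hz
          have h3 := norm_sub_norm_le (g y - g z) (L (y - z))
          push_cast
          linarith) m
      rw [euclideanHausdorffMeasure_linear_image] at h
      rw [ENNReal.div_le_iff hv0 hvt]
      rwa [mul_assoc]
    · have h := euclideanHausdorffMeasure_image_le_of_edist_le (h := g) (f := L)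
        (S := Metric.closedBall x r) (K := (1 - ε)⁻¹) (fun y hy z hz => by
          rw [e1, e2, ENNReal.coe_nnreal_eq, ← ENNReal.ofReal_mul (by positivity)]
          apply ENNReal.ofReal_le_ofReal
          have := herr y hy z hz
          have h3 := norm_sub_norm_le (L (y - z)) (g y - g z)
          rw [norm_sub_rev (L (y - z)) (g y - g z)] at h3
          rw [NNReal.coe_inv, NNReal.coe_sub hε1.le, NNReal.coe_one, inv_mul_eq_div,
            le_div_iff₀ (sub_pos.2 (by exact_mod_cast hε1))]
          linarith) m
      rw [euclideanHausdorffMeasure_linear_image] at h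
      rw [← mul_div_assoc, ENNReal.le_div_iff_mul_le (Or.inl hv0) (Or.inl hvt)]
      exact h
  have hJt : J ≠ ⊤ := ENNReal.ofReal_ne_top
  refine tendsto_order.2 ⟨fun a ha => ?_, fun a ha => ?_⟩
  · have : Tendsto (fun ε : ℝ≥0 => (((1 - ε)⁻¹ : ℝ≥0) : ℝ≥0∞) ^ m * a) (𝓝[>] 0) (𝓝 a) := by
      have h1 : Tendsto (fun ε : ℝ≥0 => (1 - ε)⁻¹) (𝓝[>] 0) (𝓝 1) := by
        have : ContinuousAt (fun ε : ℝ≥0 => (1 - ε)⁻¹) 0 := by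
          apply ContinuousAt.inv₀ (by fun_prop); simp
        have h2 := this.tendsto
        simp only [tsub_zero, inv_one] at h2
        exact h2.mono_left nhdsWithin_le_nhds
      have h2 := (ENNReal.Tendsto.pow (n := m) (ENNReal.tendsto_coe.2 h1))
      have h3 := ENNReal.Tendsto.mul_const (b := a) h2 (Or.inr (ha.trans_le le_top).ne)
      simpa using h3
    have hev := (this.eventually_lt_const ha).and
      (Ioo_mem_nhdsGT (zero_lt_one (α := ℝ≥0)))
    obtain ⟨ε, hε, hε0, hε1⟩ := hev.exists
    filter_upwards [hbound ε hε1 hε0] with r hr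
    by_contra hcon
    push Not at hcon
    exact absurd (hr.2.trans (mul_le_mul_right hcon _)) (not_le.2 hε)
  · have : Tendsto (fun ε : ℝ≥0 => ((1 + ε : ℝ≥0) : ℝ≥0∞) ^ m * J) (𝓝[>] 0) (𝓝 J) := by
      have h1 : Tendsto (fun ε : ℝ≥0 => 1 + ε) (𝓝[>] 0) (𝓝 1) := by
        have : ContinuousAt (fun ε : ℝ≥0 => 1 + ε) 0 := by fun_prop
        have h2 := this.tendsto
        simp only [add_zero] at h2
        exact h2.mono_left nhdsWithin_le_nhds
      have h2 := (ENNReal.Tendsto.pow (n := m) (ENNReal.tendsto_coe.2 h1))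
      have h3 := ENNReal.Tendsto.mul_const (b := J) h2 (Or.inr hJt)
      simpa using h3
    have hev := (this.eventually_lt_const ha).and
      (Ioo_mem_nhdsGT (zero_lt_one (α := ℝ≥0)))
    obtain ⟨ε, hε, hε0, hε1⟩ := hev.exists
    filter_upwards [hbound ε hε1 hε0] with r hr
    exact hr.1.trans_lt hε

/-- The area formula: the surface measure of the image of an open set `V ⊆ ℝᵐ` under an injective
Lipschitz immersion `g` is the push-forward of the measure with density `|det Dg|` on `V`. -/
theorem restrict_image_euclideanHausdorffMeasure {V : Set (E m)} (hV : IsOpen V)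
    (hVfin : volume V ≠ ⊤) {g : E m → F} {g' : E m → E m →L[ℝ] F} {K : ℝ≥0}
    (hlip : LipschitzOnWith K g V) (hinj : InjOn g V)
    (hg : ∀ x ∈ V, HasStrictFDerivAt g (g' x) x) (hg' : ∀ x ∈ V, Function.Injective (g' x)) :
    MeasurableEmbedding (V.domRestrict g) ∧ (μHE[m] : Measure F).restrict (g '' V) =
      (Measure.comap (Subtype.val : V → E m) (volume.withDensity fun x =>
        ENNReal.ofReal (g' x).toLinearMap.normDet)).map (V.domRestrict g) := by
  have hemb : MeasurableEmbedding (V.domRestrict g) :=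
    hlip.continuousOn.measurableEmbedding hV.measurableSet hinj
  refine ⟨hemb, ?_⟩
  have hval : MeasurableEmbedding (Subtype.val : V → E m) :=
    MeasurableEmbedding.subtype_coe hV.measurableSet
  set ρ : Measure (E m) := (Measure.comap (V.domRestrict g) μHE[m]).map Subtype.val with hρ
  have hρapp : ∀ B : Set (E m), ρ B = μHE[m] (g '' (B ∩ V)) := by
    intro B
    rw [hρ, hval.map_apply, hemb.comap_apply]
    congr 1
    ext y
    simp only [mem_image, mem_preimage, Subtype.exists, domRestrict_apply]
    constructor
    · rintro ⟨a, b, c, d⟩; exact ⟨a, ⟨c, b⟩, d⟩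
    · rintro ⟨a, ⟨b, c⟩, d⟩; exact ⟨a, c, b, d⟩
  have hρle : ∀ B : Set (E m), ρ B ≤ (K : ℝ≥0∞) ^ m * volume (B ∩ V) := by
    intro B
    rw [hρapp]
    have h := euclideanHausdorffMeasure_image_le_of_edist_le (h := (id : E m → E m)) (f := g)
      (S := B ∩ V) (K := K) (fun y hy z hz => hlip hy.2 hz.2) m
    rwa [image_id, EuclideanSpace.euclideanHausdorffMeasure_eq_volume] at h
  have : IsFiniteMeasure ρ := by
    refine ⟨(hρle univ).trans_lt ?_⟩
    rw [univ_inter]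
    exact ENNReal.mul_lt_top (by simp) hVfin.lt_top
  have hac : ρ ≪ volume := by
    intro B hB
    refine le_antisymm ((hρle B).trans ?_) bot_le
    rw [measure_mono_null inter_subset_left hB, mul_zero]
  have hdens : ∀ᵐ x ∂(volume : Measure (E m)), x ∈ V →
      ρ.rnDeriv volume x = ENNReal.ofReal (g' x).toLinearMap.normDet := by
    filter_upwards [Besicovitch.ae_tendsto_rnDeriv ρ volume] with x hx hxV
    refine tendsto_nhds_unique hx
      ((tendsto_euclideanHausdorffMeasure_image_closedBall_div (hg x hxV) (hg' x hxV)).congr' ?_)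
    obtain ⟨r₀, hr₀, hball⟩ := Metric.nhds_basis_closedBall.mem_iff.1 (hV.mem_nhds hxV)
    filter_upwards [Ioc_mem_nhdsGT hr₀] with r hr
    rw [hρapp, inter_eq_left.2 ((Metric.closedBall_subset_closedBall hr.2).trans hball)]
  have hρV : Measure.comap (V.domRestrict g) μHE[m] =
      Measure.comap (Subtype.val : V → E m) (volume.withDensity fun x =>
        ENNReal.ofReal (g' x).toLinearMap.normDet) := by
    have h1 : Measure.comap (V.domRestrict g) μHE[m] = Measure.comap (Subtype.val : V → E m) ρ := by
      rw [hρ, hval.comap_map]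
    rw [h1, ← Measure.withDensity_rnDeriv_eq ρ volume hac]
    ext B hB
    rw [hval.comap_apply, hval.comap_apply, withDensity_apply _ (hval.measurableSet_image.2 hB),
      withDensity_apply _ (hval.measurableSet_image.2 hB)]
    refine setLIntegral_congr_fun_ae (hval.measurableSet_image.2 hB) ?_
    filter_upwards [hdens] with x hx hxB
    obtain ⟨y, -, rfl⟩ := hxB
    exact hx y.2
  rw [← hρV, hemb.map_comap, range_domRestrict]

/-- The area formula for integrals. -/
theorem setIntegral_image_euclideanHausdorffMeasure {V : Set (E m)} (hV : IsOpen V)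
    (hVfin : volume V ≠ ⊤) {g : E m → F} {g' : E m → E m →L[ℝ] F} {K : ℝ≥0}
    (hlip : LipschitzOnWith K g V) (hinj : InjOn g V)
    (hg : ∀ x ∈ V, HasStrictFDerivAt g (g' x) x) (hg' : ∀ x ∈ V, Function.Injective (g' x))
    (hmeas : AEMeasurable (fun x => (g' x).toLinearMap.normDet) (volume.restrict V))
    (ψ : F → ℝ) :
    ∫ y in g '' V, ψ y ∂μHE[m] = ∫ x in V, (g' x).toLinearMap.normDet * ψ (g x) := by
  obtain ⟨hemb, h⟩ := restrict_image_euclideanHausdorffMeasure hV hVfin hlip hinj hg hg'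
  have hval : MeasurableEmbedding (Subtype.val : V → E m) :=
    MeasurableEmbedding.subtype_coe hV.measurableSet
  rw [h, hemb.integral_map]
  have h2 := hval.integral_map (μ := Measure.comap (Subtype.val : V → E m)
    (volume.withDensity fun x => ENNReal.ofReal (g' x).toLinearMap.normDet)) fun x => ψ (g x)
  rw [hval.map_comap, Subtype.range_coe] at h2
  refine h2.symm.trans ?_
  rw [restrict_withDensity hV.measurableSet,
    integral_withDensity_eq_integral_toReal_smul₀ hmeas.ennreal_ofReal
      (ae_of_all _ fun _ => ENNReal.ofReal_lt_top)]
  refine integral_congr_ae (ae_of_all _ fun x => ?_)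
  simp only [smul_eq_mul, ENNReal.toReal_ofReal (LinearMap.normDet_nonneg _)]

theorem euclideanHausdorffMeasure_image_lt_top {V : Set (E m)} (hVfin : volume V ≠ ⊤) {g : E m → F}
    {K : ℝ≥0} (hlip : LipschitzOnWith K g V) : μHE[m] (g '' V) < ⊤ := by
  have h := euclideanHausdorffMeasure_image_le_of_edist_le (h := (id : E m → E m)) (f := g)
    (S := V) (K := K) (fun y hy z hz => hlip hy hz) m
  rw [image_id, EuclideanSpace.euclideanHausdorffMeasure_eq_volume] at h
  exact h.trans_lt (ENNReal.mul_lt_top (by simp) hVfin.lt_top)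

end Abreu

namespace Abreu

open scoped NNReal ENNReal

/-! ### Adapted coordinates -/

/-- The coordinate functional `y ↦ yᵢ`. -/
noncomputable def coordL {n : ℕ} (i : Fin n) : E n →L[ℝ] ℝ := EuclideanSpace.proj i

@[simp] theorem coordL_apply {n : ℕ} (i : Fin n) (y : E n) : coordL i y = y i := rfl

section Chart

variable {n : ℕ} [NeZero n] {Ω : Set (E n)} {s : E n → ℝ} {P : E n}
  {Φ : OpenPartialHomeomorph (E n) (E n)}

theorem IsAdapted.contDiffAt (h : IsAdapted Ω s P Φ) {x : E n} (hx : x ∈ Φ.source) :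
    ContDiffAt ℝ ∞ Φ x :=
  h.smooth.contDiffAt (Φ.open_source.mem_nhds hx)

theorem IsAdapted.contDiffAt_symm (h : IsAdapted Ω s P Φ) {y : E n} (hy : y ∈ Φ.target) :
    ContDiffAt ℝ ∞ Φ.symm y :=
  h.smooth_symm.contDiffAt (Φ.open_target.mem_nhds hy)

theorem IsAdapted.contDiffAt_coord (h : IsAdapted Ω s P Φ) {x : E n} (hx : x ∈ Φ.source) :
    ContDiffAt ℝ ∞ (fun y => Φ y 0) x :=
  (coordL (0 : Fin n)).contDiff.contDiffAt.comp x (h.contDiffAt hx)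

theorem IsAdapted.hasFDerivAt (h : IsAdapted Ω s P Φ) {x : E n} (hx : x ∈ Φ.source) :
    HasFDerivAt Φ (fderiv ℝ Φ x) x :=
  ((h.contDiffAt hx).differentiableAt (by simp)).hasFDerivAt

theorem IsAdapted.hasFDerivAt_symm (h : IsAdapted Ω s P Φ) {y : E n} (hy : y ∈ Φ.target) :
    HasFDerivAt Φ.symm (fderiv ℝ Φ.symm y) y :=
  ((h.contDiffAt_symm hy).differentiableAt (by simp)).hasFDerivAt

theorem IsAdapted.fderiv_coord (h : IsAdapted Ω s P Φ) {x : E n} (hx : x ∈ Φ.source) :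
    fderiv ℝ (fun y => Φ y 0) x = (coordL 0).comp (fderiv ℝ Φ x) :=
  ((coordL (0 : Fin n)).hasFDerivAt.comp x (h.hasFDerivAt hx)).fderiv

theorem IsAdapted.fderiv_fderiv_symm (h : IsAdapted Ω s P Φ) {y : E n} (hy : y ∈ Φ.target)
    (v : E n) : fderiv ℝ Φ (Φ.symm y) (fderiv ℝ Φ.symm y v) = v := by
  have h1 := (h.hasFDerivAt (Φ.map_target hy)).comp y (h.hasFDerivAt_symm hy)
  have h2 : HasFDerivAt (Φ ∘ Φ.symm) (ContinuousLinearMap.id ℝ (E n)) y :=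
    (hasFDerivAt_id y).congr_of_eventuallyEq (by
      filter_upwards [Φ.open_target.mem_nhds hy] with z hz using Φ.right_inv hz)
  exact DFunLike.congr_fun (h1.unique h2) v

theorem IsAdapted.fderiv_symm_fderiv (h : IsAdapted Ω s P Φ) {x : E n} (hx : x ∈ Φ.source)
    (v : E n) : fderiv ℝ Φ.symm (Φ x) (fderiv ℝ Φ x v) = v := by
  have h1 := (h.hasFDerivAt_symm (Φ.map_source hx)).comp x (h.hasFDerivAt hx)
  have h2 : HasFDerivAt (Φ.symm ∘ Φ) (ContinuousLinearMap.id ℝ (E n)) x :=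
    (hasFDerivAt_id x).congr_of_eventuallyEq (by
      filter_upwards [Φ.open_source.mem_nhds hx] with z hz using Φ.left_inv hz)
  exact DFunLike.congr_fun (h1.unique h2) v

theorem IsAdapted.fderiv_coord_symm (h : IsAdapted Ω s P Φ) {y : E n} (hy : y ∈ Φ.target)
    (v : E n) : fderiv ℝ (fun y => Φ y 0) (Φ.symm y) (fderiv ℝ Φ.symm y v) = v 0 := by
  rw [h.fderiv_coord (Φ.map_target hy), ContinuousLinearMap.comp_apply, h.fderiv_fderiv_symm hy,
    coordL_apply]

omit [NeZero n] in
/-- The derivative of a nonnegative function on `Ω` that vanishes at a boundary point is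
nonnegative in the directions that point into `Ω`. -/
theorem fderiv_nonneg_of_mem {Ω : Set (E n)} (hΩ : IsOpen Ω) (hconv : Convex ℝ Ω) {x : E n}
    (hx : x ∈ frontier Ω) {g : E n → ℝ} (hg : DifferentiableAt ℝ g x) (hgx : g x = 0)
    (hpos : ∀ᶠ z in 𝓝 x, z ∈ Ω → 0 ≤ g z) {y : E n} (hy : y ∈ Ω) :
    0 ≤ fderiv ℝ g x (y - x) := by
  have hline : HasDerivAt (fun t : ℝ => x + t • (y - x)) (y - x) 0 := by
    simpa using ((hasDerivAt_id (0 : ℝ)).smul_const (y - x)).const_add x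
  have hd : HasDerivAt (fun t : ℝ => g (x + t • (y - x))) (fderiv ℝ g x (y - x)) 0 := by
    have : HasFDerivAt g (fderiv ℝ g x) (x + (0 : ℝ) • (y - x)) := by
      simpa using hg.hasFDerivAt
    exact this.comp_hasDerivAt 0 hline
  have hslope := (hasDerivAt_iff_tendsto_slope.1 hd).mono_left
    (nhdsWithin_mono (0 : ℝ) (fun t (ht : 0 < t) => ht.ne') : 𝓝[>] (0 : ℝ) ≤ 𝓝[≠] 0)
  refine ge_of_tendsto hslope ?_
  have hc : Tendsto (fun t : ℝ => x + t • (y - x)) (𝓝[>] 0) (𝓝 x) := by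
    have := hline.continuousAt.tendsto
    simp only [zero_smul, add_zero] at this
    exact this.mono_left nhdsWithin_le_nhds
  filter_upwards [hc.eventually hpos, Ioc_mem_nhdsGT (zero_lt_one (α := ℝ))] with t ht ht01
  have hmem : x + t • (y - x) ∈ Ω := by
    have := hconv.add_smul_sub_mem_interior' hx.1 (by rwa [hΩ.interior_eq]) ht01
    rwa [hΩ.interior_eq] at this
  rw [slope_def_field]
  simp only [zero_smul, add_zero, hgx, sub_zero]
  exact div_nonneg (ht hmem) ht01.1.le

-- The normal is the normalised gradient of `g`. It points inward because a function that vanishes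
-- at `x` and is nonnegative on `Ω` near `x` has nonnegative derivative towards every point of the
-- convex set `Ω`.
omit [NeZero n] in
theorem isInwardUnitNormal_of_fderiv {Ω : Set (E n)} (hΩ : IsOpen Ω) (hconv : Convex ℝ Ω) {x : E n}
    (hx : x ∈ frontier Ω) {g : E n → ℝ} (hg : DifferentiableAt ℝ g x) (hgx : g x = 0)
    (hpos : ∀ᶠ z in 𝓝 x, z ∈ Ω → 0 ≤ g z) (hne : fderiv ℝ g x ≠ 0) :
    ∃ ν : E n, IsInwardUnitNormal Ω x ν ∧ 0 < ‖fderiv ℝ g x‖ ∧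
      ∀ v, fderiv ℝ g x v = ‖fderiv ℝ g x‖ * inner ℝ ν v := by
  set w := (InnerProductSpace.toDual ℝ (E n)).symm (fderiv ℝ g x) with hw
  have hwn : ‖w‖ = ‖fderiv ℝ g x‖ := LinearIsometryEquiv.norm_map _ _
  have hpos' : 0 < ‖fderiv ℝ g x‖ := norm_pos_iff.2 hne
  have hin : ∀ v, inner ℝ w v = fderiv ℝ g x v := fun v => by
    rw [hw, InnerProductSpace.toDual_symm_apply]
  have hv : ∀ v, fderiv ℝ g x v = ‖fderiv ℝ g x‖ * inner ℝ (‖fderiv ℝ g x‖⁻¹ • w) v := by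
    intro v
    rw [real_inner_smul_left, hin]
    field_simp
  refine ⟨‖fderiv ℝ g x‖⁻¹ • w, ⟨?_, ?_⟩, hpos', hv⟩
  · rw [norm_smul, hwn, norm_inv, norm_norm, inv_mul_cancel₀ hpos'.ne']
  · intro y hy
    have := fderiv_nonneg_of_mem hΩ hconv hx hg hgx hpos hy
    rw [hv] at this
    exact nonneg_of_mul_nonneg_right this hpos'

theorem IsAdapted.fderiv_coord_ne_zero (h : IsAdapted Ω s P Φ) {x : E n} (hx : x ∈ Φ.source) :
    fderiv ℝ (fun y => Φ y 0) x ≠ 0 := by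
  intro h0
  have := h.fderiv_coord_symm (Φ.map_source hx) (stdVec 0)
  rw [Φ.left_inv hx, h0] at this
  simp at this

/-- The adapted condition prescribes `dξ` only on the normal. Since `dξ` is a multiple of pairing
with the normal, evaluating at `ν` identifies the multiple. -/
theorem IsAdapted.exists_normal (h : IsAdapted Ω s P Φ) (hΩ : IsOpen Ω) (hconv : Convex ℝ Ω)
    {x : E n} (hx : x ∈ Φ.source) (hxf : x ∈ frontier Ω) :
    ∃ ν : E n, IsInwardUnitNormal Ω x ν ∧
      ∀ v, fderiv ℝ (fun y => Φ y 0) x v = (s x)⁻¹ * inner ℝ ν v := by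
  obtain ⟨ν, hν, hpos, hv⟩ := isInwardUnitNormal_of_fderiv hΩ hconv hxf
    ((h.contDiffAt_coord hx).differentiableAt (by simp)) ((h.mem_frontier_iff x hx).1 hxf)
    (by filter_upwards [Φ.open_source.mem_nhds hx] with z hz hzΩ using
      ((h.mem_iff z hz).1 hzΩ).le) (h.fderiv_coord_ne_zero hx)
  refine ⟨ν, hν, fun v => ?_⟩
  have h1 := h.normal_deriv x hx hxf ν hν
  have h2 := hv ν
  rw [real_inner_self_eq_norm_sq, hν.1, h1] at h2
  rw [hv v, h2]
  simp

end Chart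

/-! ### Splitting off the first coordinate -/

/-- The map `(t, η) ↦ (t, η₁, …, ηₘ)`. -/
noncomputable def consL (m : ℕ) : (ℝ × E m) →L[ℝ] E (m + 1) :=
  LinearMap.toContinuousLinearMap
    { toFun := fun p => WithLp.toLp 2 (Fin.cons p.1 p.2 : Fin (m + 1) → ℝ)
      map_add' := fun p q => by
        ext i
        refine Fin.cases ?_ (fun j => ?_) i <;> simp
      map_smul' := fun c p => by
        ext i
        refine Fin.cases ?_ (fun j => ?_) i <;> simp }

@[simp] theorem consL_zero {m : ℕ} (p : ℝ × E m) : consL m p 0 = p.1 := rfl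

@[simp] theorem consL_succ {m : ℕ} (p : ℝ × E m) (j : Fin m) : consL m p j.succ = p.2 j := rfl

theorem consL_injective (m : ℕ) : Function.Injective (consL m) := by
  rintro ⟨t, η⟩ ⟨t', η'⟩ h
  ext j
  · exact congrArg (fun z : E (m + 1) => z 0) h
  · exact congrArg (fun z : E (m + 1) => z j.succ) h

theorem exists_consL_eq {m : ℕ} (y : E (m + 1)) :
    consL m (y 0, WithLp.toLp 2 fun j => y j.succ) = y := by
  ext i
  refine Fin.cases ?_ (fun j => ?_) i <;> simp

theorem measurePreserving_consL (m : ℕ) :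
    MeasurePreserving (consL m) volume volume ∧ MeasurableEmbedding (consL m) := by
  have h1 := ((PiLp.volume_preserving_toLp (Fin (m + 1))).comp
    (volume_preserving_piFinSuccAbove (fun _ : Fin (m + 1) => ℝ) 0).symm).comp
    ((MeasurePreserving.id (volume : Measure ℝ)).prod (PiLp.volume_preserving_ofLp (Fin m)))
  have h2 : (WithLp.toLp 2 ∘ (MeasurableEquiv.piFinSuccAbove (fun _ : Fin (m + 1) => ℝ) 0).symm) ∘
      Prod.map id (WithLp.ofLp : E m → _) = consL m := by
    funext p
    ext i
    refine Fin.cases ?_ (fun j => ?_) i <;> simp [MeasurableEquiv.piFinSuccAbove]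
  rw [h2] at h1
  exact ⟨h1, (consL m).continuous.measurableEmbedding (consL_injective m)⟩

/-- The inclusion `η ↦ (0, η)` of the boundary of the half-space. -/
noncomputable def sliceL (m : ℕ) : E m →L[ℝ] E (m + 1) := (consL m).comp (ContinuousLinearMap.inr ℝ ℝ (E m))

theorem sliceL_apply {m : ℕ} (η : E m) : sliceL m η = consL m (0, η) := rfl

theorem sliceL_stdVec {m : ℕ} (j : Fin m) : sliceL m (stdVec j) = stdVec j.succ := by
  ext i
  rw [sliceL_apply]
  refine Fin.cases ?_ (fun k => ?_) i
  · simp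
  · simp

/-- The change of volume under a linear map and under its restriction to a hyperplane. -/
theorem abs_det_eq_mul_normDet {m : ℕ} (D : E (m + 1) →L[ℝ] E (m + 1)) {ν : E (m + 1)} {c : ℝ}
    (hc : 0 < c) (hν : ‖ν‖ = 1) (hD : ∀ v, inner ℝ ν (D v) = c * v 0) :
    |D.det| = c * (D.comp (sliceL m)).toLinearMap.normDet := by
  classical
  have horth : Orthonormal ℝ (Set.domRestrict {(0 : Fin (m + 1))} fun _ => ν) := by
    refine ⟨fun _ => hν, fun i j hij => absurd (Subsingleton.elim i j) hij⟩
  -- In an orthonormal basis of the target starting with `ν`, the first row of the matrix of `D` is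
  -- `(c, 0, …, 0)`. The determinant is `c` times a minor, and the Gram determinant of the remaining
  -- columns is the square of that minor.
  obtain ⟨b, hb⟩ := horth.exists_orthonormalBasis_extension_of_card_eq
    (by rw [finrank_euclideanSpace_fin, Fintype.card_fin])
  have hb0 : b 0 = ν := hb 0 (by simp)
  set M : Matrix (Fin (m + 1)) (Fin (m + 1)) ℝ :=
    Matrix.of fun i j => inner ℝ (b i) (D (stdVec j)) with hM
  have hdet : |D.det| = |M.det| := by
    have h1 := D.toLinearMap.normDet_eq_norm_det_toMatrix
      (EuclideanSpace.basisFun (Fin (m + 1)) ℝ) b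
    have h2 := D.toLinearMap.normDet_eq_norm_det
    have h3 : LinearMap.toMatrix (EuclideanSpace.basisFun (Fin (m + 1)) ℝ).toBasis b.toBasis
        D.toLinearMap = M := by
      ext i j
      simp [LinearMap.toMatrix_apply, hM, OrthonormalBasis.repr_apply_apply]
    rw [h3] at h1
    rw [h1] at h2
    simpa [ContinuousLinearMap.det] using h2.symm
  have hrow : ∀ j : Fin m, M 0 j.succ = 0 := by
    intro j
    simp [hM, hb0, hD]
  have hM00 : M 0 0 = c := by simp [hM, hb0, hD]
  set M' : Matrix (Fin m) (Fin m) ℝ := M.submatrix Fin.succ Fin.succ with hM'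
  have hdetM : M.det = c * M'.det := by
    rw [Matrix.det_succ_row_zero, Fin.sum_univ_succ]
    simp [hrow, hM00, hM']
  have hgram : (D.comp (sliceL m)).toLinearMap.normDet ^ 2 = M'.det ^ 2 := by
    have h1 := (D.comp (sliceL m)).toLinearMap.normDet_sq_eq_det_gram
      (EuclideanSpace.basisFun (Fin m) ℝ)
    have h2 : Matrix.gram ℝ (fun i => (D.comp (sliceL m)).toLinearMap
        (EuclideanSpace.basisFun (Fin m) ℝ i)) = M'.transpose * M' := by
      ext j k
      rw [Matrix.gram_apply, ← b.sum_inner_mul_inner, Fin.sum_univ_succ, Matrix.mul_apply]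
      have h3 : ∀ j : Fin m, (D.comp (sliceL m)).toLinearMap
          (EuclideanSpace.basisFun (Fin m) ℝ j) = D (stdVec j.succ) := by
        intro j
        simp [sliceL_stdVec]
      rw [h3, h3, hb0, hD (stdVec k.succ)]
      simp only [hM', hM, Matrix.transpose_apply, Matrix.submatrix_apply, Matrix.of_apply]
      simp only [real_inner_comm]
      simp
    rw [h2, Matrix.det_mul, Matrix.det_transpose] at h1
    simpa [sq] using h1
  have h0 := LinearMap.normDet_nonneg (D.comp (sliceL m)).toLinearMap
  rw [hdet, hdetM, abs_mul, abs_of_pos hc, ← sq_eq_sq₀ (by positivity) (by positivity)]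
  rw [mul_pow, sq_abs, mul_pow, hgram]

end Abreu

namespace Abreu

open scoped NNReal ENNReal

/-! ### Functions extended by zero -/

section Indicator

variable {X : Type*} [NormedAddCommGroup X] [NormedSpace ℝ X] {U K : Set X} {g : X → ℝ}

theorem indicator_eventuallyEq (hU : IsOpen U) {x : X} (hx : x ∈ U) : U.indicator g =ᶠ[𝓝 x] g := by
  filter_upwards [hU.mem_nhds hx] with z hz using indicator_of_mem hz g

theorem indicator_eventuallyEq_zero (hK : IsClosed K) (hg : ∀ x ∈ U, x ∉ K → g x = 0) {x : X}
    (hx : x ∉ K) : U.indicator g =ᶠ[𝓝 x] fun _ => 0 := by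
  filter_upwards [hK.isOpen_compl.mem_nhds hx] with z hz
  by_cases hzU : z ∈ U
  · rw [indicator_of_mem hzU, hg z hzU hz]
  · exact indicator_of_notMem hzU g

/-- The open sets `U` and `Kᶜ` cover the space, and the extension is locally `g` on the first and
zero on the second. It globalises expressions that make sense only on the domain of a chart. -/
theorem contDiff_indicator {k : WithTop ℕ∞} (hU : IsOpen U) (hK : IsClosed K) (hKU : K ⊆ U)
    (hg : ∀ x ∈ U, x ∉ K → g x = 0) (hc : ContDiffOn ℝ k g U) : ContDiff ℝ k (U.indicator g) := by
  rw [contDiff_iff_contDiffAt]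
  intro x
  by_cases hx : x ∈ K
  · exact (hc.contDiffAt (hU.mem_nhds (hKU hx))).congr_of_eventuallyEq
      (indicator_eventuallyEq hU (hKU hx))
  · exact contDiffAt_const.congr_of_eventuallyEq (indicator_eventuallyEq_zero hK hg hx)

theorem continuous_indicator_of_isClosed (hU : IsOpen U) (hK : IsClosed K) (hKU : K ⊆ U)
    (hg : ∀ x ∈ U, x ∉ K → g x = 0) (hc : ContinuousOn g U) : Continuous (U.indicator g) :=
  contDiff_zero.1 (contDiff_indicator hU hK hKU hg (contDiffOn_zero.2 hc))

theorem tsupport_indicator_subset (hK : IsClosed K) (hg : ∀ x ∈ U, x ∉ K → g x = 0) :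
    tsupport (U.indicator g) ⊆ K := by
  refine closure_minimal (fun x hx => ?_) hK
  by_contra hxK
  exact hx (indicator_eventuallyEq_zero hK hg hxK).self_of_nhds

end Indicator

/-! ### The boundary measure in adapted coordinates -/

theorem aemeasurable_density {n : ℕ} {Ω : Set (E n)} {s : E n → ℝ}
    (hs : IsSmoothPositiveDensity Ω s) (μ : Measure (E n)) :
    AEMeasurable s (μ.restrict (frontier Ω)) :=
  hs.smooth.continuousOn.aemeasurable isClosed_frontier.measurableSet

theorem integral_boundaryMeasure {n : ℕ} {Ω : Set (E n)} {s : E n → ℝ}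
    (hs : IsSmoothPositiveDensity Ω s) (ψ : E n → ℝ) :
    ∫ x, ψ x ∂boundaryMeasure Ω s = ∫ x in frontier Ω, s x * ψ x ∂μHE[n - 1] := by
  rw [boundaryMeasure, integral_withDensity_eq_integral_toReal_smul₀
    (aemeasurable_density hs _).ennreal_ofReal (ae_of_all _ fun _ => ENNReal.ofReal_lt_top)]
  refine setIntegral_congr_fun isClosed_frontier.measurableSet fun x hx => ?_
  simp only [smul_eq_mul, ENNReal.toReal_ofReal (hs.pos x hx).le]

/-- The coordinate ball of radius `r` around `P`. -/
def chartBall {n : ℕ} (Φ : OpenPartialHomeomorph (E n) (E n)) (P : E n) (r : ℝ) : Set (E n) :=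
  Φ.source ∩ Φ ⁻¹' Metric.ball (Φ P) r

section ChartBall

variable {n : ℕ} {P : E n} {Φ : OpenPartialHomeomorph (E n) (E n)} {r : ℝ}

theorem isOpen_chartBall : IsOpen (chartBall Φ P r) :=
  Φ.isOpen_inter_preimage Metric.isOpen_ball

theorem chartBall_subset_source : chartBall Φ P r ⊆ Φ.source := inter_subset_left

theorem mem_chartBall_self (hP : P ∈ Φ.source) (hr : 0 < r) : P ∈ chartBall Φ P r :=
  mem_inter hP (mem_preimage.2 (Metric.mem_ball_self hr))

theorem chartBall_eq_image (h : Metric.ball (Φ P) r ⊆ Φ.target) :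
    chartBall Φ P r = Φ.symm '' Metric.ball (Φ P) r := by
  rw [Φ.symm_image_eq_source_inter_preimage h, chartBall]

end ChartBall

variable {m : ℕ} {Ω : Set (E (m + 1))} {s : E (m + 1) → ℝ} {P : E (m + 1)}
  {Φ : OpenPartialHomeomorph (E (m + 1)) (E (m + 1))}

/-- Here the normalisation of `ξ` enters: the normal component of the image of `v` under the inverse
chart is `s · v 0`, so the density of `σ` is exactly the ratio of the full Jacobian to the
tangential one. In coordinates, `σ` therefore has the full Jacobian as its density. -/
theorem IsAdapted.abs_det_fderiv_symm (h : IsAdapted Ω s P Φ) (hΩ : IsOpen Ω) (hconv : Convex ℝ Ω)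
    (hs : IsSmoothPositiveDensity Ω s) {η : E m} (hη : sliceL m η ∈ Φ.target) :
    |(fderiv ℝ Φ.symm (sliceL m η)).det| = s (Φ.symm (sliceL m η)) *
      ((fderiv ℝ Φ.symm (sliceL m η)).comp (sliceL m)).toLinearMap.normDet := by
  have hx := Φ.map_target hη
  have hxf : Φ.symm (sliceL m η) ∈ frontier Ω := by
    rw [h.mem_frontier_iff _ hx, Φ.right_inv hη, sliceL_apply, consL_zero]
  have hpos := hs.pos _ hxf
  obtain ⟨ν, hν, hv⟩ := h.exists_normal hΩ hconv hx hxf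
  refine abs_det_eq_mul_normDet _ hpos hν.1 fun v => ?_
  rw [← h.fderiv_coord_symm hη v, hv]
  field_simp

/-- The boundary measure in adapted coordinates, near `P`. -/
theorem IsAdapted.eventually_boundary (h : IsAdapted Ω s P Φ) (hΩ : IsOpen Ω)
    (hconv : Convex ℝ Ω) (hs : IsSmoothPositiveDensity Ω s) :
    ∀ᶠ r in 𝓝[>] (0 : ℝ), Metric.closedBall (Φ P) r ⊆ Φ.target ∧
      Bornology.IsBounded (chartBall Φ P r) ∧
      μHE[m] (frontier Ω ∩ chartBall Φ P r) < ⊤ ∧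
      ∀ ψ : E (m + 1) → ℝ, ∫ x in frontier Ω ∩ chartBall Φ P r, s x * ψ x ∂μHE[m] =
        ∫ η in sliceL m ⁻¹' Metric.ball (Φ P) r,
          |(fderiv ℝ Φ.symm (sliceL m η)).det| * ψ (Φ.symm (sliceL m η)) := by
  have hPt : Φ P ∈ Φ.target := Φ.map_source h.mem_source
  obtain ⟨K, t, ht, hK⟩ := ((h.contDiffAt_symm hPt).of_le
    (by exact_mod_cast le_top : (1 : WithTop ℕ∞) ≤ ((⊤ : ℕ∞) : WithTop ℕ∞))).exists_lipschitzOnWith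
  obtain ⟨r₀, hr₀, hball⟩ := Metric.nhds_basis_closedBall.mem_iff.1
    (inter_mem ht (Φ.open_target.mem_nhds hPt))
  filter_upwards [Ioc_mem_nhdsGT hr₀] with r hr
  have hsub : Metric.closedBall (Φ P) r ⊆ t ∩ Φ.target :=
    (Metric.closedBall_subset_closedBall hr.2).trans hball
  have hbt : Metric.ball (Φ P) r ⊆ Φ.target := fun y hy => (hsub (Metric.ball_subset_closedBall hy)).2
  set V : Set (E m) := sliceL m ⁻¹' Metric.ball (Φ P) r with hV
  have hVo : IsOpen V := Metric.isOpen_ball.preimage (sliceL m).continuous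
  have hslice : ∀ η : E m, ‖sliceL m η‖ = ‖η‖ := by
    intro η
    rw [EuclideanSpace.norm_eq, EuclideanSpace.norm_eq, Fin.sum_univ_succ]
    simp [sliceL_apply]
  have hslice' : ∀ η η' : E m, dist (sliceL m η) (sliceL m η') = dist η η' := by
    intro η η'
    rw [dist_eq_norm, dist_eq_norm, ← map_sub, hslice]
  have hVb : volume V ≠ ⊤ := by
    have : Bornology.IsBounded V := by
      rw [Metric.isBounded_iff]
      refine ⟨2 * r, fun x hx y hy => ?_⟩
      rw [← hslice']
      have h1 := Metric.mem_ball.1 hx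
      have h2 := Metric.mem_ball.1 hy
      linarith [dist_triangle_right (sliceL m x) (sliceL m y) (Φ P)]
    exact this.measure_lt_top.ne
  set g : E m → E (m + 1) := fun η => Φ.symm (sliceL m η) with hg
  have himg : frontier Ω ∩ chartBall Φ P r = g '' V := by
    ext x
    constructor
    · rintro ⟨hxf, hxs, hxb⟩
      have h0 := (h.mem_frontier_iff x hxs).1 hxf
      have h1 := exists_consL_eq (Φ x)
      rw [h0, ← sliceL_apply] at h1
      refine ⟨WithLp.toLp 2 fun j => Φ x j.succ, ?_, ?_⟩
      · rw [hV, mem_preimage, h1]; exact hxb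
      · rw [hg]; simp only; rw [h1, Φ.left_inv hxs]
    · rintro ⟨η, hη, rfl⟩
      have hηt := hbt hη
      refine ⟨?_, Φ.map_target hηt, ?_⟩
      · rw [h.mem_frontier_iff _ (Φ.map_target hηt), Φ.right_inv hηt, sliceL_apply, consL_zero]
      · rw [mem_preimage, Φ.right_inv hηt]; exact hη
  have hlip : LipschitzOnWith K g V := by
    intro x hx y hy
    have := hK (hsub (Metric.ball_subset_closedBall hx)).1
      (hsub (Metric.ball_subset_closedBall hy)).1
    rwa [edist_dist (sliceL m x), hslice', ← edist_dist] at this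
  have hinj : InjOn g V := by
    intro x hx y hy hxy
    have h1 := Φ.symm.injOn (hbt hx) (hbt hy) hxy
    rw [← dist_eq_zero, ← hslice', h1, dist_self]
  set g' : E m → E m →L[ℝ] E (m + 1) := fun η =>
    (fderiv ℝ Φ.symm (sliceL m η)).comp (sliceL m) with hg'
  have hstrict : ∀ x ∈ V, HasStrictFDerivAt g (g' x) x := by
    intro x hx
    exact ((h.contDiffAt_symm (hbt hx)).hasStrictFDerivAt (by simp)).comp x
      (sliceL m).hasStrictFDerivAt
  have hginj : ∀ x ∈ V, Function.Injective (g' x) := by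
    intro x hx y z hyz
    have h1 := congrArg (fderiv ℝ Φ (Φ.symm (sliceL m x))) hyz
    simp only [hg', ContinuousLinearMap.comp_apply, h.fderiv_fderiv_symm (hbt hx)] at h1
    rw [← dist_eq_zero, ← hslice', h1, dist_self]
  have hfin := euclideanHausdorffMeasure_image_lt_top hVb hlip
  rw [← himg] at hfin
  have hcd : ContinuousOn (fun η => |(fderiv ℝ Φ.symm (sliceL m η)).det|) V := by
    have h1 : ContinuousOn (fderiv ℝ Φ.symm) Φ.target :=
      h.smooth_symm.continuousOn_fderiv_of_isOpen Φ.open_target (by simp)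
    exact (ContinuousLinearMap.continuous_det.comp_continuousOn
      (h1.comp (sliceL m).continuous.continuousOn fun x hx => hbt hx)).abs
  have hcs : ContinuousOn (fun η => s (g η)) V := by
    refine hs.smooth.continuousOn.comp hlip.continuousOn fun x hx => ?_
    have : g x ∈ frontier Ω ∩ chartBall Φ P r := himg ▸ mem_image_of_mem g hx
    exact this.1
  have hspos : ∀ x ∈ V, 0 < s (g x) := fun x hx => by
    have : g x ∈ frontier Ω ∩ chartBall Φ P r := himg ▸ mem_image_of_mem g hx
    exact hs.pos _ this.1
  -- The tangential Jacobian is a quotient of continuous functions, the full Jacobian by the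
  -- density, which settles measurability.
  have hmeas : AEMeasurable (fun x => (g' x).toLinearMap.normDet) (volume.restrict V) := by
    have h1 : ContinuousOn (fun x => |(fderiv ℝ Φ.symm (sliceL m x)).det| / s (g x)) V :=
      hcd.div hcs fun x hx => (hspos x hx).ne'
    refine (h1.congr fun x hx => ?_).aemeasurable hVo.measurableSet
    rw [h.abs_det_fderiv_symm hΩ hconv hs (hbt hx)]
    have := (hspos x hx).ne'
    simp only [hg] at this
    simp only [hg]
    field_simp
    rfl
  refine ⟨fun y hy => (hsub hy).2, ?_, hfin, fun ψ => ?_⟩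
  · rw [chartBall_eq_image hbt]
    exact ((isCompact_closedBall (Φ P) r).image_of_continuousOn (Φ.symm.continuousOn.mono
      fun y hy => (hsub hy).2)).isBounded.subset (image_mono Metric.ball_subset_closedBall)
  · rw [himg, setIntegral_image_euclideanHausdorffMeasure hVo hVb hlip hinj hstrict hginj hmeas]
    refine setIntegral_congr_fun hVo.measurableSet fun x hx => ?_
    rw [h.abs_det_fderiv_symm hΩ hconv hs (hbt hx)]
    simp only [hg, hg']
    ring

end Abreu

namespace Abreu

open scoped NNReal ENNReal

/-! ### Integrals over thin collars of the boundary -/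

/-- Integrals of a continuous function `F` against the rescaled kernel `k(y₀/δ)/δ` converge to a
multiple of the integral of `F` over the hyperplane `y₀ = 0`. -/
theorem tendsto_collar_halfspace {m : ℕ} {F : E (m + 1) → ℝ} (hF : Continuous F)
    (hFc : HasCompactSupport F) {k : ℝ → ℝ} (hk : Continuous k)
    (hk0 : ∀ r, r ∉ Icc (1 : ℝ) 2 → k r = 0) :
    Tendsto (fun δ : ℝ => δ⁻¹ * ∫ y, k (y 0 / δ) * F y) (𝓝[>] 0)
      (𝓝 ((∫ r, k r) * ∫ η, F (sliceL m η))) := by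
  obtain ⟨hmp, hme⟩ := measurePreserving_consL m
  have hemb : IsClosedEmbedding (consL m) :=
    (consL m).toLinearMap.isClosedEmbedding_of_injective
      (LinearMap.ker_eq_bot.2 (consL_injective m))
  set G : ℝ × E m → ℝ := fun p => F (consL m p) with hG
  have hGc : Continuous G := hF.comp (consL m).continuous
  have hGs : HasCompactSupport G := hFc.comp_isClosedEmbedding hemb
  set I : ℝ → ℝ := fun t => ∫ η, G (t, η) with hI
  obtain ⟨R, hR⟩ : ∃ R : ℝ, ∀ t : ℝ, ∀ η : E m, η ∉ Metric.closedBall (0 : E m) R → G (t, η) = 0 := by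
    obtain ⟨R, hR⟩ := hGs.isBounded.subset_closedBall (0 : ℝ × E m)
    refine ⟨R, fun t η hη => ?_⟩
    by_contra hne
    have := hR (subset_tsupport G hne)
    rw [mem_closedBall_zero_iff] at this
    exact hη (mem_closedBall_zero_iff.2 ((norm_snd_le (t, η)).trans this))
  have hIset : I = fun t => ∫ η in Metric.closedBall (0 : E m) R, G (t, η) := by
    funext t
    exact (setIntegral_eq_integral_of_forall_compl_eq_zero fun η hη => hR t η hη).symm
  have hIc : Continuous I := by
    rw [hIset]
    exact continuous_parametric_integral_of_continuous (f := fun t η => G (t, η)) (by exact hGc)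
      (isCompact_closedBall _ _)
  have hkset : ∀ δ : ℝ, ∫ r, k r * I (δ * r) = ∫ r in Icc (1 : ℝ) 2, k r * I (δ * r) := fun δ =>
    (setIntegral_eq_integral_of_forall_compl_eq_zero fun r hr => by rw [hk0 r hr, zero_mul]).symm
  have hJc : Continuous fun δ : ℝ => ∫ r, k r * I (δ * r) := by
    simp_rw [hkset]
    exact continuous_parametric_integral_of_continuous (f := fun δ r => k r * I (δ * r))
      (by fun_prop) isCompact_Icc
  have hlim : Tendsto (fun δ : ℝ => ∫ r, k r * I (δ * r)) (𝓝[>] 0)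
      (𝓝 ((∫ r, k r) * ∫ η, F (sliceL m η))) := by
    have h1 := hJc.continuousAt.tendsto (x := 0)
    simp only [zero_mul] at h1
    rw [integral_mul_const] at h1
    exact h1.mono_left nhdsWithin_le_nhds
  refine hlim.congr' ?_
  filter_upwards [self_mem_nhdsWithin] with δ (hδ : 0 < δ)
  have h1 : ∫ y, k (y 0 / δ) * F y = ∫ p : ℝ × E m, k (p.1 / δ) * G p := by
    rw [← hmp.integral_comp hme]
    rfl
  have hint : Integrable (fun p : ℝ × E m => k (p.1 / δ) * G p) := by
    refine Continuous.integrable_of_hasCompactSupport (by fun_prop) ?_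
    exact hGs.mul_left
  have h2 : ∫ p : ℝ × E m, k (p.1 / δ) * G p = ∫ t, k (t / δ) * I t := by
    rw [Measure.volume_eq_prod] at hint ⊢
    rw [integral_prod _ hint]
    simp only [integral_const_mul, hI]
  have h3 := Measure.integral_comp_mul_left (fun t => k (t / δ) * I t) δ
  rw [h1, h2]
  simp only [smul_eq_mul, abs_of_pos (inv_pos.2 hδ)] at h3
  rw [← h3]
  refine integral_congr_ae (ae_of_all _ fun r => ?_)
  simp only
  rw [mul_div_cancel_left₀ r hδ.ne']

section Collar

variable {m : ℕ} {Ω : Set (E (m + 1))} {s : E (m + 1) → ℝ} {P : E (m + 1)}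
  {Φ : OpenPartialHomeomorph (E (m + 1)) (E (m + 1))}

/-- Changing variables by the chart reduces this to the half-space for the function `|det| · ψ ∘
Φ.symm`, whose integral over the hyperplane is `∫ ψ dσ`. Because the kernel vanishes on nonpositive
arguments, integrating over `Ω` or over the whole chart ball makes no difference. -/
theorem IsAdapted.eventually_collar_aux (h : IsAdapted Ω s P Φ) (hΩ : IsOpen Ω)
    (hconv : Convex ℝ Ω) (hs : IsSmoothPositiveDensity Ω s) :
    ∀ᶠ r in 𝓝[>] (0 : ℝ), Metric.closedBall (Φ P) r ⊆ Φ.target ∧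
      Bornology.IsBounded (chartBall Φ P r) ∧
      μHE[m] (frontier Ω ∩ chartBall Φ P r) < ⊤ ∧
      ∀ ψ : E (m + 1) → ℝ, Continuous ψ → HasCompactSupport ψ → tsupport ψ ⊆ chartBall Φ P r →
      ∀ k : ℝ → ℝ, Continuous k → (∀ r, r ∉ Icc (1 : ℝ) 2 → k r = 0) →
      Tendsto (fun δ : ℝ => δ⁻¹ * ∫ x in Ω, k (Φ x 0 / δ) * ψ x) (𝓝[>] 0)
        (𝓝 ((∫ r, k r) * ∫ x, ψ x ∂boundaryMeasure Ω s)) := by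
  filter_upwards [h.eventually_boundary hΩ hconv hs] with r hr
  obtain ⟨hball, hbd, hfin, hbdry⟩ := hr
  refine ⟨hball, hbd, hfin, fun ψ hψ hψc hψN k hk hk0 => ?_⟩
  have hbt : Metric.ball (Φ P) r ⊆ Φ.target := Metric.ball_subset_closedBall.trans hball
  set J : E (m + 1) → ℝ := fun y => |(fderiv ℝ Φ.symm y).det| * ψ (Φ.symm y) with hJ
  set F : E (m + 1) → ℝ := (Metric.ball (Φ P) r).indicator J with hF
  set K : Set (E (m + 1)) := Φ '' tsupport ψ with hK
  have hKc : IsCompact K := hψc.isCompact.image_of_continuousOn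
    (Φ.continuousOn.mono (hψN.trans chartBall_subset_source))
  have hKb : K ⊆ Metric.ball (Φ P) r := by
    rintro _ ⟨x, hx, rfl⟩
    exact (hψN hx).2
  have hJ0 : ∀ y ∈ Metric.ball (Φ P) r, y ∉ K → J y = 0 := by
    intro y hy hyK
    have : Φ.symm y ∉ tsupport ψ := fun hmem =>
      hyK ⟨_, hmem, Φ.right_inv (hbt hy)⟩
    simp only [hJ, image_eq_zero_of_notMem_tsupport this, mul_zero]
  have hJc : ContinuousOn J (Metric.ball (Φ P) r) := by
    have h1 : ContinuousOn (fderiv ℝ Φ.symm) Φ.target :=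
      h.smooth_symm.continuousOn_fderiv_of_isOpen Φ.open_target (by simp)
    exact ((ContinuousLinearMap.continuous_det.comp_continuousOn (h1.mono hbt)).abs).mul
      (hψ.comp_continuousOn (Φ.symm.continuousOn.mono hbt))
  have hFc : Continuous F :=
    continuous_indicator_of_isClosed Metric.isOpen_ball hKc.isClosed hKb hJ0 hJc
  have hFs : HasCompactSupport F :=
    hKc.of_isClosed_subset (isClosed_tsupport F) (tsupport_indicator_subset hKc.isClosed hJ0)
  have hmain := tendsto_collar_halfspace hFc hFs hk hk0
  have hlim : ∫ η, F (sliceL m η) = ∫ x, ψ x ∂boundaryMeasure Ω s := by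
    rw [integral_boundaryMeasure hs, Nat.add_sub_cancel]
    have h1 : ∫ x in frontier Ω, s x * ψ x ∂μHE[m] =
        ∫ x in frontier Ω ∩ chartBall Φ P r, s x * ψ x ∂μHE[m] := by
      apply setIntegral_eq_of_subset_of_forall_sdiff_eq_zero isClosed_frontier.measurableSet
        inter_subset_left
      intro x hx
      have : x ∉ tsupport ψ := fun hmem => hx.2 ⟨hx.1, hψN hmem⟩
      rw [image_eq_zero_of_notMem_tsupport this, mul_zero]
    rw [h1, hbdry, ← integral_indicator (Metric.isOpen_ball.measurableSet.preimage
      (sliceL m).continuous.measurable)]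
    rfl
  rw [hlim] at hmain
  refine hmain.congr' ?_
  filter_upwards [self_mem_nhdsWithin] with δ (hδ : 0 < δ)
  congr 1
  have h1 : ∫ x in Ω, k (Φ x 0 / δ) * ψ x = ∫ x in chartBall Φ P r, k (Φ x 0 / δ) * ψ x := by
    rw [← integral_indicator hΩ.measurableSet, ← integral_indicator isOpen_chartBall.measurableSet]
    congr 1
    funext x
    by_cases hxN : x ∈ chartBall Φ P r
    · rw [indicator_of_mem hxN]
      by_cases hxΩ : x ∈ Ω
      · rw [indicator_of_mem hxΩ]
      · rw [indicator_of_notMem hxΩ, hk0, zero_mul]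
        rw [h.mem_iff x hxN.1, not_lt] at hxΩ
        intro hmem
        have := div_nonpos_of_nonpos_of_nonneg hxΩ hδ.le
        linarith [hmem.1]
    · have : x ∉ tsupport ψ := fun hmem => hxN (hψN hmem)
      rw [indicator_of_notMem hxN]
      exact indicator_apply_eq_zero.2 fun _ => by
        rw [image_eq_zero_of_notMem_tsupport this, mul_zero]
  have hinj : InjOn Φ.symm (Metric.ball (Φ P) r) := Φ.symm.injOn.mono hbt
  rw [h1, chartBall_eq_image hbt, integral_image_eq_integral_abs_det_fderiv_smul volume
    Metric.isOpen_ball.measurableSet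
    (fun y hy => (h.hasFDerivAt_symm (hbt hy)).hasFDerivWithinAt) hinj,
    ← integral_indicator Metric.isOpen_ball.measurableSet]
  refine integral_congr_ae (ae_of_all _ fun y => ?_)
  by_cases hy : y ∈ Metric.ball (Φ P) r
  · simp only [hF, hJ, indicator_of_mem hy, smul_eq_mul, Φ.right_inv (hbt hy)]
    ring
  · simp only [hF, indicator_of_notMem hy, mul_zero]

end Collar

theorem IsAdapted.eventually_collar {n : ℕ} [NeZero n] {Ω : Set (E n)} {s : E n → ℝ} {P : E n}
    {Φ : OpenPartialHomeomorph (E n) (E n)} (h : IsAdapted Ω s P Φ) (hΩ : IsOpen Ω)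
    (hconv : Convex ℝ Ω) (hs : IsSmoothPositiveDensity Ω s) :
    ∀ᶠ r in 𝓝[>] (0 : ℝ), Metric.closedBall (Φ P) r ⊆ Φ.target ∧
      Bornology.IsBounded (chartBall Φ P r) ∧
      μHE[n - 1] (frontier Ω ∩ chartBall Φ P r) < ⊤ ∧
      ∀ ψ : E n → ℝ, Continuous ψ → HasCompactSupport ψ → tsupport ψ ⊆ chartBall Φ P r →
      ∀ k : ℝ → ℝ, Continuous k → (∀ r, r ∉ Icc (1 : ℝ) 2 → k r = 0) →
      Tendsto (fun δ : ℝ => δ⁻¹ * ∫ x in Ω, k (Φ x 0 / δ) * ψ x) (𝓝[>] 0)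
        (𝓝 ((∫ r, k r) * ∫ x, ψ x ∂boundaryMeasure Ω s)) := by
  obtain ⟨m, rfl⟩ := Nat.exists_eq_succ_of_ne_zero (NeZero.ne n)
  exact IsAdapted.eventually_collar_aux h hΩ hconv hs

end Abreu

namespace Abreu

/-! ### Second derivatives -/

/-- The second derivative `D²g(x)` as a bilinear form. -/
noncomputable def D2 {n : ℕ} (g : E n → ℝ) (x : E n) : E n →L[ℝ] E n →L[ℝ] ℝ :=
  fderiv ℝ (fderiv ℝ g) x

section Calculus

variable {n : ℕ}

theorem differentiableAt_fderiv {g : E n → ℝ} {x : E n} (hg : ContDiffAt ℝ 2 g x) :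
    DifferentiableAt ℝ (fderiv ℝ g) x :=
  (hg.fderiv_right (m := 1) (by norm_num)).differentiableAt (by norm_num)

theorem fderiv_fderiv_apply {g : E n → ℝ} {x : E n} (hg : ContDiffAt ℝ 2 g x) (v w : E n) :
    fderiv ℝ (fun y => fderiv ℝ g y w) x v = D2 g x v w := by
  have h := (differentiableAt_fderiv hg).hasFDerivAt.clm_apply (hasFDerivAt_const w x)
  rw [h.fderiv]
  simp [D2]

theorem hessian_eq_D2 {g : E n → ℝ} {x : E n} (hg : ContDiffAt ℝ 2 g x) (i j : Fin n) :
    hessian g x i j = D2 g x (stdVec i) (stdVec j) :=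
  fderiv_fderiv_apply hg _ _

theorem D2_symm {g : E n → ℝ} {x : E n} (hg : ContDiffAt ℝ 2 g x) (v w : E n) :
    D2 g x v w = D2 g x w v :=
  hg.isSymmSndFDerivAt (by simp) v w

theorem D2_congr {g h : E n → ℝ} {x : E n} (hgh : g =ᶠ[𝓝 x] h) : D2 g x = D2 h x := by
  rw [D2, D2, hgh.fderiv.fderiv_eq]

theorem D2_add {g h : E n → ℝ} {x : E n} (hg : ContDiffAt ℝ 2 g x) (hh : ContDiffAt ℝ 2 h x) :
    D2 (fun y => g y + h y) x = D2 g x + D2 h x := by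
  have h1 : fderiv ℝ (fun y => g y + h y) =ᶠ[𝓝 x] fun y => fderiv ℝ g y + fderiv ℝ h y := by
    filter_upwards [hg.eventually (by simp), hh.eventually (by simp)] with y hy hy'
    exact fderiv_fun_add (hy.differentiableAt (by simp)) (hy'.differentiableAt (by simp))
  rw [D2, h1.fderiv_eq, fderiv_fun_add (differentiableAt_fderiv hg) (differentiableAt_fderiv hh)]
  rfl

theorem D2_mul {g h : E n → ℝ} {x : E n} (hg : ContDiffAt ℝ 2 g x) (hh : ContDiffAt ℝ 2 h x)
    (v w : E n) : D2 (fun y => g y * h y) x v w = g x * D2 h x v w + h x * D2 g x v w +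
      fderiv ℝ g x v * fderiv ℝ h x w + fderiv ℝ h x v * fderiv ℝ g x w := by
  have h1 : fderiv ℝ (fun y => g y * h y) =ᶠ[𝓝 x] fun y => g y • fderiv ℝ h y + h y • fderiv ℝ g y := by
    filter_upwards [hg.eventually (by simp), hh.eventually (by simp)] with y hy hy'
    exact fderiv_fun_mul (hy.differentiableAt (by simp)) (hy'.differentiableAt (by simp))
  have hg1 := (hg.differentiableAt (by simp)).hasFDerivAt
  have hh1 := (hh.differentiableAt (by simp)).hasFDerivAt
  have h2 := (hg1.smul (differentiableAt_fderiv hh).hasFDerivAt).add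
    (hh1.smul (differentiableAt_fderiv hg).hasFDerivAt)
  rw [D2, h1.fderiv_eq]
  have h3 := h2.fderiv
  refine (congrArg (fun L : E n →L[ℝ] E n →L[ℝ] ℝ => L v w) h3).trans ?_
  simp [D2]
  ring

/-- The second derivative of a composition. -/
theorem D2_comp {k : ℕ} {h : E k → ℝ} {Φ : E n → E k} {x : E n} (hh : ContDiffAt ℝ 2 h (Φ x))
    (hΦ : ContDiffAt ℝ 2 Φ x) (v w : E n) :
    D2 (fun y => h (Φ y)) x v w = D2 h (Φ x) (fderiv ℝ Φ x v) (fderiv ℝ Φ x w) +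
      fderiv ℝ h (Φ x) (fderiv ℝ (fderiv ℝ Φ) x v w) := by
  have h1 : fderiv ℝ (fun y => h (Φ y)) =ᶠ[𝓝 x] fun y => (fderiv ℝ h (Φ y)).comp (fderiv ℝ Φ y) := by
    filter_upwards [hΦ.eventually (by simp),
      hΦ.continuousAt.eventually (hh.eventually (by simp))] with y hy hy'
    exact fderiv_comp y (hy'.differentiableAt (by simp)) (hy.differentiableAt (by simp))
  have hΦ1 := (hΦ.differentiableAt (by simp)).hasFDerivAt
  have hΦ2 : DifferentiableAt ℝ (fderiv ℝ Φ) x :=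
    (hΦ.fderiv_right (m := 1) (by norm_num)).differentiableAt (by norm_num)
  have h2 := ((differentiableAt_fderiv hh).hasFDerivAt.comp x hΦ1).clm_comp hΦ2.hasFDerivAt
  rw [D2, h1.fderiv_eq]
  refine (congrArg (fun L : E n →L[ℝ] E n →L[ℝ] ℝ => L v w) h2.fderiv).trans ?_
  simp [D2]
  ring

theorem fderiv_scalar_comp {h : ℝ → ℝ} {ξ : E n → ℝ} {x : E n} (hh : ContDiff ℝ ∞ h)
    (hξ : ContDiffAt ℝ 2 ξ x) :
    fderiv ℝ (fun y => h (ξ y)) x = deriv h (ξ x) • fderiv ℝ ξ x :=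
  (((hh.differentiable (by simp) (ξ x)).hasDerivAt).comp_hasFDerivAt x
    (hξ.differentiableAt (by simp)).hasFDerivAt).fderiv

theorem D2_scalar_comp {h : ℝ → ℝ} {ξ : E n → ℝ} {x : E n} (hh : ContDiff ℝ ∞ h)
    (hξ : ContDiffAt ℝ 2 ξ x) (v w : E n) :
    D2 (fun y => h (ξ y)) x v w = deriv (deriv h) (ξ x) * fderiv ℝ ξ x v * fderiv ℝ ξ x w +
      deriv h (ξ x) * D2 ξ x v w := by
  have h1 : fderiv ℝ (fun y => h (ξ y)) =ᶠ[𝓝 x] fun y => deriv h (ξ y) • fderiv ℝ ξ y := by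
    filter_upwards [hξ.eventually (by simp)] with y hy
    exact fderiv_scalar_comp hh hy
  have hh' : ContDiff ℝ ∞ (deriv h) := (contDiff_infty_iff_deriv.1 hh).2
  have h2 := ((hh'.differentiable (by simp) (ξ x)).hasDerivAt.comp_hasFDerivAt x
    (hξ.differentiableAt (by simp)).hasFDerivAt).smul (differentiableAt_fderiv hξ).hasFDerivAt
  rw [D2, h1.fderiv_eq]
  refine (congrArg (fun L : E n →L[ℝ] E n →L[ℝ] ℝ => L v w) h2.fderiv).trans ?_
  simp [D2]
  ring

theorem contDiffAt_mul_log [NeZero n] {y : E n} (hy : 0 < y 0) {k : WithTop ℕ∞} :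
    ContDiffAt ℝ k (fun y : E n => y 0 * Real.log (y 0)) y := by
  have h0 : ContDiffAt ℝ k (fun y : E n => y 0) y := (coordL (0 : Fin n)).contDiff.contDiffAt
  exact h0.mul (h0.log hy.ne')

theorem fderiv_mul_log [NeZero n] {y : E n} (hy : 0 < y 0) :
    fderiv ℝ (fun y : E n => y 0 * Real.log (y 0)) y = (Real.log (y 0) + 1) • coordL 0 := by
  have h0 : HasFDerivAt (fun y : E n => y 0) (coordL (0 : Fin n)) y := (coordL 0).hasFDerivAt
  have h1 := (Real.hasDerivAt_mul_log hy.ne').comp_hasFDerivAt y h0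
  exact h1.fderiv

theorem D2_mul_log [NeZero n] {y : E n} (hy : 0 < y 0) (v w : E n) :
    D2 (fun y : E n => y 0 * Real.log (y 0)) y v w = v 0 * w 0 / y 0 := by
  have h0 : HasFDerivAt (fun y : E n => y 0) (coordL (0 : Fin n)) y := (coordL 0).hasFDerivAt
  have h1 : fderiv ℝ (fun y : E n => y 0 * Real.log (y 0)) =ᶠ[𝓝 y]
      fun y => (Real.log (y 0) + 1) • coordL 0 := by
    have : ∀ᶠ z in 𝓝 y, 0 < (coordL 0 : E n →L[ℝ] ℝ) z :=
      (coordL (0 : Fin n)).continuous.continuousAt.eventually (lt_mem_nhds hy)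
    filter_upwards [this] with z hz using fderiv_mul_log hz
  have h2 := ((h0.log hy.ne').add_const 1).smul_const (coordL (0 : Fin n))
  rw [D2, h1.fderiv_eq]
  refine (congrArg (fun L : E n →L[ℝ] E n →L[ℝ] ℝ => L v w) h2.fderiv).trans ?_
  simp
  field_simp

theorem iteratedFDeriv_two_eq_D2 (f : E n → ℝ) (y v w : E n) :
    iteratedFDeriv ℝ 2 f y ![v, w] = D2 f y v w := by
  rw [iteratedFDeriv_two_apply]; rfl

theorem fderiv_D2_apply {f : E n → ℝ} {y : E n} (hf : ContDiffAt ℝ ∞ f y) (a v w : E n) :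
    HasFDerivAt (fun z => D2 f z v w) (fderiv ℝ (fun z => D2 f z v w) y) y ∧
    fderiv ℝ (fun z => D2 f z v w) y a = iteratedFDeriv ℝ 3 f y ![a, v, w] := by
  have h1 : DifferentiableAt ℝ (iteratedFDeriv ℝ 2 f) y :=
    hf.differentiableAt_iteratedFDeriv (WithTop.coe_lt_coe.2 (ENat.natCast_lt_top 2))
  have h2 : (fun z => D2 f z v w) = fun z => iteratedFDeriv ℝ 2 f z ![v, w] := by
    funext z; rw [iteratedFDeriv_two_eq_D2]
  have h3 : HasFDerivAt (fun z => iteratedFDeriv ℝ 2 f z ![v, w])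
      ((ContinuousMultilinearMap.apply ℝ (fun _ : Fin 2 => E n) ℝ ![v, w]).comp
        (fderiv ℝ (iteratedFDeriv ℝ 2 f) y)) y :=
    (ContinuousMultilinearMap.apply ℝ (fun _ : Fin 2 => E n) ℝ ![v, w]).hasFDerivAt.comp y
      h1.hasFDerivAt
  rw [h2]
  refine ⟨h3.differentiableAt.hasFDerivAt, ?_⟩
  rw [h3.fderiv, iteratedFDeriv_succ_apply_left]
  rfl

end Calculus

/-! ### The remainder `f = u - ξ log ξ` in adapted coordinates -/

section Remainder

variable {n : ℕ} [NeZero n]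

theorem exists_of_isLittleO_alpha {T : Set (E n)} {g : E n → ℝ} {a : ℝ → ℝ}
    (h : g =o[comap (fun y : E n => y 0) (𝓝[>] 0) ⊓ 𝓟 T] fun y => a (y 0)) {ε : ℝ} (hε : 0 < ε) :
    ∃ δ > 0, ∀ y ∈ T, 0 < y 0 → y 0 < δ → |g y| ≤ ε * |a (y 0)| := by
  have h1 := h.def hε
  rw [eventually_inf_principal, eventually_comap] at h1
  obtain ⟨δ, hδ, h2⟩ := (nhdsGT_basis (0 : ℝ)).eventually_iff.1 h1
  exact ⟨δ, hδ, fun y hy h0 h3 => h2 ⟨h0, h3⟩ y rfl hy⟩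

variable {Ω : Set (E n)} {s u : E n → ℝ} {Φ : OpenPartialHomeomorph (E n) (E n)} {P : E n}

theorem contDiffAt_remainder (hu : ContDiffOn ℝ ∞ u Ω) (hΩ : IsOpen Ω) (h : IsAdapted Ω s P Φ)
    {y : E n} (hy : y ∈ Φ.target) (hy0 : 0 < y 0) : ContDiffAt ℝ ∞ (remainder Φ u) y := by
  have hx : Φ.symm y ∈ Ω := by
    rw [h.mem_iff _ (Φ.map_target hy), Φ.right_inv hy]
    exact hy0
  exact ((hu.contDiffAt (hΩ.mem_nhds hx)).comp y (h.contDiffAt_symm hy)).sub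
    (contDiffAt_mul_log hy0)

/-- The condition on the partial derivatives of the remainder in the definition of `𝒮_{Ω,σ}`. -/
def RemainderDecay (Φ : OpenPartialHomeomorph (E n) (E n)) (u : E n → ℝ) : Prop :=
  ∀ p q : ℕ, 1 ≤ p → p + q ≤ 3 → ∀ η : Fin q → Fin n, (∀ k, η k ≠ 0) →
    (fun y => iteratedFDeriv ℝ (p + q) (remainder Φ u) y
        (Fin.append (fun _ : Fin p => stdVec 0) fun k => stdVec (η k)))
      =o[comap (fun y : E n => y 0) (𝓝[>] 0) ⊓ 𝓟 Φ.target] fun y => alpha p (y 0)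

theorem RemainderDecay.first (h : RemainderDecay Φ u) :
    (fun y => fderiv ℝ (remainder Φ u) y (stdVec 0))
      =o[comap (fun y : E n => y 0) (𝓝[>] 0) ⊓ 𝓟 Φ.target] fun y => -Real.log (y 0) := by
  refine (h 1 0 le_rfl (by norm_num) (fun k => k.elim0) (fun k => k.elim0)).congr_left fun y => ?_
  exact iteratedFDeriv_one_apply _

theorem RemainderDecay.second (h : RemainderDecay Φ u) :
    (fun y => D2 (remainder Φ u) y (stdVec 0) (stdVec 0))
      =o[comap (fun y : E n => y 0) (𝓝[>] 0) ⊓ 𝓟 Φ.target] fun y => (y 0)⁻¹ := by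
  refine (h 2 0 (by norm_num) (by norm_num) (fun k => k.elim0) (fun k => k.elim0)).congr_left
    fun y => ?_
  exact iteratedFDeriv_two_apply _ _ _

theorem RemainderDecay.mixed (h : RemainderDecay Φ u) {j : Fin n} (hj : j ≠ 0) :
    (fun y => D2 (remainder Φ u) y (stdVec 0) (stdVec j))
      =o[comap (fun y : E n => y 0) (𝓝[>] 0) ⊓ 𝓟 Φ.target] fun y => -Real.log (y 0) := by
  refine (h 1 1 le_rfl (by norm_num) (fun _ => j) (fun _ => hj)).congr_left fun y => ?_
  exact iteratedFDeriv_two_apply _ _ _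

theorem RemainderDecay.third (h : RemainderDecay Φ u) {j k : Fin n} (hj : j ≠ 0) (hk : k ≠ 0) :
    (fun y => iteratedFDeriv ℝ 3 (remainder Φ u) y ![stdVec 0, stdVec j, stdVec k])
      =o[comap (fun y : E n => y 0) (𝓝[>] 0) ⊓ 𝓟 Φ.target] fun y => -Real.log (y 0) := by
  refine (h 1 2 le_rfl (by norm_num) ![j, k]
    (fun i => by fin_cases i <;> simpa)).congr_left fun y => ?_
  change iteratedFDeriv ℝ 3 (remainder Φ u) y _ = _
  congr 1
  funext i
  fin_cases i <;> rfl

/-- A function whose derivative in the direction `y₀` is `O(|log y₀|)` is bounded near a point of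
the hyperplane `y₀ = 0`. -/
theorem exists_bound_of_normal_derivative {T : Set (E n)} {Q : E n} {g : E n → ℝ} {δ r : ℝ}
    (hQ : Q 0 = 0) (hr : 0 < r) (hr1 : r < 1) (hrδ : r < δ)
    (hT : Metric.closedBall Q (3 * r) ⊆ T)
    (hg : ∀ y ∈ T, 0 < y 0 → DifferentiableAt ℝ g y)
    (hg' : ∀ y ∈ T, 0 < y 0 → y 0 < δ → |fderiv ℝ g y (stdVec 0)| ≤ |Real.log (y 0)|) :
    ∃ C, ∀ y ∈ Metric.ball Q r, 0 < y 0 → |g y| ≤ C := by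
  set S : Set (E n) := Metric.closedBall Q (3 * r) ∩ {z | z 0 = r} with hS
  have hSc : IsCompact S := (isCompact_closedBall Q (3 * r)).inter_right
    (isClosed_eq (coordL (0 : Fin n)).continuous continuous_const)
  have hgS : ContinuousOn g S := fun z hz =>
    (hg z (hT hz.1) (by rw [show z 0 = r from hz.2]; exact hr)).continuousAt.continuousWithinAt
  obtain ⟨M, hM⟩ := hSc.exists_bound_of_continuousOn hgS
  -- At height `r` the function is bounded by `M`, by compactness. Moving from height `y 0` up to
  -- `r` changes it by at most the integral of `-log t`, whose primitive is `t - t log t`.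
  refine ⟨M + (r - r * Real.log r), fun y hy hy0 => ?_⟩
  have hyQ : dist y Q < r := hy
  have hyr : y 0 < r := by
    have h1 : |(y - Q) 0| ≤ ‖y - Q‖ := PiLp.norm_apply_le (y - Q) 0
    rw [dist_eq_norm] at hyQ
    have h2 : (y - Q) 0 = y 0 := by simp [hQ]
    rw [h2, abs_of_pos hy0] at h1
    linarith
  set γ : ℝ → E n := fun t => y + (t - y 0) • stdVec 0 with hγ
  have hγ0 : ∀ t, γ t 0 = t := fun t => by simp [hγ]
  have hγb : ∀ t ∈ Icc (y 0) r, γ t ∈ Metric.closedBall Q (3 * r) := by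
    intro t ht
    have h1 : dist (γ t) y ≤ r := by
      rw [dist_eq_norm, hγ]
      simp only [add_sub_cancel_left, norm_smul, PiLp.norm_single, norm_one, mul_one,
        Real.norm_eq_abs]
      rw [abs_of_nonneg (sub_nonneg.2 ht.1)]
      linarith [ht.2]
    rw [Metric.mem_closedBall]
    linarith [dist_triangle (γ t) y Q]
  have hγd : ∀ t, HasDerivAt γ (stdVec 0) t := fun t => by
    simpa [hγ] using ((hasDerivAt_id t).sub_const (y 0)).smul_const (stdVec (0 : Fin n))
  have hGd : ∀ t ∈ Icc (y 0) r, HasDerivAt (fun t => g (γ t)) (fderiv ℝ g (γ t) (stdVec 0)) t := by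
    intro t ht
    exact (hg _ (hT (hγb t ht)) (by rw [hγ0]; linarith [ht.1])).hasFDerivAt.comp_hasDerivAt t (hγd t)
  have hAd : ∀ t ∈ Icc (y 0) r, HasDerivAt (fun t : ℝ => t - t * Real.log t) (-Real.log t) t := by
    intro t ht
    have := (hasDerivAt_id t).sub (Real.hasDerivAt_mul_log (hy0.trans_le ht.1).ne')
    convert! this using 1
    ring
  have hbd : ∀ t ∈ Icc (y 0) r, |fderiv ℝ g (γ t) (stdVec 0)| ≤ -Real.log t := by
    intro t ht
    have h1 := hg' _ (hT (hγb t ht)) (by rw [hγ0]; linarith [ht.1])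
      (by rw [hγ0]; linarith [ht.2])
    rw [hγ0] at h1
    rwa [abs_of_nonpos (Real.log_nonpos (hy0.le.trans ht.1) (by linarith [ht.2]))] at h1
  -- The signs `σ = 1` and `σ = -1` give the two sides of the bound without integrating the
  -- derivative.
  have hmono : ∀ σ : ℝ, |σ| = 1 →
      MonotoneOn (fun t => (t - t * Real.log t) + σ * g (γ t)) (Icc (y 0) r) := by
    intro σ hσ
    have hd : ∀ t ∈ Icc (y 0) r, HasDerivAt (fun t => (t - t * Real.log t) + σ * g (γ t))
        (-Real.log t + σ * fderiv ℝ g (γ t) (stdVec 0)) t := fun t ht =>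
      (hAd t ht).add ((hGd t ht).const_mul σ)
    refine monotoneOn_of_deriv_nonneg (convex_Icc _ _)
      (fun t ht => (hd t ht).continuousAt.continuousWithinAt) (fun t ht => ?_) fun t ht => ?_
    · rw [interior_Icc] at ht
      exact (hd t (Ioo_subset_Icc_self ht)).differentiableAt.differentiableWithinAt
    · rw [interior_Icc] at ht
      rw [(hd t (Ioo_subset_Icc_self ht)).deriv]
      have h1 := hbd t (Ioo_subset_Icc_self ht)
      have h2 : |σ * fderiv ℝ g (γ t) (stdVec 0)| ≤ -Real.log t := by rwa [abs_mul, hσ, one_mul]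
      linarith [neg_abs_le (σ * fderiv ℝ g (γ t) (stdVec 0))]
  have hl : y 0 ∈ Icc (y 0) r := ⟨le_rfl, hyr.le⟩
  have hrr : r ∈ Icc (y 0) r := ⟨hyr.le, le_rfl⟩
  have h1 := hmono 1 (by norm_num) hl hrr hyr.le
  have h2 := hmono (-1) (by norm_num) hl hrr hyr.le
  have hγy : γ (y 0) = y := by simp [hγ]
  simp only [hγy] at h1 h2
  have h3 : 0 ≤ y 0 - y 0 * Real.log (y 0) := by
    have : Real.log (y 0) ≤ 0 := Real.log_nonpos hy0.le (by linarith)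
    nlinarith
  have h4 : |g (γ r)| ≤ M := hM _ ⟨hγb r hrr, hγ0 r⟩
  rw [abs_le] at h4 ⊢
  constructor <;> linarith [h4.1, h4.2]

end Remainder

end Abreu

namespace Abreu

/-! ### The Hessian of a function of class `𝒮` near the boundary -/

section Bounds

variable {n : ℕ}

theorem sum_coord_smul_stdVec (w : E n) : ∑ j, w j • (stdVec j : E n) = w := by
  ext i
  simp [Finset.sum_apply, Pi.single_apply]

theorem clm_eq_sum (l : E n →L[ℝ] ℝ) (w : E n) : l w = ∑ j, w j * l (stdVec j) := by
  conv_lhs => rw [← sum_coord_smul_stdVec w]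
  simp [map_sum]

theorem abs_clm_le {l : E n →L[ℝ] ℝ} {M : ℝ} (h : ∀ j, |l (stdVec j)| ≤ M) (w : E n) :
    |l w| ≤ n * M * ‖w‖ := by
  rw [clm_eq_sum]
  calc |∑ j, w j * l (stdVec j)| ≤ ∑ j, |w j * l (stdVec j)| := Finset.abs_sum_le_sum_abs _ _
    _ ≤ ∑ _j : Fin n, ‖w‖ * M := by
      refine Finset.sum_le_sum fun j _ => ?_
      rw [abs_mul]
      exact mul_le_mul (PiLp.norm_apply_le w j) (h j) (abs_nonneg _) (norm_nonneg _)
    _ = n * M * ‖w‖ := by simp; ring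

theorem abs_bilin_le [NeZero n] {B : E n →L[ℝ] E n →L[ℝ] ℝ} {M M₀ : ℝ} (hM : 0 ≤ M)
    (h₀ : |B (stdVec 0) (stdVec 0)| ≤ M₀)
    (h : ∀ j k, (j ≠ 0 ∨ k ≠ 0) → |B (stdVec j) (stdVec k)| ≤ M) (a : E n) :
    |B a a| ≤ M₀ * a 0 ^ 2 + n ^ 2 * M * ‖a‖ ^ 2 := by
  set b := B (stdVec 0) (stdVec 0) with hb
  set B' : E n →L[ℝ] E n →L[ℝ] ℝ := B - b • (coordL (0 : Fin n)).smulRight (coordL (0 : Fin n)) with hB'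
  have hB'a : ∀ v w, B' v w = B v w - b * (v 0 * w 0) := fun v w => by simp [hB']
  have hent : ∀ j k, |B' (stdVec j) (stdVec k)| ≤ M := by
    intro j k
    rw [hB'a]
    by_cases hj : j = 0
    · by_cases hk : k = 0
      · subst hj hk
        simpa [hb] using hM
      · have := h j k (Or.inr hk)
        simpa [Ne.symm hk, hk] using this
    · have := h j k (Or.inl hj)
      simpa [Ne.symm hj, hj] using this
  have h1 : ∀ k, |B' a (stdVec k)| ≤ n * M * ‖a‖ := fun k =>
    abs_clm_le (l := B'.flip (stdVec k)) (fun j => hent j k) a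
  have h2 : |B' a a| ≤ n * (n * M * ‖a‖) * ‖a‖ := abs_clm_le h1 a
  have h3 : B a a = B' a a + b * a 0 ^ 2 := by rw [hB'a]; ring
  rw [h3]
  calc _ ≤ |B' a a| + |b * a 0 ^ 2| := abs_add_le _ _
    _ ≤ n * (n * M * ‖a‖) * ‖a‖ + M₀ * a 0 ^ 2 := by
      gcongr
      rw [abs_mul, abs_of_nonneg (sq_nonneg (a 0))]
      gcongr
    _ = _ := by ring

end Bounds

variable {n : ℕ} [NeZero n] {Ω : Set (E n)} {s u : E n → ℝ}
  {Φ : OpenPartialHomeomorph (E n) (E n)} {P : E n}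

/-- The filter of points `y` of `T` with `y₀ > 0` and `y₀ → 0`. -/
def collarFilter (ξ : E n → ℝ) (T : Set (E n)) : Filter (E n) := comap ξ (𝓝[>] 0) ⊓ 𝓟 T

omit [NeZero n] in
theorem tendsto_collarFilter (ξ : E n → ℝ) (T : Set (E n)) :
    Tendsto ξ (collarFilter ξ T) (𝓝[>] 0) :=
  tendsto_comap.mono_left inf_le_left

omit [NeZero n] in
theorem eventually_mem_collarFilter (ξ : E n → ℝ) (T : Set (E n)) :
    ∀ᶠ x in collarFilter ξ T, x ∈ T :=
  mem_inf_of_right (mem_principal_self T)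

omit [NeZero n] in
theorem eventually_collarFilter_of_nhdsGT {ξ : E n → ℝ} {T : Set (E n)} {p : ℝ → Prop}
    (hp : ∀ᶠ t in 𝓝[>] (0 : ℝ), p t) : ∀ᶠ x in collarFilter ξ T, p (ξ x) :=
  (tendsto_collarFilter ξ T).eventually hp

theorem eventually_le_neg_log (C : ℝ) {ε : ℝ} (hε : 0 < ε) :
    ∀ᶠ t in 𝓝[>] (0 : ℝ), C ≤ ε * -Real.log t := by
  have h : Tendsto (fun t : ℝ => ε * -Real.log t) (𝓝[>] 0) atTop :=
    (tendsto_neg_atBot_atTop.comp Real.tendsto_log_nhdsGT_zero).const_mul_atTop hε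
  exact h.eventually_ge_atTop C

theorem eventually_mul_log_le (C : ℝ) {ε : ℝ} (hε : 0 < ε) :
    ∀ᶠ t in 𝓝[>] (0 : ℝ), C * (t * -Real.log t) ≤ ε := by
  have h : Tendsto (fun t : ℝ => C * (t * -Real.log t)) (𝓝[>] 0) (𝓝 0) := by
    have h1 := (Real.continuous_mul_log.tendsto 0).mono_left
      (nhdsWithin_le_nhds : 𝓝[>] (0 : ℝ) ≤ 𝓝 0)
    have h2 := (h1.neg).const_mul C
    simp only [zero_mul, neg_zero, mul_zero] at h2
    refine h2.congr fun t => ?_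
    ring
  filter_upwards [h.eventually_lt_const hε] with t ht using ht.le

theorem eventually_neg_log_pos : ∀ᶠ t in 𝓝[>] (0 : ℝ), 0 < -Real.log t := by
  filter_upwards [eventually_le_neg_log 1 one_pos] with t ht
  linarith

theorem IsAdapted.coord_self (h : IsAdapted Ω s P Φ) (hP : P ∈ frontier Ω) : Φ P 0 = 0 :=
  (h.mem_frontier_iff P h.mem_source).1 hP

/-- All derivatives of the remainder of orders one and two are small compared with `|log ξ|`,
except for the second normal derivative, which is small compared with `ξ⁻¹`. -/
theorem RemainderDecay.eventually (hd : RemainderDecay Φ u) (hu : ContDiffOn ℝ ∞ u Ω)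
    (hΩ : IsOpen Ω) (h : IsAdapted Ω s P Φ) (hP : P ∈ frontier Ω) :
    ∀ᶠ r in 𝓝[>] (0 : ℝ), ∀ ε > 0,
      ∀ᶠ y in collarFilter (fun y : E n => y 0) (Metric.ball (Φ P) r),
      (∀ j, |fderiv ℝ (remainder Φ u) y (stdVec j)| ≤ ε * -Real.log (y 0)) ∧
      |D2 (remainder Φ u) y (stdVec 0) (stdVec 0)| ≤ ε * (y 0)⁻¹ ∧
      ∀ j k, (j ≠ 0 ∨ k ≠ 0) →
        |D2 (remainder Φ u) y (stdVec j) (stdVec k)| ≤ ε * -Real.log (y 0) := by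
  set f := remainder Φ u with hf
  have hPt : Φ P ∈ Φ.target := Φ.map_source h.mem_source
  have hsm : ∀ y ∈ Φ.target, 0 < y 0 → ContDiffAt ℝ ∞ f y := fun y hy h0 =>
    contDiffAt_remainder hu hΩ h hy h0
  have hsm2 : ∀ y ∈ Φ.target, 0 < y 0 → ContDiffAt ℝ 2 f y := fun y hy h0 =>
    (hsm y hy h0).of_le (WithTop.coe_le_coe.2 le_top : ((2 : ℕ∞) : WithTop ℕ∞) ≤ _)
  obtain ⟨r₀, hr₀, hball⟩ := Metric.nhds_basis_closedBall.mem_iff.1 (Φ.open_target.mem_nhds hPt)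
  have hev3 : ∀ᶠ r in 𝓝[>] (0 : ℝ), Metric.closedBall (Φ P) (3 * r) ⊆ Φ.target := by
    filter_upwards [Ioc_mem_nhdsGT (show 0 < r₀ / 3 by positivity)] with r hr
    exact (Metric.closedBall_subset_closedBall (by linarith [hr.2])).trans hball
  -- The class imposes nothing on purely tangential derivatives. Their normal derivative is `o(|log
  -- ξ|)`, which is integrable in `ξ`, so they stay bounded, and bounded is small compared with
  -- `|log ξ|`.
  have hb1 : ∀ j, j ≠ 0 → ∀ᶠ r in 𝓝[>] (0 : ℝ), ∃ C, ∀ y ∈ Metric.ball (Φ P) r, 0 < y 0 →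
      |fderiv ℝ f y (stdVec j)| ≤ C := by
    intro j hj
    obtain ⟨δ, hδ, hδ'⟩ := exists_of_isLittleO_alpha (a := fun t => -Real.log t)
      (hd.mixed hj) one_pos
    filter_upwards [hev3, Ioo_mem_nhdsGT hδ, Ioo_mem_nhdsGT one_pos] with r h3 hr hr1
    refine exists_bound_of_normal_derivative (g := fun y => fderiv ℝ f y (stdVec j))
      (h.coord_self hP) hr.1 hr1.2 hr.2 h3 (fun y hy h0 => ?_) fun y hy h0 h1 => ?_
    · exact ((differentiableAt_fderiv (hsm2 y hy h0)).clm_apply (differentiableAt_const _))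
    · rw [fderiv_fderiv_apply (hsm2 y hy h0)]
      simpa using hδ' y hy h0 h1
  -- The same argument one order higher; this is what the third-order condition with one normal and
  -- two tangential derivatives is needed for.
  have hb2 : ∀ j k, j ≠ 0 → k ≠ 0 → ∀ᶠ r in 𝓝[>] (0 : ℝ), ∃ C, ∀ y ∈ Metric.ball (Φ P) r,
      0 < y 0 → |D2 f y (stdVec j) (stdVec k)| ≤ C := by
    intro j k hj hk
    obtain ⟨δ, hδ, hδ'⟩ := exists_of_isLittleO_alpha (a := fun t => -Real.log t)
      (hd.third hj hk) one_pos
    filter_upwards [hev3, Ioo_mem_nhdsGT hδ, Ioo_mem_nhdsGT one_pos] with r h3 hr hr1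
    refine exists_bound_of_normal_derivative (g := fun y => D2 f y (stdVec j) (stdVec k))
      (h.coord_self hP) hr.1 hr1.2 hr.2 h3 (fun y hy h0 => ?_) fun y hy h0 h1 => ?_
    · exact (fderiv_D2_apply (hsm y hy h0) 0 _ _).1.differentiableAt
    · rw [(fderiv_D2_apply (hsm y hy h0) _ _ _).2]
      simpa using hδ' y hy h0 h1
  have hb1' : ∀ᶠ r in 𝓝[>] (0 : ℝ), ∀ j, j ≠ 0 → ∃ C, ∀ y ∈ Metric.ball (Φ P) r, 0 < y 0 →
      |fderiv ℝ f y (stdVec j)| ≤ C := by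
    rw [eventually_all]
    intro j
    by_cases hj : j = 0
    · exact Eventually.of_forall fun r hj' => absurd hj hj'
    · filter_upwards [hb1 j hj] with r hr _ using hr
  have hb2' : ∀ᶠ r in 𝓝[>] (0 : ℝ), ∀ j k, j ≠ 0 → k ≠ 0 → ∃ C, ∀ y ∈ Metric.ball (Φ P) r,
      0 < y 0 → |D2 f y (stdVec j) (stdVec k)| ≤ C := by
    rw [eventually_all]
    intro j
    rw [eventually_all]
    intro k
    by_cases hj : j = 0
    · exact Eventually.of_forall fun r hj' => absurd hj hj'
    by_cases hk : k = 0
    · exact Eventually.of_forall fun r _ hk' => absurd hk hk'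
    filter_upwards [hb2 j k hj hk] with r hr _ _ using hr
  filter_upwards [hb1', hb2', hev3, self_mem_nhdsWithin] with r h1 h2 h3 (hr : 0 < r) ε hε
  have hbt : Metric.ball (Φ P) r ⊆ Φ.target :=
    (Metric.ball_subset_closedBall.trans (Metric.closedBall_subset_closedBall (by linarith))).trans h3
  have hle : collarFilter (fun y : E n => y 0) (Metric.ball (Φ P) r) ≤
      comap (fun y : E n => y 0) (𝓝[>] 0) ⊓ 𝓟 Φ.target :=
    inf_le_inf_left _ (principal_mono.2 hbt)
  have hpos : ∀ᶠ y in collarFilter (fun y : E n => y 0) (Metric.ball (Φ P) r), 0 < y 0 :=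
    eventually_collarFilter_of_nhdsGT self_mem_nhdsWithin
  have hlog : ∀ᶠ y in collarFilter (fun y : E n => y 0) (Metric.ball (Φ P) r),
      0 < -Real.log (y 0) := eventually_collarFilter_of_nhdsGT eventually_neg_log_pos
  have hmem := eventually_mem_collarFilter (fun y : E n => y 0) (Metric.ball (Φ P) r)
  have e1 : ∀ᶠ y in collarFilter (fun y : E n => y 0) (Metric.ball (Φ P) r), ∀ j,
      |fderiv ℝ f y (stdVec j)| ≤ ε * -Real.log (y 0) := by
    rw [eventually_all]
    intro j
    by_cases hj : j = 0
    · subst hj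
      filter_upwards [(hd.first.mono hle).def hε, hlog] with y hy hl
      rwa [Real.norm_eq_abs, Real.norm_eq_abs, abs_of_pos hl] at hy
    · obtain ⟨C, hC⟩ := h1 j hj
      filter_upwards [hmem, hpos, eventually_collarFilter_of_nhdsGT (eventually_le_neg_log C hε)]
        with y hy h0 hl
      exact (hC y hy h0).trans hl
  have e2 : ∀ᶠ y in collarFilter (fun y : E n => y 0) (Metric.ball (Φ P) r),
      |D2 f y (stdVec 0) (stdVec 0)| ≤ ε * (y 0)⁻¹ := by
    filter_upwards [(hd.second.mono hle).def hε, hpos] with y hy h0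
    rwa [Real.norm_eq_abs, Real.norm_eq_abs, abs_of_pos (inv_pos.2 h0)] at hy
  have e3 : ∀ k, k ≠ 0 → ∀ᶠ y in collarFilter (fun y : E n => y 0) (Metric.ball (Φ P) r),
      |D2 f y (stdVec 0) (stdVec k)| ≤ ε * -Real.log (y 0) := by
    intro k hk
    filter_upwards [((hd.mixed hk).mono hle).def hε, hlog] with y hy hl
    rwa [Real.norm_eq_abs, Real.norm_eq_abs, abs_of_pos hl] at hy
  have e4 : ∀ᶠ y in collarFilter (fun y : E n => y 0) (Metric.ball (Φ P) r), ∀ j k,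
      (j ≠ 0 ∨ k ≠ 0) → |D2 f y (stdVec j) (stdVec k)| ≤ ε * -Real.log (y 0) := by
    rw [eventually_all]
    intro j
    rw [eventually_all]
    intro k
    by_cases hj : j = 0
    · by_cases hk : k = 0
      · exact Eventually.of_forall fun y hjk => absurd hjk (by simp [hj, hk])
      · subst hj
        filter_upwards [e3 k hk] with y hy _ using hy
    · by_cases hk : k = 0
      · subst hk
        filter_upwards [e3 j hj, hmem, hpos] with y hy hyb h0 _
        rwa [D2_symm (hsm2 y (hbt hyb) h0)]
      · obtain ⟨C, hC⟩ := h2 j k hj hk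
        filter_upwards [hmem, hpos, eventually_collarFilter_of_nhdsGT (eventually_le_neg_log C hε)]
          with y hy h0 hl _
        exact (hC y hy h0).trans hl
  filter_upwards [e1, e2, e4] with y a b c using ⟨a, b, c⟩

end Abreu

/-! ### The second derivative of `u` in the original coordinates -/

namespace Abreu

variable {n : ℕ} [NeZero n] {Ω : Set (E n)} {s u : E n → ℝ}
  {Φ : OpenPartialHomeomorph (E n) (E n)} {P : E n}

omit [NeZero n] in
theorem eventually_chartBall_subset (hP : P ∈ Φ.source) {W : Set (E n)} (hW : W ∈ 𝓝 P) :
    ∀ᶠ r in 𝓝[>] (0 : ℝ), chartBall Φ P r ⊆ W := by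
  have hPt : Φ P ∈ Φ.target := Φ.map_source hP
  have hc : ContinuousAt Φ.symm (Φ P) := Φ.continuousAt_symm hPt
  have hW' : Φ.symm ⁻¹' W ∈ 𝓝 (Φ P) := hc.preimage_mem_nhds (by rwa [Φ.left_inv hP])
  obtain ⟨r₀, hr₀, hball⟩ := Metric.nhds_basis_ball.mem_iff.1 hW'
  filter_upwards [Ioc_mem_nhdsGT hr₀] with r hr x hx
  have := hball (Metric.ball_subset_ball hr.2 hx.2)
  rwa [mem_preimage, Φ.left_inv hx.1] at this

theorem tendsto_chart_collarFilter (r : ℝ) :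
    Tendsto Φ (collarFilter (fun x => Φ x 0) (chartBall Φ P r))
      (collarFilter (fun y : E n => y 0) (Metric.ball (Φ P) r)) := by
  refine tendsto_inf.2 ⟨tendsto_comap_iff.2 ?_, tendsto_principal.2 ?_⟩
  · exact tendsto_collarFilter (fun x => Φ x 0) (chartBall Φ P r)
  · filter_upwards [eventually_mem_collarFilter (fun x => Φ x 0) (chartBall Φ P r)] with x hx
      using hx.2

theorem IsAdapted.contDiffAt_two (h : IsAdapted Ω s P Φ) {x : E n} (hx : x ∈ Φ.source) :
    ContDiffAt ℝ 2 Φ x :=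
  (h.contDiffAt hx).of_le (WithTop.coe_le_coe.2 le_top : ((2 : ℕ∞) : WithTop ℕ∞) ≤ _)

theorem IsAdapted.contDiffAt_coord_two (h : IsAdapted Ω s P Φ) {x : E n} (hx : x ∈ Φ.source) :
    ContDiffAt ℝ 2 (fun y => Φ y 0) x :=
  (h.contDiffAt_coord hx).of_le (WithTop.coe_le_coe.2 le_top : ((2 : ℕ∞) : WithTop ℕ∞) ≤ _)

theorem D2_coord (y : E n) (v w : E n) : D2 (fun y : E n => y 0) y v w = 0 := by
  have h1 : fderiv ℝ (fun y : E n => y 0) = fun _ => coordL 0 := by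
    funext z
    exact (coordL (0 : Fin n)).hasFDerivAt.fderiv
  rw [D2, h1]
  simp

theorem IsAdapted.D2_coord (h : IsAdapted Ω s P Φ) {x : E n} (hx : x ∈ Φ.source) (v w : E n) :
    D2 (fun y => Φ y 0) x v w = (fderiv ℝ (fderiv ℝ Φ) x v w) 0 := by
  have h1 := D2_comp (h := fun y : E n => y 0) (coordL (0 : Fin n)).contDiff.contDiffAt
    (h.contDiffAt_two hx) v w
  rw [Abreu.D2_coord, zero_add] at h1
  rw [h1]
  have h2 : fderiv ℝ (fun y : E n => y 0) (Φ x) = coordL 0 :=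
    (coordL (0 : Fin n)).hasFDerivAt.fderiv
  rw [h2, coordL_apply]

/-- The second derivative of `u = ξ log ξ + f` near the boundary. -/
theorem RemainderDecay.eventually_D2 (hd : RemainderDecay Φ u) (hu : ContDiffOn ℝ ∞ u Ω)
    (hΩ : IsOpen Ω) (h : IsAdapted Ω s P Φ) (hP : P ∈ frontier Ω) :
    ∀ᶠ r in 𝓝[>] (0 : ℝ), ∀ ε > 0,
      ∀ᶠ x in collarFilter (fun x => Φ x 0) (chartBall Φ P r), ∀ v,
      |D2 u x v v - (fderiv ℝ (fun y => Φ y 0) x v) ^ 2 / Φ x 0 -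
          Real.log (Φ x 0) * D2 (fun y => Φ y 0) x v v| ≤
        ε * ((fderiv ℝ (fun y => Φ y 0) x v) ^ 2 / Φ x 0 + -Real.log (Φ x 0) * ‖v‖ ^ 2) := by
  have hn : (0 : ℝ) < n := by exact_mod_cast NeZero.pos n
  have hcd1 : ContinuousAt (fderiv ℝ Φ) P :=
    (((h.contDiffAt_two h.mem_source).fderiv_right (m := 1) (by norm_num))).continuousAt
  have hcd2 : ContinuousAt (fderiv ℝ (fderiv ℝ Φ)) P :=
    (((h.contDiffAt_two h.mem_source).fderiv_right (m := 1) (by norm_num)).fderiv_right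
      (m := 0) (by norm_num)).continuousAt
  set C₁ := ‖fderiv ℝ Φ P‖ + 1 with hC₁
  set C₂ := ‖fderiv ℝ (fderiv ℝ Φ) P‖ + 1 with hC₂
  have hb1 : ∀ᶠ x in 𝓝 P, ‖fderiv ℝ Φ x‖ < C₁ := hcd1.norm.eventually_lt_const (by simp [hC₁])
  have hb2 : ∀ᶠ x in 𝓝 P, ‖fderiv ℝ (fderiv ℝ Φ) x‖ < C₂ :=
    (show ContinuousAt (fun x => ‖fderiv ℝ (fderiv ℝ Φ) x‖) P from
      (continuous_norm (E := E n →L[ℝ] E n →L[ℝ] E n)).continuousAt.comp hcd2).eventually_lt_const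
      (by simp [hC₂])
  have hC₁0 : 0 < C₁ := by positivity
  have hC₂0 : 0 < C₂ := by positivity
  filter_upwards [hd.eventually hu hΩ h hP, eventually_chartBall_subset h.mem_source
    (hb1.and hb2)] with r hr hsub ε hε
  -- The summands of the denominator account for the tangential and mixed part of `D²f`, for `df`
  -- applied to the second derivative of the chart, and for the lower-order term of `d(ξ log ξ)`.
  set ε' : ℝ := min ε (ε / (n ^ 2 * C₁ ^ 2 + n * C₂ + 1)) with hε'
  have hden : 0 < (n : ℝ) ^ 2 * C₁ ^ 2 + n * C₂ + 1 := by positivity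
  have hε'0 : 0 < ε' := lt_min hε (div_pos hε hden)
  have hε'1 : ε' * (n ^ 2 * C₁ ^ 2 + n * C₂ + 1) ≤ ε := by
    have : ε' ≤ ε / (n ^ 2 * C₁ ^ 2 + n * C₂ + 1) := min_le_right _ _
    rwa [le_div_iff₀ hden] at this
  filter_upwards [(tendsto_chart_collarFilter r).eventually (hr ε' hε'0),
    eventually_mem_collarFilter (fun x => Φ x 0) (chartBall Φ P r),
    eventually_collarFilter_of_nhdsGT (ξ := fun x => Φ x 0) (T := chartBall Φ P r)
      self_mem_nhdsWithin,
    eventually_collarFilter_of_nhdsGT (ξ := fun x => Φ x 0) (T := chartBall Φ P r)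
      eventually_neg_log_pos,
    eventually_collarFilter_of_nhdsGT (ξ := fun x => Φ x 0) (T := chartBall Φ P r)
      (eventually_le_neg_log C₂ hε'0)] with x hf hx hx0 hl hlC v
  replace hx0 : 0 < Φ x 0 := hx0
  obtain ⟨hf1, hf2, hf3⟩ := hf
  have hxs := hx.1
  have hxt := Φ.map_source hxs
  set f := remainder Φ u with hfdef
  set l := -Real.log (Φ x 0) with hldef
  set a := fderiv ℝ Φ x v with ha
  set w := fderiv ℝ (fderiv ℝ Φ) x v v with hw
  have hf2at : ContDiffAt ℝ 2 f (Φ x) := (contDiffAt_remainder hu hΩ h hxt hx0).of_le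
    (WithTop.coe_le_coe.2 le_top : ((2 : ℕ∞) : WithTop ℕ∞) ≤ _)
  have hml : ContDiffAt ℝ 2 (fun y : E n => y 0 * Real.log (y 0)) (Φ x) := contDiffAt_mul_log hx0
  have hueq : u =ᶠ[𝓝 x] fun z => (fun y : E n => y 0 * Real.log (y 0) + f y) (Φ z) := by
    filter_upwards [Φ.open_source.mem_nhds hxs] with z hz
    simp [hfdef, remainder, Φ.left_inv hz]
  have hD : D2 u x v v = a 0 ^ 2 / Φ x 0 + D2 f (Φ x) a a + ((1 - l) * w 0 + fderiv ℝ f (Φ x) w) := by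
    rw [D2_congr hueq, D2_comp (hml.add hf2at) (h.contDiffAt_two hxs), D2_add hml hf2at,
      fderiv_fun_add (hml.differentiableAt (by simp)) (hf2at.differentiableAt (by simp)),
      fderiv_mul_log hx0]
    simp only [add_apply, D2_mul_log hx0, smul_apply,
      coordL_apply, smul_eq_mul, hldef, ← ha, ← hw]
    ring
  have hdξ : fderiv ℝ (fun y => Φ y 0) x v = a 0 := by rw [h.fderiv_coord hxs]; rfl
  have hD2ξ : D2 (fun y => Φ y 0) x v v = w 0 := h.D2_coord hxs v v
  have hna : ‖a‖ ≤ C₁ * ‖v‖ := (ContinuousLinearMap.le_opNorm _ _).trans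
    (mul_le_mul_of_nonneg_right (hsub hx).1.le (norm_nonneg _))
  have hnw : ‖w‖ ≤ C₂ * ‖v‖ ^ 2 := by
    calc ‖w‖ ≤ ‖fderiv ℝ (fderiv ℝ Φ) x v‖ * ‖v‖ := ContinuousLinearMap.le_opNorm _ _
      _ ≤ ‖fderiv ℝ (fderiv ℝ Φ) x‖ * ‖v‖ * ‖v‖ := by
        gcongr
        exact ContinuousLinearMap.le_opNorm _ _
      _ ≤ C₂ * ‖v‖ * ‖v‖ := by
        gcongr
        exact (hsub hx).2.le
      _ = C₂ * ‖v‖ ^ 2 := by ring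
  -- This term stems from the `1` in `d(ξ log ξ) = (log ξ + 1) dξ` and is negligible against the
  -- logarithm.
  have hw0 : |w 0| ≤ ε' * l * ‖v‖ ^ 2 := by
    calc |w 0| ≤ ‖w‖ := PiLp.norm_apply_le w 0
      _ ≤ C₂ * ‖v‖ ^ 2 := hnw
      _ ≤ ε' * l * ‖v‖ ^ 2 := by gcongr
  have hfw : |fderiv ℝ f (Φ x) w| ≤ ε' * (n * C₂) * (l * ‖v‖ ^ 2) := by
    calc |fderiv ℝ f (Φ x) w| ≤ n * (ε' * l) * ‖w‖ := abs_clm_le hf1 w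
      _ ≤ n * (ε' * l) * (C₂ * ‖v‖ ^ 2) := by gcongr
      _ = _ := by ring
  have hfa : |D2 f (Φ x) a a| ≤ ε' * (a 0 ^ 2 / Φ x 0) + ε' * (n ^ 2 * C₁ ^ 2) * (l * ‖v‖ ^ 2) := by
    calc |D2 f (Φ x) a a| ≤ ε' * (Φ x 0)⁻¹ * a 0 ^ 2 + n ^ 2 * (ε' * l) * ‖a‖ ^ 2 :=
          abs_bilin_le (by positivity) hf2 hf3 a
      _ ≤ ε' * (Φ x 0)⁻¹ * a 0 ^ 2 + n ^ 2 * (ε' * l) * (C₁ * ‖v‖) ^ 2 := by gcongr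
      _ = _ := by ring
  rw [hD, hdξ, hD2ξ]
  have e1 : a 0 ^ 2 / Φ x 0 + D2 f (Φ x) a a + ((1 - l) * w 0 + fderiv ℝ f (Φ x) w) -
      a 0 ^ 2 / Φ x 0 - Real.log (Φ x 0) * w 0 =
      D2 f (Φ x) a a + w 0 + fderiv ℝ f (Φ x) w := by rw [hldef]; ring
  rw [e1]
  have hq : 0 ≤ a 0 ^ 2 / Φ x 0 := by positivity
  have hlv : 0 ≤ l * ‖v‖ ^ 2 := by positivity
  calc _ ≤ |D2 f (Φ x) a a| + |w 0| + |fderiv ℝ f (Φ x) w| := abs_add_three _ _ _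
    _ ≤ (ε' * (a 0 ^ 2 / Φ x 0) + ε' * (n ^ 2 * C₁ ^ 2) * (l * ‖v‖ ^ 2)) + ε' * l * ‖v‖ ^ 2 +
        ε' * (n * C₂) * (l * ‖v‖ ^ 2) := by gcongr
    _ = ε' * (a 0 ^ 2 / Φ x 0) + ε' * (n ^ 2 * C₁ ^ 2 + n * C₂ + 1) * (l * ‖v‖ ^ 2) := by ring
    _ ≤ ε * (a 0 ^ 2 / Φ x 0) + ε * (l * ‖v‖ ^ 2) := by
      gcongr
      exact min_le_left _ _
    _ = _ := by ring

/-! ### Strict convexity of the boundary -/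

omit [NeZero n] in
theorem D2_eq_zero_of_line {F : E n → ℝ} {y a : E n} (hF : ContDiffAt ℝ 2 F y)
    (h : ∀ᶠ t in 𝓝 (0 : ℝ), F (y + t • a) = 0) : D2 F y a a = 0 := by
  have hline : ∀ t : ℝ, HasDerivAt (fun t : ℝ => y + t • a) a t := fun t => by
    simpa using (hasDerivAt_id t).smul_const a
  have hc : Tendsto (fun t : ℝ => y + t • a) (𝓝 0) (𝓝 y) := by
    have := (hline 0).continuousAt.tendsto
    simpa using this
  have h1 : ∀ᶠ t in 𝓝 (0 : ℝ), fderiv ℝ F (y + t • a) a = 0 := by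
    filter_upwards [h.eventually_nhds, hc.eventually (hF.eventually (by simp))] with t ht hFt
    have h2 := (hFt.differentiableAt (by simp)).hasFDerivAt.comp_hasDerivAt t (hline t)
    have h3 : HasDerivAt (F ∘ fun t : ℝ => y + t • a) 0 t :=
      (hasDerivAt_const t (0 : ℝ)).congr_of_eventuallyEq ht
    exact h2.unique h3
  have h4 : HasFDerivAt (fun z => fderiv ℝ F z a) (fderiv ℝ (fun z => fderiv ℝ F z a) y)
      (y + (0 : ℝ) • a) := by
    rw [zero_smul, add_zero]
    exact ((differentiableAt_fderiv hF).clm_apply (differentiableAt_const a)).hasFDerivAt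
  have h5 := h4.comp_hasDerivAt 0 (hline 0)
  have h6 : HasDerivAt ((fun z => fderiv ℝ F z a) ∘ fun t : ℝ => y + t • a) 0 0 :=
    (hasDerivAt_const (0 : ℝ) (0 : ℝ)).congr_of_eventuallyEq h1
  rw [← fderiv_fderiv_apply hF]
  exact h5.unique h6

omit [NeZero n] in
theorem fderiv_eq_zero_of_line {F : E n → ℝ} {y a : E n} (hF : DifferentiableAt ℝ F y)
    (h : ∀ᶠ t in 𝓝 (0 : ℝ), F (y + t • a) = 0) : fderiv ℝ F y a = 0 := by
  have hline : HasDerivAt (fun t : ℝ => y + t • a) a 0 := by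
    simpa using (hasDerivAt_id (0 : ℝ)).smul_const a
  have h4 : HasFDerivAt F (fderiv ℝ F y) (y + (0 : ℝ) • a) := by
    rw [zero_smul, add_zero]
    exact hF.hasFDerivAt
  exact (h4.comp_hasDerivAt 0 hline).unique
    ((hasDerivAt_const (0 : ℝ) (0 : ℝ)).congr_of_eventuallyEq h)

omit [NeZero n] in
theorem fderiv_nonneg_of_line {F : E n → ℝ} {y a : E n} (hF : DifferentiableAt ℝ F y)
    (h0 : F y = 0) (h : ∀ᶠ t in 𝓝[>] (0 : ℝ), 0 ≤ F (y + t • a)) : 0 ≤ fderiv ℝ F y a := by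
  have hline : HasDerivAt (fun t : ℝ => y + t • a) a 0 := by
    simpa using (hasDerivAt_id (0 : ℝ)).smul_const a
  have h4 : HasFDerivAt F (fderiv ℝ F y) (y + (0 : ℝ) • a) := by
    rw [zero_smul, add_zero]
    exact hF.hasFDerivAt
  have hslope := (hasDerivAt_iff_tendsto_slope.1 (h4.comp_hasDerivAt 0 hline)).mono_left
    (nhdsWithin_mono (0 : ℝ) (fun t (ht : 0 < t) => ht.ne') : 𝓝[>] (0 : ℝ) ≤ 𝓝[≠] 0)
  refine ge_of_tendsto hslope ?_
  filter_upwards [h, self_mem_nhdsWithin] with t ht (ht0 : 0 < t)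
  rw [slope_def_field]
  simp only [Function.comp_apply, zero_smul, add_zero, h0, sub_zero]
  exact div_nonneg ht ht0.le

/-- The boundary-defining coordinate has negative definite second derivative on the tangent space
of a strictly convex boundary. -/
theorem IsAdapted.D2_coord_neg (h : IsAdapted Ω s P Φ) (hΩ : IsOpen Ω)
    (hbd : StrictlyConvexSmoothBoundary Ω) (hP : P ∈ frontier Ω) {w : E n} (hw : w ≠ 0)
    (hwt : fderiv ℝ (fun y => Φ y 0) P w = 0) : D2 (fun y => Φ y 0) P w w < 0 := by
  -- Both `ρ` and `ξ` vanish on the boundary, so `dρ = c dξ` at `P`, with `c > 0` because `dρ ≠ 0`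
  -- and both are positive inside. Along a coordinate line in the hyperplane both composites with
  -- the inverse chart vanish identically. The chain rule then expresses `D²ρ(w,w)` and `D²ξ(w,w)`
  -- as `-dρ` and `-dξ` of one and the same vector, so they differ by the factor `c`.
  obtain ⟨U, ρ, hU, hPU, hρ, hiff, hneg⟩ := hbd P hP
  have hρ0 : ∀ x ∈ U, x ∈ frontier Ω → ρ x = 0 := by
    intro x hx hxf
    have h1 : ¬ 0 < ρ x := fun h0 => by
      have hxΩ := (hiff x hx).2 h0
      have := hxf.2
      rw [hΩ.interior_eq] at this
      exact this hxΩ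
    refine le_antisymm (not_lt.1 h1) ?_
    by_contra hlt
    push Not at hlt
    have h2 : ∀ᶠ z in 𝓝 x, ρ z < 0 ∧ z ∈ U :=
      ((hρ.continuousOn.continuousAt (hU.mem_nhds hx)).eventually_lt_const hlt).and (hU.mem_nhds hx)
    obtain ⟨z, hz, hz'⟩ := (mem_closure_iff_frequently.1 hxf.1).and_eventually h2 |>.exists
    exact absurd ((hiff z hz'.2).1 hz) (not_lt.2 hz'.1.le)
  obtain ⟨hρ1, hρ2⟩ := hneg P hPU (hρ0 P hPU hP)
  have hPs := h.mem_source
  set y := Φ P with hy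
  have hyt : y ∈ Φ.target := Φ.map_source hPs
  have hsy : Φ.symm y = P := Φ.left_inv hPs
  have hy0 : y 0 = 0 := h.coord_self hP
  have hρP : ContDiffAt ℝ 2 ρ P := (hρ.contDiffAt (hU.mem_nhds hPU)).of_le
    (WithTop.coe_le_coe.2 le_top : ((2 : ℕ∞) : WithTop ℕ∞) ≤ _)
  have hΨ : ContDiffAt ℝ 2 Φ.symm y := (h.contDiffAt_symm hyt).of_le
    (WithTop.coe_le_coe.2 le_top : ((2 : ℕ∞) : WithTop ℕ∞) ≤ _)
  have hρP' : ContDiffAt ℝ 2 ρ (Φ.symm y) := by rwa [hsy]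
  have hcomp : ContDiffAt ℝ 2 (fun z => ρ (Φ.symm z)) y := hρP'.comp y hΨ
  have hdcomp : ∀ v, fderiv ℝ (fun z => ρ (Φ.symm z)) y v = fderiv ℝ ρ P (fderiv ℝ Φ.symm y v) := by
    intro v
    have := (hρP'.differentiableAt (by simp)).hasFDerivAt.comp y (h.hasFDerivAt_symm hyt)
    rw [hsy] at this
    rw [show (fun z => ρ (Φ.symm z)) = ρ ∘ Φ.symm from rfl, this.fderiv]
    rfl
  have hline : ∀ b : E n, Tendsto (fun t : ℝ => y + t • b) (𝓝 0) (𝓝 y) := fun b => by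
    have : Continuous fun t : ℝ => y + t • b := by fun_prop
    simpa using this.tendsto 0
  have hnear : ∀ᶠ z in 𝓝 y, z ∈ Φ.target ∧ Φ.symm z ∈ U :=
    Eventually.and (Φ.open_target.mem_nhds hyt) ((Φ.continuousAt_symm hyt).preimage_mem_nhds
      (by rw [hsy]; exact hU.mem_nhds hPU))
  have hzero : ∀ b : E n, b 0 = 0 → ∀ᶠ t in 𝓝 (0 : ℝ), ρ (Φ.symm (y + t • b)) = 0 := by
    intro b hb
    filter_upwards [(hline b).eventually hnear] with t ht
    refine hρ0 _ ht.2 ?_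
    rw [h.mem_frontier_iff _ (Φ.map_target ht.1), Φ.right_inv ht.1]
    simp [hy0, hb]
  set c := fderiv ℝ ρ P (fderiv ℝ Φ.symm y (stdVec 0)) with hc
  have hc0 : 0 ≤ c := by
    rw [hc, ← hdcomp]
    refine fderiv_nonneg_of_line (hcomp.differentiableAt (by simp)) ?_ ?_
    · rw [hsy]; exact hρ0 P hPU hP
    · filter_upwards [((hline (stdVec 0)).mono_left nhdsWithin_le_nhds).eventually hnear,
        self_mem_nhdsWithin] with t ht (ht0 : 0 < t)
      refine ((hiff _ ht.2).1 ?_).le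
      rw [h.mem_iff _ (Φ.map_target ht.1), Φ.right_inv ht.1]
      simpa [hy0] using ht0
  have hprop : ∀ v, fderiv ℝ ρ P v = c * fderiv ℝ (fun y => Φ y 0) P v := by
    intro v
    set b := fderiv ℝ Φ P v with hb
    have hv : v = fderiv ℝ Φ.symm y b := (h.fderiv_symm_fderiv hPs v).symm
    have hb0 : fderiv ℝ (fun y => Φ y 0) P v = b 0 := by rw [h.fderiv_coord hPs]; rfl
    have hsplit : b = (b - b 0 • stdVec 0) + b 0 • stdVec 0 := by abel
    have h1 : fderiv ℝ (fun z => ρ (Φ.symm z)) y (b - b 0 • stdVec 0) = 0 :=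
      fderiv_eq_zero_of_line (hcomp.differentiableAt (by simp)) (hzero _ (by simp))
    rw [hdcomp] at h1
    rw [hb0]
    conv_lhs => rw [hv, hsplit, map_add, map_add, h1, zero_add, map_smul, map_smul]
    rw [smul_eq_mul, mul_comm]
  have hcpos : 0 < c := by
    refine lt_of_le_of_ne hc0 fun h0 => hρ1 ?_
    ext v
    rw [hprop, ← h0, zero_mul]
    rfl
  set a := fderiv ℝ Φ P w with ha
  have ha0 : a 0 = 0 := by rw [← hwt, h.fderiv_coord hPs]; rfl
  have hwa : fderiv ℝ Φ.symm y a = w := h.fderiv_symm_fderiv hPs w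
  have h1 := D2_comp hρP' hΨ a a
  rw [D2_eq_zero_of_line hcomp (hzero a ha0), hsy, hwa] at h1
  have hξ' : ContDiffAt ℝ 2 (fun x => Φ x 0) (Φ.symm y) := by
    rw [hsy]; exact h.contDiffAt_coord_two hPs
  have h2 := D2_comp hξ' hΨ a a
  have h3 : D2 (fun z => Φ (Φ.symm z) 0) y a a = 0 := by
    refine D2_eq_zero_of_line (hξ'.comp y hΨ) ?_
    filter_upwards [(hline a).eventually hnear] with t ht
    rw [Φ.right_inv ht.1]
    simp [hy0, ha0]
  rw [h3, hsy, hwa] at h2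
  have h4 := hρ2 w hw (by rw [hprop, hwt, mul_zero])
  rw [iteratedFDeriv_two_eq_D2] at h4
  rw [hprop] at h1
  nlinarith

end Abreu

/-! ### Coercivity of a form that is negative on a hyperplane -/

namespace Abreu

variable {n : ℕ}

/-- A quadratic form that is negative on the kernel of a linear form becomes negative definite
after subtracting a multiple of the square of the linear form; this is locally uniform. -/
theorem exists_coercive {X : Type*} [TopologicalSpace X] {P : X} {B : X → E n →L[ℝ] E n →L[ℝ] ℝ}
    {L : X → E n →L[ℝ] ℝ} (hB : ContinuousAt B P) (hL : ContinuousAt L P)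
    (hpos : ∀ w, w ≠ 0 → L P w = 0 → B P w w < 0) :
    ∃ c > 0, ∃ C ≥ 0, ∀ᶠ x in 𝓝 P, ∀ v, c * ‖v‖ ^ 2 ≤ -B x v v + C * (L x v) ^ 2 := by
  have hcomp : IsCompact (Metric.sphere (0 : E n) 1) := isCompact_sphere _ _
  have key : ∃ c > 0, ∃ C ≥ 0, ∀ᶠ x in 𝓝 P, ∀ v ∈ Metric.sphere (0 : E n) 1,
      c ≤ -B x v v + C * (L x v) ^ 2 := by
    -- The constants are found near each unit vector by joint continuity in `x` and `v`. Compactness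
    -- of the sphere leaves finitely many, and the smallest `c` and largest `C` serve for all.
    refine hcomp.induction_on (p := fun T => ∃ c > 0, ∃ C ≥ 0, ∀ᶠ x in 𝓝 P, ∀ v ∈ T,
      c ≤ -B x v v + C * (L x v) ^ 2) ?_ ?_ ?_ ?_
    · exact ⟨1, one_pos, 0, le_rfl, by simp⟩
    · rintro T T' hTT' ⟨c, hc, C, hC, h⟩
      exact ⟨c, hc, C, hC, h.mono fun x hx v hv => hx v (hTT' hv)⟩
    · rintro T T' ⟨c, hc, C, hC, h⟩ ⟨c', hc', C', hC', h'⟩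
      refine ⟨min c c', lt_min hc hc', max C C', le_max_of_le_left hC, ?_⟩
      filter_upwards [h, h'] with x hx hx' v hv
      rcases hv with hv | hv
      · calc min c c' ≤ c := min_le_left _ _
          _ ≤ _ := hx v hv
          _ ≤ _ := by gcongr; exact le_max_left _ _
      · calc min c c' ≤ c' := min_le_right _ _
          _ ≤ _ := hx' v hv
          _ ≤ _ := by gcongr; exact le_max_right _ _
    · intro v hv
      have hv0 : v ≠ 0 := fun h0 => by simp [h0] at hv
      obtain ⟨C, hC, hCv⟩ : ∃ C ≥ 0, 0 < -B P v v + C * (L P v) ^ 2 := by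
        by_cases h0 : L P v = 0
        · exact ⟨0, le_rfl, by simpa using hpos v hv0 h0⟩
        · have hsq : 0 < (L P v) ^ 2 := by positivity
          refine ⟨(1 + |B P v v|) / (L P v) ^ 2, by positivity, ?_⟩
          rw [div_mul_cancel₀ _ hsq.ne']
          linarith [le_abs_self (B P v v)]
      have hcont : ContinuousAt (fun p : X × E n => -B p.1 p.2 p.2 + C * (L p.1 p.2) ^ 2) (P, v) := by
        have h1 : ContinuousAt (fun p : X × E n => B p.1) (P, v) :=
          ContinuousAt.comp (g := B) (f := Prod.fst) hB continuousAt_fst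
        have h2 : ContinuousAt (fun p : X × E n => L p.1) (P, v) :=
          ContinuousAt.comp (g := L) (f := Prod.fst) hL continuousAt_fst
        have h3 : ContinuousAt (fun p : X × E n => p.2) (P, v) := continuousAt_snd
        exact ((h1.clm_apply h3).clm_apply h3).neg.add (((h2.clm_apply h3).pow 2).const_mul C)
      set c := (-B P v v + C * (L P v) ^ 2) / 2 with hc
      have hev : ∀ᶠ p : X × E n in 𝓝 (P, v), c < -B p.1 p.2 p.2 + C * (L p.1 p.2) ^ 2 :=
        hcont.eventually_const_lt (by simp only [hc]; linarith)
      rw [nhds_prod_eq, eventually_prod_iff] at hev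
      obtain ⟨pa, hpa, pb, hpb, hab⟩ := hev
      refine ⟨{w | pb w}, mem_nhdsWithin_of_mem_nhds hpb, c, by simp only [hc]; linarith, C, hC, ?_⟩
      filter_upwards [hpa] with x hx w hw using (hab hx hw).le
  obtain ⟨c, hc, C, hC, h⟩ := key
  refine ⟨c, hc, C, hC, h.mono fun x hx v => ?_⟩
  by_cases hv : v = 0
  · simp [hv]
  have hnv : 0 < ‖v‖ := norm_pos_iff.2 hv
  have h1 := hx (‖v‖⁻¹ • v) (by simp [norm_smul, hnv.ne'])
  simp only [map_smul, _root_.smul_apply, smul_eq_mul] at h1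
  have h2 := mul_le_mul_of_nonneg_left h1 (sq_nonneg ‖v‖)
  calc c * ‖v‖ ^ 2 = ‖v‖ ^ 2 * c := mul_comm _ _
    _ ≤ _ := h2
    _ = _ := by field_simp

/-! ### The inverse of the Hessian -/

/-- The vector dual to the linear form `α` with respect to the Hessian of `u`. -/
noncomputable def sharp (u : E n → ℝ) (x : E n) (α : E n →L[ℝ] ℝ) : E n :=
  WithLp.toLp 2 ((hessian u x)⁻¹.mulVec fun i => α (stdVec i))

theorem sharp_coord (u : E n → ℝ) (x : E n) (i j : Fin n) :
    sharp u x (coordL j) i = (hessian u x)⁻¹ i j := by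
  simp [sharp, Matrix.mulVec, dotProduct]

theorem hessian_symm {u : E n → ℝ} {x : E n} (hu : ContDiffAt ℝ 2 u x) :
    (hessian u x).transpose = hessian u x := by
  ext i j
  rw [Matrix.transpose_apply, hessian_eq_D2 hu, hessian_eq_D2 hu, D2_symm hu]

/-- This replaces explicit inversion: estimates for `u^{ij}` come from evaluating the quadratic form
`D²u` at dual vectors, where it reproduces the linear form. -/
theorem D2_sharp {u : E n → ℝ} {x : E n} (hu : ContDiffAt ℝ 2 u x) (hdet : (hessian u x).PosDef)
    (α : E n →L[ℝ] ℝ) (w : E n) : D2 u x w (sharp u x α) = α w := by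
  have h1 : (hessian u x).mulVec (sharp u x α) = fun i => α (stdVec i) := by
    rw [sharp, Matrix.mulVec_mulVec, Matrix.mul_nonsing_inv _ hdet.det_pos.ne'.isUnit,
      Matrix.one_mulVec]
  have h2 : ∀ i, D2 u x (stdVec i) (sharp u x α) = α (stdVec i) := by
    intro i
    rw [clm_eq_sum (D2 u x (stdVec i)), ← congrFun h1 i]
    simp only [Matrix.mulVec, dotProduct, hessian_eq_D2 hu]
    exact Finset.sum_congr rfl fun j _ => mul_comm _ _
  have h3 := clm_eq_sum ((D2 u x).flip (sharp u x α)) w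
  simp only [ContinuousLinearMap.flip_apply, h2] at h3
  rw [h3, ← clm_eq_sum]

/-- The contraction `∑ u^{ij} B(eⱼ, eᵢ)` of a bilinear form with the inverse of the Hessian. -/
noncomputable def contract (u : E n → ℝ) (x : E n) (B : Fin n → Fin n → ℝ) : ℝ :=
  ∑ i, ∑ j, (hessian u x)⁻¹ i j * B j i

theorem contract_mul (u : E n → ℝ) (x : E n) (α β : E n →L[ℝ] ℝ) :
    contract u x (fun j i => α (stdVec j) * β (stdVec i)) = β (sharp u x α) := by
  rw [clm_eq_sum β, contract]
  refine Finset.sum_congr rfl fun i _ => ?_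
  simp only [sharp, Matrix.mulVec, dotProduct, Finset.sum_mul]
  exact Finset.sum_congr rfl fun j _ => by ring

theorem abs_contract_le {u : E n → ℝ} {x : E n} {ε M : ℝ} {B : Fin n → Fin n → ℝ}
    (hU : ∀ i j, |(hessian u x)⁻¹ i j| ≤ ε) (hB : ∀ i j, |B i j| ≤ M) :
    |contract u x B| ≤ n ^ 2 * ε * M := by
  calc |contract u x B| ≤ ∑ i, ∑ j, |(hessian u x)⁻¹ i j * B j i| :=
        (Finset.abs_sum_le_sum_abs _ _).trans
          (Finset.sum_le_sum fun i _ => Finset.abs_sum_le_sum_abs _ _)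
    _ ≤ ∑ _i : Fin n, ∑ _j : Fin n, ε * M := by
      refine Finset.sum_le_sum fun i _ => Finset.sum_le_sum fun j _ => ?_
      rw [abs_mul]
      exact mul_le_mul (hU i j) (hB j i) (abs_nonneg _) ((abs_nonneg _).trans (hU i j))
    _ = n ^ 2 * ε * M := by simp; ring

variable [NeZero n] {Ω : Set (E n)} {s u : E n → ℝ}
  {Φ : OpenPartialHomeomorph (E n) (E n)} {P : E n}

set_option maxHeartbeats 1000000 in
/-- Near the boundary, the inverse of the Hessian of `u` is small, and the square of the length of
`dξ` with respect to it is asymptotic to `ξ`. -/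
theorem RemainderDecay.eventually_inverse (hd : RemainderDecay Φ u) (hu : ContDiffOn ℝ ∞ u Ω)
    (hpd : ∀ x ∈ Ω, (hessian u x).PosDef)
    (hΩ : IsOpen Ω) (hbd : StrictlyConvexSmoothBoundary Ω) (h : IsAdapted Ω s P Φ)
    (hP : P ∈ frontier Ω) :
    ∀ᶠ r in 𝓝[>] (0 : ℝ), ∀ ε > 0,
      ∀ᶠ x in collarFilter (fun x => Φ x 0) (chartBall Φ P r),
      (∀ i j, |(hessian u x)⁻¹ i j| ≤ ε) ∧
      |contract u x (fun j i => fderiv ℝ (fun y => Φ y 0) x (stdVec j) *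
        fderiv ℝ (fun y => Φ y 0) x (stdVec i)) - Φ x 0| ≤ ε * Φ x 0 := by
  set ξ : E n → ℝ := fun y => Φ y 0 with hξ
  have hξP : ContDiffAt ℝ 2 ξ P := h.contDiffAt_coord_two h.mem_source
  have hcL : ContinuousAt (fderiv ℝ ξ) P := (hξP.fderiv_right (m := 1) (by norm_num)).continuousAt
  have hcB : ContinuousAt (D2 ξ) P :=
    ((hξP.fderiv_right (m := 1) (by norm_num)).fderiv_right (m := 0) (by norm_num)).continuousAt
  obtain ⟨c, hc, C, hC, hcoer⟩ := exists_coercive (B := D2 ξ) (L := fderiv ℝ ξ)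
    hcB hcL fun w hw hw0 => h.D2_coord_neg hΩ hbd hP hw hw0
  -- A fixed transversal vector, the trial vector for the lower bound. Near `P` its `dξ`-value `d`
  -- exceeds `1/2`, so that `1 ≤ 4 d ^ 2`; this is the source of the factor `4` below.
  set v₀ := fderiv ℝ Φ.symm (Φ P) (stdVec 0) with hv₀
  have hdv₀ : fderiv ℝ ξ P v₀ = 1 := by
    have := h.fderiv_coord_symm (Φ.map_source h.mem_source) (stdVec 0)
    rw [Φ.left_inv h.mem_source] at this
    simpa using this
  have hev1 : ∀ᶠ x in 𝓝 P, 1 / 2 < fderiv ℝ ξ x v₀ :=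
    (hcL.clm_apply continuousAt_const).eventually_const_lt (by
      change (1 / 2 : ℝ) < fderiv ℝ ξ P v₀
      rw [hdv₀]; norm_num)
  set C₂ := |D2 ξ P v₀ v₀| + 1 with hC₂
  have hev2 : ∀ᶠ x in 𝓝 P, |D2 ξ x v₀ v₀| < C₂ :=
    ((hcB.clm_apply continuousAt_const).clm_apply continuousAt_const).abs.eventually_lt_const
      (by simp [hC₂])
  filter_upwards [hd.eventually_D2 hu hΩ h hP, eventually_chartBall_subset h.mem_source
    (hcoer.and (hev1.and hev2))] with r hr hsub ε hε
  obtain ⟨ε', hε'0, hε'c, hε'1, hε'2⟩ : ∃ ε' > 0, ε' ≤ c / 2 ∧ 2 * ε' ≤ 1 / 2 ∧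
      2 * ε' * (1 + ε) ≤ ε := by
    refine ⟨min (c / 2) (min (1 / 4) (ε / (2 * (1 + ε)))), by positivity, min_le_left _ _, ?_, ?_⟩
    · have : min (c / 2) (min (1 / 4) (ε / (2 * (1 + ε)))) ≤ 1 / 4 :=
        (min_le_right _ _).trans (min_le_left _ _)
      linarith
    · have : min (c / 2) (min (1 / 4) (ε / (2 * (1 + ε)))) ≤ ε / (2 * (1 + ε)) :=
        (min_le_right _ _).trans (min_le_right _ _)
      rw [le_div_iff₀ (by positivity)] at this
      linarith
  have hfil := fun {p : ℝ → Prop} (hp : ∀ᶠ t in 𝓝[>] (0 : ℝ), p t) =>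
    eventually_collarFilter_of_nhdsGT (ξ := ξ) (T := chartBall Φ P r) hp
  filter_upwards [hr ε' hε'0, eventually_mem_collarFilter ξ (chartBall Φ P r),
    hfil self_mem_nhdsWithin, hfil eventually_neg_log_pos, hfil (eventually_mul_log_le C hε'0),
    hfil (eventually_mul_log_le (4 * (C₂ + ‖v₀‖ ^ 2)) hε'0),
    hfil (eventually_le_neg_log (2 / c) hε)] with x hD hx hx0 hl hlC hlC₂ hlε
  replace hx0 : 0 < ξ x := hx0
  obtain ⟨hcx, hd12, hDv₀⟩ := hsub hx
  have hxΩ : x ∈ Ω := (h.mem_iff x hx.1).2 hx0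
  have hux : ContDiffAt ℝ 2 u x := (hu.contDiffAt (hΩ.mem_nhds hxΩ)).of_le
    (WithTop.coe_le_coe.2 le_top : ((2 : ℕ∞) : WithTop ℕ∞) ≤ _)
  have hpx := hpd x hxΩ
  set l := -Real.log (ξ x) with hldef
  -- Coercivity bounds `log ξ · D²ξ(v,v)` below by `l (c ‖v‖² - C dξ(v)²)`. Since `ξ l → 0`, the
  -- negative term costs at most `ε' dξ(v)²/ξ`; the error of the asymptotic expansion costs another
  -- `ε'` and half of `c`.
  have hlow : ∀ v, (1 - 2 * ε') * ((fderiv ℝ ξ x v) ^ 2 / ξ x) + c / 2 * l * ‖v‖ ^ 2 ≤ D2 u x v v := by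
    intro v
    have h1 := (abs_le.1 (hD v)).1
    have h2 := hcx v
    set q := (fderiv ℝ ξ x v) ^ 2 / ξ x with hq
    have hq0 : 0 ≤ q := by positivity
    have hqξ : (fderiv ℝ ξ x v) ^ 2 = q * ξ x := by rw [hq]; field_simp
    rw [hqξ] at h2
    have h3 : C * (ξ x * l) * q ≤ ε' * q := mul_le_mul_of_nonneg_right hlC hq0
    have h4 : ε' * (l * ‖v‖ ^ 2) ≤ c / 2 * (l * ‖v‖ ^ 2) :=
      mul_le_mul_of_nonneg_right hε'c (by positivity)
    have h5 := mul_le_mul_of_nonneg_left h2 hl.le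
    have h6 : Real.log (ξ x) = -l := by rw [hldef]; ring
    rw [h6] at h1
    change -(ε' * (q + l * ‖v‖ ^ 2)) ≤ D2 u x v v - q - -l * D2 ξ x v v at h1
    nlinarith
  have hsharp : ∀ α : E n →L[ℝ] ℝ, D2 u x (sharp u x α) (sharp u x α) = α (sharp u x α) :=
    fun α => D2_sharp hux hpx α _
  constructor
  · intro i j
    rw [← sharp_coord]
    -- For the dual vector of a coordinate the form equals `z j ≤ ‖z‖`, so the tangential part of
    -- the lower bound yields `‖z‖ ≤ 2 / (c l)`, which is small.
    set z := sharp u x (coordL j) with hz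
    have h1 := hlow z
    rw [hsharp, coordL_apply] at h1
    have h2 : |z j| ≤ ‖z‖ := PiLp.norm_apply_le z j
    have h3 : |z i| ≤ ‖z‖ := PiLp.norm_apply_le z i
    have h4 : 0 ≤ (1 - 2 * ε') * ((fderiv ℝ ξ x z) ^ 2 / ξ x) :=
      mul_nonneg (by linarith) (by positivity)
    have h5 : c / 2 * l * ‖z‖ ^ 2 ≤ ‖z‖ := by linarith [le_abs_self (z j)]
    refine h3.trans ?_
    by_cases hz0 : ‖z‖ = 0
    · rw [hz0]; exact hε.le
    have hzp : 0 < ‖z‖ := lt_of_le_of_ne (norm_nonneg _) (Ne.symm hz0)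
    have h6 : c / 2 * l * ‖z‖ ≤ 1 := by
      by_contra hcon
      push Not at hcon
      nlinarith
    have h7 : 1 ≤ c / 2 * (ε * l) := by
      have : 2 / c ≤ ε * l := hlε
      rw [div_le_iff₀ hc] at this
      linarith
    have hcl : 0 < c / 2 * l := by positivity
    by_contra hcon
    push Not at hcon
    nlinarith
  · rw [contract_mul]
    set z := sharp u x (fderiv ℝ ξ x) with hz
    set q := fderiv ℝ ξ x z with hq
    have hzz : D2 u x z z = q := hsharp _
    -- At the dual vector of `dξ` the form and `dξ` take the same value `q`, so the normal part of
    -- the lower bound is quadratic in `q`; dividing by `q` bounds it by `ξ / (1 - 2 ε')`.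
    have hup : (1 - 2 * ε') * (q ^ 2 / ξ x) ≤ q := by
      have h1 := hlow z
      rw [hzz] at h1
      have : 0 ≤ c / 2 * l * ‖z‖ ^ 2 := by positivity
      linarith
    have hq0 : 0 ≤ q := le_trans (mul_nonneg (by linarith) (by positivity)) hup
    have hup' : q ≤ (1 + ε) * ξ x := by
      by_cases hq1 : q = 0
      · rw [hq1]; positivity
      have hqp : 0 < q := lt_of_le_of_ne hq0 (Ne.symm hq1)
      have h1 : (1 - 2 * ε') * q ≤ ξ x := by
        rw [← mul_div_assoc, div_le_iff₀ hx0] at hup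
        have : q * ((1 - 2 * ε') * q) ≤ q * ξ x := by nlinarith
        exact le_of_mul_le_mul_left this hqp
      nlinarith
    set d := fderiv ℝ ξ x v₀ with hddef
    have hd0 : 0 < d := by linarith
    have hQ0 : D2 u x v₀ v₀ ≤ (1 + 2 * ε') * (d ^ 2 / ξ x) := by
      have h1 := (abs_le.1 (hD v₀)).2
      have h6 : Real.log (ξ x) = -l := by rw [hldef]; ring
      rw [h6] at h1
      change D2 u x v₀ v₀ - d ^ 2 / ξ x - -l * D2 ξ x v₀ v₀ ≤
        ε' * (d ^ 2 / ξ x + l * ‖v₀‖ ^ 2) at h1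
      have h2 : l * (C₂ + ‖v₀‖ ^ 2) ≤ ε' * (d ^ 2 / ξ x) := by
        rw [← mul_div_assoc, le_div_iff₀ hx0]
        have hd2 : 1 ≤ 4 * d ^ 2 := by nlinarith
        have h7 : 4 * (C₂ + ‖v₀‖ ^ 2) * (ξ x * l) ≤ ε' := hlC₂
        have h8 : ε' ≤ ε' * (4 * d ^ 2) := le_mul_of_one_le_right hε'0.le hd2
        linarith
      have h3 : -(l * D2 ξ x v₀ v₀) ≤ l * C₂ := by
        have h7 := mul_le_mul_of_nonneg_left (neg_le.1 (abs_le.1 hDv₀.le).1) hl.le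
        linarith
      have h4 : ε' * (l * ‖v₀‖ ^ 2) ≤ l * ‖v₀‖ ^ 2 :=
        mul_le_of_le_one_left (by positivity) (by linarith)
      linarith
    have hlow' : (1 - ε) * ξ x ≤ q := by
      -- This `t` minimises the upper bound `q - 2 t d + t² (1 + 2 ε') d² / ξ` for the nonnegative
      -- form at `z - t v₀`, and nonnegativity becomes `ξ / (1 + 2 ε') ≤ q`.
      set t := ξ x / ((1 + 2 * ε') * d) with ht
      have h1 : 0 ≤ D2 u x (z - t • v₀) (z - t • v₀) := by
        refine le_trans ?_ (hlow _)
        have : 0 ≤ (1 - 2 * ε') * ((fderiv ℝ ξ x (z - t • v₀)) ^ 2 / ξ x) :=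
          mul_nonneg (by linarith) (by positivity)
        positivity
      have h2 : D2 u x (z - t • v₀) (z - t • v₀) = q - 2 * t * d + t ^ 2 * D2 u x v₀ v₀ := by
        have h3 : D2 u x v₀ z = d := D2_sharp hux hpx _ _
        have h4 : D2 u x z v₀ = d := by rw [D2_symm hux, h3]
        simp only [map_sub, map_smul, _root_.sub_apply, _root_.smul_apply,
          smul_eq_mul, hzz, h3, h4]
        ring
      have h5 : t ^ 2 * D2 u x v₀ v₀ ≤ t ^ 2 * ((1 + 2 * ε') * (d ^ 2 / ξ x)) :=
        mul_le_mul_of_nonneg_left hQ0 (sq_nonneg t)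
      have h6 : t ^ 2 * ((1 + 2 * ε') * (d ^ 2 / ξ x)) = t * d := by
        rw [ht]
        field_simp
      have h7 : t * d = ξ x / (1 + 2 * ε') := by
        rw [ht]
        field_simp
      have h8 : (1 - ε) * ξ x ≤ ξ x / (1 + 2 * ε') := by
        rw [le_div_iff₀ (by positivity)]
        have h9 : (1 - ε) * (1 + 2 * ε') ≤ 1 := by linarith [mul_pos hε'0 hε]
        calc (1 - ε) * ξ x * (1 + 2 * ε') = ((1 - ε) * (1 + 2 * ε')) * ξ x := by ring
          _ ≤ 1 * ξ x := mul_le_mul_of_nonneg_right h9 hx0.le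
          _ = ξ x := one_mul _
      linarith
    rw [abs_le]
    constructor <;> linarith

end Abreu

/-! ### Cutoff functions and localisation -/

namespace Abreu

open scoped Manifold in
/-- Smooth cutoff functions. -/
theorem exists_smooth_cutoff {n : ℕ} {K U : Set (E n)} (hK : IsCompact K) (hU : IsOpen U)
    (hKU : K ⊆ U) : ∃ χ : E n → ℝ, ContDiff ℝ ∞ χ ∧ HasCompactSupport χ ∧ tsupport χ ⊆ U ∧
      (∀ᶠ x in 𝓝ˢ K, χ x = 1) ∧ ∀ x, χ x ∈ Icc (0 : ℝ) 1 := by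
  obtain ⟨K', hK', hKK', hK'U⟩ := exists_compact_between hK hU hKU
  obtain ⟨f, hf0, hf1, hf⟩ := exists_contMDiffMap_zero_one_nhds_of_isClosed (n := ⊤)
    (𝓘(ℝ, E n)) isOpen_interior.isClosed_compl hK.isClosed
    (disjoint_left.2 fun x hx hx' => hx (hKK' hx'))
  have hsub : tsupport f ⊆ K' := by
    refine closure_minimal (fun x hx => ?_) hK'.isClosed
    by_contra hxK
    exact hx (hf0.self_of_nhdsSet x fun h => hxK (interior_subset h))
  exact ⟨f, f.contMDiff.contDiff, hK'.of_isClosed_subset (isClosed_tsupport f) hsub,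
    hsub.trans hK'U, hf1, hf⟩

/-- A property of smooth functions with compact support that is stable under gluing holds if it
holds locally. -/
theorem smooth_local_induction {n : ℕ} {p : (E n → ℝ) → Prop}
    (hglue : ∀ ψ χ : E n → ℝ, ContDiff ℝ ∞ ψ → HasCompactSupport ψ → ContDiff ℝ ∞ χ →
      (∀ x, χ x ∈ Icc (0 : ℝ) 1) → p (fun x => χ x * ψ x) → p (fun x => (1 - χ x) * ψ x) → p ψ)
    (hloc : ∀ x, ∃ N ∈ 𝓝 x, ∀ ψ, ContDiff ℝ ∞ ψ → HasCompactSupport ψ → tsupport ψ ⊆ N → p ψ)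
    {ψ : E n → ℝ} (hψ : ContDiff ℝ ∞ ψ) (hψc : HasCompactSupport ψ) : p ψ := by
  obtain ⟨N, hN, hψN, h⟩ : ∃ N, IsOpen N ∧ tsupport ψ ⊆ N ∧
      ∀ ψ, ContDiff ℝ ∞ ψ → HasCompactSupport ψ → tsupport ψ ⊆ N → p ψ := by
    refine hψc.isCompact.induction_on (p := fun T => ∃ N, IsOpen N ∧ T ⊆ N ∧
      ∀ ψ, ContDiff ℝ ∞ ψ → HasCompactSupport ψ → tsupport ψ ⊆ N → p ψ) ?_ ?_ ?_ ?_
    · refine ⟨∅, isOpen_empty, Subset.rfl, fun ψ h1 h2 h3 => ?_⟩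
      obtain ⟨N, -, h⟩ := hloc 0
      exact h ψ h1 h2 (h3.trans (empty_subset _))
    · rintro T T' hTT' ⟨N, hN, hT, h⟩
      exact ⟨N, hN, hTT'.trans hT, h⟩
    · rintro T T' ⟨N, hN, hT, h⟩ ⟨N', hN', hT', h'⟩
      refine ⟨N ∪ N', hN.union hN', union_subset_union hT hT', fun ψ h1 h2 h3 => ?_⟩
      -- The cutoff is `1` near the part of the support outside `N'`, so `χ ψ` lives in `N` and `(1
      -- - χ) ψ` in `N'`. The values of `χ` in `[0, 1]` keep both pieces nonnegative when `ψ` is.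
      obtain ⟨χ, hχ, hχc, hχN, hχ1, hχ01⟩ := exists_smooth_cutoff (K := tsupport ψ \ N') (U := N)
        (h2.isCompact.diff hN') hN fun x hx => (h3 hx.1).resolve_right hx.2
      refine hglue ψ χ h1 h2 hχ hχ01 ?_ ?_
      · exact h _ (hχ.mul h1) h2.mul_left ((tsupport_mul_subset_left).trans hχN)
      · refine h' _ ((contDiff_const.sub hχ).mul h1) h2.mul_left fun x hx => ?_
        by_contra hxN
        have hxψ : x ∈ tsupport ψ := tsupport_mul_subset_right hx
        have : (fun x => (1 - χ x) * ψ x) =ᶠ[𝓝 x] 0 := by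
          filter_upwards [hχ1.filter_mono (nhds_le_nhdsSet (show x ∈ tsupport ψ \ N' from ⟨hxψ, hxN⟩))] with y hy
          simp [hy]
        exact (notMem_tsupport_iff_eventuallyEq.2 this) hx
    · intro x _
      obtain ⟨N, hN, h⟩ := hloc x
      exact ⟨interior N, mem_nhdsWithin_of_mem_nhds (interior_mem_nhds.2 hN), interior N,
        isOpen_interior, Subset.rfl, fun ψ h1 h2 h3 => h ψ h1 h2 (h3.trans interior_subset)⟩
  exact h ψ hψ hψc hψN

/-! ### Integration by parts for functions supported inside `Ω` -/

section Parts

variable {n : ℕ} {Ω K : Set (E n)}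

theorem integrable_of_continuousOn_of_zero {g : E n → ℝ} (hΩ : IsOpen Ω) (hK : IsCompact K)
    (hKΩ : K ⊆ Ω) (hg : ContinuousOn g Ω) (h0 : ∀ x, x ∉ K → g x = 0) : Integrable g := by
  have h1 : Ω.indicator g = g := by
    funext x
    by_cases hx : x ∈ Ω
    · exact indicator_of_mem hx g
    · rw [indicator_of_notMem hx, h0 x fun h => hx (hKΩ h)]
  have h2 := continuous_indicator_of_isClosed hΩ hK.isClosed hKΩ (fun x _ hx => h0 x hx) hg
  rw [h1] at h2
  exact h2.integrable_of_hasCompactSupport (HasCompactSupport.intro hK h0)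

theorem integral_pderiv_mul (hΩ : IsOpen Ω) {f ψ : E n → ℝ} (hf : ContDiffOn ℝ 1 f Ω)
    (hψ : ContDiff ℝ 1 ψ) (hψc : HasCompactSupport ψ) (hψΩ : tsupport ψ ⊆ Ω) (i : Fin n) :
    ∫ x in Ω, pderiv i f x * ψ x = -∫ x in Ω, f x * pderiv i ψ x := by
  have h0 : ∀ x, x ∉ tsupport ψ → ψ x = 0 := fun x hx => image_eq_zero_of_notMem_tsupport hx
  have h0' : ∀ x, x ∉ tsupport ψ → pderiv i ψ x = 0 := fun x hx => by
    rw [pderiv, image_eq_zero_of_notMem_tsupport fun h => hx (tsupport_fderiv_subset ℝ h)]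
    rfl
  have hfd : ContinuousOn (fun x => pderiv i f x) Ω :=
    (hf.continuousOn_fderiv_of_isOpen hΩ le_rfl).clm_apply continuousOn_const
  have hψd : Continuous (fun x => pderiv i ψ x) :=
    (hψ.continuous_fderiv one_ne_zero).clm_apply continuous_const
  have key := integral_mul_fderiv_eq_neg_fderiv_mul_of_integrable (μ := (volume : Measure (E n)))
    (f := f) (g := ψ) (v := stdVec i)
    (integrable_of_continuousOn_of_zero hΩ hψc hψΩ (hfd.mul hψ.continuous.continuousOn)
      fun x hx => by rw [h0 x hx, mul_zero])
    (integrable_of_continuousOn_of_zero hΩ hψc hψΩ (hf.continuousOn.mul hψd.continuousOn)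
      fun x hx => by change f x * pderiv i ψ x = 0; rw [h0' x hx, mul_zero])
    (integrable_of_continuousOn_of_zero hΩ hψc hψΩ (hf.continuousOn.mul hψ.continuous.continuousOn)
      fun x hx => by rw [h0 x hx, mul_zero])
    (fun x hx => (hf.contDiffAt (hΩ.mem_nhds (hψΩ hx))).differentiableAt (by simp))
    (fun x _ => hψ.differentiable (by simp) x)
  rw [setIntegral_eq_integral_of_forall_compl_eq_zero fun x hx => by
      rw [h0 x fun h => hx (hψΩ h), mul_zero],
    setIntegral_eq_integral_of_forall_compl_eq_zero fun x hx => by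
      rw [h0' x fun h => hx (hψΩ h), mul_zero]]
  rw [eq_neg_iff_add_eq_zero, ← eq_neg_iff_add_eq_zero.1 key, add_comm]
  rfl

theorem integral_mul_pderiv_pderiv (hΩ : IsOpen Ω) {f ψ : E n → ℝ} (hf : ContDiffOn ℝ ∞ f Ω)
    (hψ : ContDiff ℝ ∞ ψ) (hψc : HasCompactSupport ψ) (hψΩ : tsupport ψ ⊆ Ω) (i j : Fin n) :
    ∫ x in Ω, f x * pderiv j (pderiv i ψ) x = ∫ x in Ω, pderiv i (pderiv j f) x * ψ x := by
  have hψi : ContDiff ℝ ∞ (pderiv i ψ) :=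
    (hψ.fderiv_right (m := ∞) (by simp)).clm_apply contDiff_const
  have hsub : tsupport (pderiv i ψ) ⊆ tsupport ψ := by
    refine closure_minimal (fun x hx => ?_) (isClosed_tsupport ψ)
    by_contra h
    refine hx ?_
    rw [pderiv, image_eq_zero_of_notMem_tsupport fun h' => h (tsupport_fderiv_subset ℝ h')]
    rfl
  have hfj : ContDiffOn ℝ ∞ (pderiv j f) Ω :=
    (hf.fderiv_of_isOpen hΩ (m := ∞) (by simp)).clm_apply contDiffOn_const
  have h1 := integral_pderiv_mul hΩ (hf.of_le (by simp)) (hψi.of_le (by simp))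
    (hψc.of_isClosed_subset (isClosed_tsupport _) hsub) (hsub.trans hψΩ) j
  have h2 := integral_pderiv_mul hΩ (hfj.of_le (by simp)) (hψ.of_le (by simp)) hψc hψΩ i
  linarith

end Parts

/-! ### The operator `∑ u^{ij} ∂ᵢ∂ⱼ` on functions supported inside `Ω` -/

section Inverse

variable {n : ℕ} {Ω : Set (E n)} {u A : E n → ℝ}

theorem contDiffOn_det {X : Type*} [NormedAddCommGroup X] [NormedSpace ℝ X] {T : Set X}
    {k : WithTop ℕ∞} {M : X → Matrix (Fin n) (Fin n) ℝ}
    (hM : ∀ i j, ContDiffOn ℝ k (fun x => M x i j) T) : ContDiffOn ℝ k (fun x => (M x).det) T := by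
  simp only [Matrix.det_apply]
  exact ContDiffOn.sum fun σ _ => (contDiffOn_prod fun i _ => hM _ _).const_smul _

theorem contDiffOn_hessian (hΩ : IsOpen Ω) (hu : ContDiffOn ℝ ∞ u Ω) (i j : Fin n) :
    ContDiffOn ℝ ∞ (fun x => hessian u x i j) Ω :=
  (((hu.fderiv_of_isOpen hΩ (m := ∞) (by simp)).clm_apply contDiffOn_const).fderiv_of_isOpen hΩ
    (m := ∞) (by simp)).clm_apply contDiffOn_const

theorem contDiffOn_invHessian (hΩ : IsOpen Ω) (hu : ContDiffOn ℝ ∞ u Ω)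
    (hpd : ∀ x ∈ Ω, (hessian u x).PosDef) (i j : Fin n) :
    ContDiffOn ℝ ∞ (fun x => (hessian u x)⁻¹ i j) Ω := by
  have h1 := contDiffOn_hessian hΩ hu
  have h2 : ContDiffOn ℝ ∞ (fun x => ((hessian u x).det)⁻¹ * (hessian u x).adjugate i j) Ω := by
    refine ((contDiffOn_det h1).inv fun x hx => (hpd x hx).det_pos.ne').mul ?_
    simp only [Matrix.adjugate_apply]
    refine contDiffOn_det fun k l => ?_
    by_cases hk : k = j
    · subst hk
      simp only [Matrix.updateRow_self]
      exact contDiffOn_const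
    · simp only [Matrix.updateRow_ne hk]
      exact h1 k l
  refine h2.congr fun x hx => ?_
  rw [Matrix.inv_def, Ring.inverse_eq_inv']
  rfl

/-- The linearised operator `∑ u^{ij} ψ_{ij}`. -/
noncomputable def trHess (u ψ : E n → ℝ) (x : E n) : ℝ :=
  contract u x fun j i => D2 ψ x (stdVec j) (stdVec i)

theorem continuousOn_trHess (hΩ : IsOpen Ω) (hu : ContDiffOn ℝ ∞ u Ω)
    (hpd : ∀ x ∈ Ω, (hessian u x).PosDef) {ψ : E n → ℝ} (hψ : ContDiff ℝ ∞ ψ) :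
    ContinuousOn (trHess u ψ) Ω := by
  change ContinuousOn (fun x => ∑ i, ∑ j, (hessian u x)⁻¹ i j * D2 ψ x (stdVec j) (stdVec i)) Ω
  refine continuousOn_finsetSum _ fun i _ => continuousOn_finsetSum _ fun j _ => ?_
  refine (contDiffOn_invHessian hΩ hu hpd i j).continuousOn.mul (Continuous.continuousOn ?_)
  exact (((hψ.fderiv_right (m := ∞) (by simp)).fderiv_right (m := ∞)
    (by simp)).continuous.clm_apply continuous_const).clm_apply continuous_const

/-- Two integrations by parts move the derivatives onto `u^{ij}`, where the Abreu equation evaluates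
them. With the support inside `Ω` there is no boundary term. -/
theorem integral_trHess_of_tsupport_subset (hΩ : IsOpen Ω) (hu : ContDiffOn ℝ ∞ u Ω)
    (hpd : ∀ x ∈ Ω, (hessian u x).PosDef) (hA : SolvesAbreu Ω A u) {ψ : E n → ℝ}
    (hψ : ContDiff ℝ ∞ ψ) (hψc : HasCompactSupport ψ) (hψΩ : tsupport ψ ⊆ Ω) :
    ∫ x in Ω, trHess u ψ x = -∫ x in Ω, A x * ψ x := by
  have h0 : ∀ x, x ∉ tsupport ψ → ψ x = 0 := fun x hx => image_eq_zero_of_notMem_tsupport hx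
  have hU := contDiffOn_invHessian hΩ hu hpd
  have hd2 : ∀ (x : E n) (i j : Fin n), D2 ψ x (stdVec j) (stdVec i) = pderiv j (pderiv i ψ) x :=
    fun x i j => (hessian_eq_D2 (hψ.contDiffAt.of_le
      (WithTop.coe_le_coe.2 le_top : ((2 : ℕ∞) : WithTop ℕ∞) ≤ _)) j i).symm
  have h0' : ∀ (x : E n), x ∉ tsupport ψ → D2 ψ x = 0 := fun x hx => by
    have : ψ =ᶠ[𝓝 x] fun _ => 0 := notMem_tsupport_iff_eventuallyEq.1 hx
    rw [D2_congr this]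
    simp [D2]
  have hc2 : ∀ i j : Fin n, Continuous fun x => D2 ψ x (stdVec j) (stdVec i) := fun i j =>
    (((hψ.fderiv_right (m := ∞) (by simp)).fderiv_right (m := ∞)
    (by simp)).continuous.clm_apply continuous_const).clm_apply continuous_const
  have hint1 : ∀ i j, Integrable (fun x => (hessian u x)⁻¹ i j * D2 ψ x (stdVec j) (stdVec i))
      (volume.restrict Ω) := fun i j =>
    (integrable_of_continuousOn_of_zero hΩ hψc hψΩ
      ((hU i j).continuousOn.mul (hc2 i j).continuousOn)
      fun x hx => by simp [h0' x hx]).integrableOn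
  have hint2 : ∀ i j, Integrable (fun x => pderiv i (pderiv j fun y => (hessian u y)⁻¹ i j) x * ψ x)
      (volume.restrict Ω) := fun i j => by
    refine (integrable_of_continuousOn_of_zero hΩ hψc hψΩ
      (ContinuousOn.mul ?_ hψ.continuous.continuousOn)
      fun x hx => by simp [h0 x hx]).integrableOn
    exact ((((hU i j).fderiv_of_isOpen hΩ (m := ∞) (by simp)).clm_apply
      contDiffOn_const).fderiv_of_isOpen hΩ (m := ∞) (by simp)).continuousOn.clm_apply
      continuousOn_const
  calc ∫ x in Ω, trHess u ψ x
      = ∑ i, ∑ j, ∫ x in Ω, (hessian u x)⁻¹ i j * D2 ψ x (stdVec j) (stdVec i) := by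
        simp only [trHess, contract]
        rw [integral_finsetSum _ fun i _ => integrable_finsetSum _ fun j _ => hint1 i j]
        exact Finset.sum_congr rfl fun i _ => integral_finsetSum _ fun j _ => hint1 i j
    _ = ∑ i, ∑ j, ∫ x in Ω, pderiv i (pderiv j fun y => (hessian u y)⁻¹ i j) x * ψ x := by
        refine Finset.sum_congr rfl fun i _ => Finset.sum_congr rfl fun j _ => ?_
        simp only [hd2]
        exact integral_mul_pderiv_pderiv hΩ (hU i j) hψ hψc hψΩ i j
    _ = ∫ x in Ω, ∑ i, ∑ j, pderiv i (pderiv j fun y => (hessian u y)⁻¹ i j) x * ψ x := by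
        rw [integral_finsetSum _ fun i _ => integrable_finsetSum _ fun j _ => hint2 i j]
        exact Finset.sum_congr rfl fun i _ => (integral_finsetSum _ fun j _ => hint2 i j).symm
    _ = ∫ x in Ω, -(A x * ψ x) := by
        refine setIntegral_congr_fun hΩ.measurableSet fun x hx => ?_
        simp only [← Finset.sum_mul]
        rw [hA x hx]
        ring
    _ = _ := integral_neg _

/-- The integrand is the divergence of the vector field `ψ(x) (x - p)`, which has compact support in
`Ω`. -/
theorem integral_div_of_tsupport_subset (hΩ : IsOpen Ω) {ψ : E n → ℝ}
    (hψ : ContDiff ℝ ∞ ψ) (hψc : HasCompactSupport ψ) (hψΩ : tsupport ψ ⊆ Ω) (p : E n) :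
    ∫ x in Ω, (n * ψ x + fderiv ℝ ψ x (x - p)) = 0 := by
  have hd : ∀ i, ContDiff ℝ 1 fun x : E n => x i - p i := fun i =>
    (coordL i).contDiff.sub contDiff_const
  have hpd : ∀ (i : Fin n) (x : E n), pderiv i (fun x : E n => x i - p i) x = 1 := by
    intro i x
    have : HasFDerivAt (fun x : E n => x i - p i) (coordL i) x :=
      (coordL i).hasFDerivAt.sub_const (p i)
    rw [pderiv, this.fderiv, coordL_apply]
    simp
  have h0' : ∀ (i : Fin n) (x : E n), x ∉ tsupport ψ → pderiv i ψ x = 0 := fun i x hx => by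
    rw [pderiv, image_eq_zero_of_notMem_tsupport fun h => hx (tsupport_fderiv_subset ℝ h)]
    rfl
  have hint1 : Integrable ψ (volume.restrict Ω) :=
    (hψ.continuous.integrable_of_hasCompactSupport hψc).integrableOn
  have hint2 : ∀ i, Integrable (fun x => (x i - p i) * pderiv i ψ x) (volume.restrict Ω) :=
    fun i => (integrable_of_continuousOn_of_zero hΩ hψc hψΩ ((hd i).continuous.mul
      ((hψ.continuous_fderiv (by simp)).clm_apply continuous_const)).continuousOn
      fun x hx => by
        change (x i - p i) * pderiv i ψ x = 0
        rw [h0' i x hx, mul_zero]).integrableOn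
  have hpt : ∀ x, n * ψ x + fderiv ℝ ψ x (x - p) = ∑ i, (ψ x + (x i - p i) * pderiv i ψ x) := by
    intro x
    rw [Finset.sum_add_distrib, clm_eq_sum (fderiv ℝ ψ x) (x - p)]
    simp [pderiv]
  simp only [hpt]
  rw [integral_finsetSum (f := fun i x => ψ x + (x i - p i) * pderiv i ψ x) _
    fun i _ => hint1.add (hint2 i)]
  refine Finset.sum_eq_zero fun i _ => ?_
  rw [integral_add hint1 (hint2 i)]
  have := integral_pderiv_mul hΩ (hd i).contDiffOn (hψ.of_le (by simp)) hψc hψΩ i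
  simp only [hpd, one_mul] at this
  linarith

end Inverse

end Abreu

namespace Abreu

/-! ### A smooth step function -/

/-- A smooth function that vanishes for `r ≤ 1` and equals `1` for `2 ≤ r`. -/
noncomputable def step (r : ℝ) : ℝ := Real.smoothTransition (r - 1)

theorem contDiff_step : ContDiff ℝ ∞ step :=
  Real.smoothTransition.contDiff.comp (contDiff_id.sub contDiff_const)

theorem step_eq_zero {r : ℝ} (hr : r ≤ 1) : step r = 0 :=
  Real.smoothTransition.zero_of_nonpos (by linarith)

theorem step_eq_one {r : ℝ} (hr : 2 ≤ r) : step r = 1 :=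
  Real.smoothTransition.one_of_one_le (by linarith)

theorem step_mem (r : ℝ) : step r ∈ Icc (0 : ℝ) 1 :=
  ⟨Real.smoothTransition.nonneg _, Real.smoothTransition.le_one _⟩

theorem deriv_step_eventuallyEq {r : ℝ} (hr : r ∉ Icc (1 : ℝ) 2) :
    deriv step =ᶠ[𝓝 r] fun _ => 0 := by
  have hev : ∃ c : ℝ, step =ᶠ[𝓝 r] fun _ => c := by
    rw [mem_Icc, not_and_or, not_le, not_le] at hr
    rcases hr with hr | hr
    · exact ⟨0, by filter_upwards [eventually_lt_nhds hr] with t ht using step_eq_zero ht.le⟩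
    · exact ⟨1, by filter_upwards [eventually_gt_nhds hr] with t ht using step_eq_one ht.le⟩
  obtain ⟨c, hc⟩ := hev
  exact hc.deriv.trans (by simp)

theorem deriv_step_eq_zero {r : ℝ} (hr : r ∉ Icc (1 : ℝ) 2) : deriv step r = 0 :=
  (deriv_step_eventuallyEq hr).self_of_nhds

theorem deriv_deriv_step_eq_zero {r : ℝ} (hr : r ∉ Icc (1 : ℝ) 2) : deriv (deriv step) r = 0 := by
  rw [(deriv_step_eventuallyEq hr).deriv_eq, deriv_const]

theorem contDiff_deriv_step : ContDiff ℝ ∞ (deriv step) :=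
  (contDiff_infty_iff_deriv.1 contDiff_step).2

theorem contDiff_deriv_deriv_step : ContDiff ℝ ∞ (deriv (deriv step)) :=
  (contDiff_infty_iff_deriv.1 contDiff_deriv_step).2

theorem integral_deriv_step : ∫ r, deriv step r = 1 := by
  rw [← intervalIntegral.integral_eq_integral_of_support_subset (a := 0) (b := 3) fun r hr => ?_]
  · rw [intervalIntegral.integral_deriv_eq_sub
      (fun x _ => contDiff_step.differentiable (by simp) x)
      (contDiff_deriv_step.continuous.intervalIntegrable _ _), step_eq_one (by norm_num),
      step_eq_zero (by norm_num), sub_zero]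
  · by_contra h
    exact hr (deriv_step_eq_zero fun h' => h ⟨by linarith [h'.1], by linarith [h'.2]⟩)

/-- The primitive `r step' - step` falls from `0` to `-1`. This constant is the coefficient with
which `σ` appears in the limit of the collar terms. -/
theorem integral_mul_deriv_deriv_step : ∫ r, r * deriv (deriv step) r = -1 := by
  rw [← intervalIntegral.integral_eq_integral_of_support_subset (a := 0) (b := 3) fun r hr => ?_]
  · have hd : ∀ x ∈ uIcc (0 : ℝ) 3, HasDerivAt (fun r => r * deriv step r - step r)
        (x * deriv (deriv step) x) x := fun x _ => by
      have h1 := (contDiff_step.differentiable (by simp) x).hasDerivAt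
      have h2 := (contDiff_deriv_step.differentiable (by simp) x).hasDerivAt
      exact (((hasDerivAt_id x).mul h2).sub h1).congr_deriv (by simp)
    rw [intervalIntegral.integral_eq_sub_of_hasDerivAt hd
      ((continuous_id.mul contDiff_deriv_deriv_step.continuous).intervalIntegrable _ _),
      step_eq_one (by norm_num), step_eq_zero (by norm_num),
      deriv_step_eq_zero (r := 3) (by norm_num), deriv_step_eq_zero (r := 0) (by norm_num)]
    norm_num
  · by_contra h
    refine hr ?_
    change r * deriv (deriv step) r = 0
    rw [deriv_deriv_step_eq_zero fun h' => h ⟨by linarith [h'.1], by linarith [h'.2]⟩, mul_zero]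

/-! ### Cutting off a collar of the boundary -/

/-- The function `step (ξ / δ)` on the domain of a chart. -/
noncomputable def collarCut {n : ℕ} [NeZero n] (Φ : OpenPartialHomeomorph (E n) (E n))
    (N : Set (E n)) (δ : ℝ) : E n → ℝ :=
  N.indicator fun x => step (Φ x 0 / δ)

section Cut

variable {n : ℕ} [NeZero n] {Ω N : Set (E n)} {s : E n → ℝ}
  {Φ : OpenPartialHomeomorph (E n) (E n)} {P : E n} {δ : ℝ}

theorem collarCut_mem (x : E n) : collarCut Φ N δ x ∈ Icc (0 : ℝ) 1 := by
  by_cases hx : x ∈ N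
  · rw [collarCut, indicator_of_mem hx]; exact step_mem _
  · rw [collarCut, indicator_of_notMem hx]; simp

theorem IsAdapted.continuousOn_coord (h : IsAdapted Ω s P Φ) (hN : N ⊆ Φ.source) :
    ContinuousOn (fun x => Φ x 0) N :=
  (coordL (0 : Fin n)).continuous.comp_continuousOn (h.smooth.continuousOn.mono hN)

theorem IsAdapted.measurable_collarCut (h : IsAdapted Ω s P Φ) (hN : IsOpen N)
    (hNs : N ⊆ Φ.source) : Measurable (collarCut Φ N δ) := by
  refine measurable_of_restrict_of_restrict_compl hN.measurableSet ?_ ?_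
  · have : ContinuousOn (collarCut Φ N δ) N :=
      ((contDiff_step.continuous.comp_continuousOn
        ((h.continuousOn_coord hNs).div_const δ))).congr fun x hx => indicator_of_mem hx _
    exact (continuousOn_iff_continuous_domRestrict.1 this).measurable
  · have : ContinuousOn (collarCut Φ N δ) Nᶜ :=
      continuousOn_const.congr fun x hx => indicator_of_notMem hx _
    exact (continuousOn_iff_continuous_domRestrict.1 this).measurable

theorem collarCut_mul_eventuallyEq (hN : IsOpen N) {ψ : E n → ℝ} {x : E n} (hx : x ∈ N) :
    (fun x => collarCut Φ N δ x * ψ x) =ᶠ[𝓝 x] fun x => step (Φ x 0 / δ) * ψ x := by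
  filter_upwards [hN.mem_nhds hx] with y hy
  rw [collarCut, indicator_of_mem hy]

/-- The factor `ψ` removes the jump of the cutoff at the edge of `N`, and vanishing for `ξ < δ`
confines the closed support to `{ξ ≥ δ}`. The product is thus admissible for the interior
integrations by parts. -/
theorem IsAdapted.contDiff_collarCut_mul (h : IsAdapted Ω s P Φ) (hN : IsOpen N)
    (hNs : N ⊆ Φ.source) (hδ : 0 < δ) {ψ : E n → ℝ} (hψ : ContDiff ℝ ∞ ψ)
    (hψc : HasCompactSupport ψ) (hψN : tsupport ψ ⊆ N) :
    ContDiff ℝ ∞ (fun x => collarCut Φ N δ x * ψ x) ∧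
      HasCompactSupport (fun x => collarCut Φ N δ x * ψ x) ∧
      tsupport (fun x => collarCut Φ N δ x * ψ x) ⊆ Ω := by
  have h0 : ∀ x, x ∉ tsupport ψ → ψ x = 0 := fun x hx => image_eq_zero_of_notMem_tsupport hx
  refine ⟨?_, hψc.mul_left, ?_⟩
  · have h1 := contDiff_indicator (k := ∞) hN (isClosed_tsupport ψ) hψN
      (g := fun x => step (Φ x 0 / δ) * ψ x) (fun x _ hx => by rw [h0 x hx, mul_zero])
      ((contDiff_step.comp_contDiffOn
        (((coordL (0 : Fin n)).contDiff.comp_contDiffOn (h.smooth.mono hNs)).div_const δ)).mul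
        hψ.contDiffOn)
    convert h1 using 1
    funext x
    by_cases hx : x ∈ N
    · rw [collarCut, indicator_of_mem hx, indicator_of_mem hx]
    · rw [collarCut, indicator_of_notMem hx, indicator_of_notMem hx, zero_mul]
  · have hcl : IsClosed (tsupport ψ ∩ (fun x => Φ x 0) ⁻¹' Ici δ) :=
      (h.continuousOn_coord (hψN.trans hNs)).preimage_isClosed_of_isClosed
        (isClosed_tsupport ψ) isClosed_Ici
    have hsub : tsupport (fun x => collarCut Φ N δ x * ψ x) ⊆
        tsupport ψ ∩ (fun x => Φ x 0) ⁻¹' Ici δ := by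
      refine closure_minimal (fun x hx => ?_) hcl
      have hxψ : x ∈ tsupport ψ := by
        by_contra hxψ
        exact hx (by simp only [h0 x hxψ, mul_zero])
      refine ⟨hxψ, ?_⟩
      by_contra hxδ
      rw [mem_preimage, mem_Ici, not_le] at hxδ
      refine hx ?_
      simp only [collarCut, indicator_of_mem (hψN hxψ)]
      rw [step_eq_zero ((div_le_one hδ).2 hxδ.le), zero_mul]
    intro x hx
    obtain ⟨hx1, hx2⟩ := hsub hx
    exact (h.mem_iff x (hNs (hψN hx1))).2 (lt_of_lt_of_le hδ hx2)

theorem IsAdapted.tendsto_integral_collarCut_mul (h : IsAdapted Ω s P Φ) (hΩ : IsOpen Ω)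
    (hN : IsOpen N) (hNs : N ⊆ Φ.source) {G : E n → ℝ} (hG : IntegrableOn G Ω)
    (hG0 : ∀ x, x ∉ N → G x = 0) :
    Tendsto (fun δ => ∫ x in Ω, collarCut Φ N δ x * G x) (𝓝[>] 0) (𝓝 (∫ x in Ω, G x)) := by
  refine tendsto_integral_filter_of_dominated_convergence (fun x => ‖G x‖)
    (Eventually.of_forall fun δ => (h.measurable_collarCut hN hNs).aestronglyMeasurable.mul
      hG.aestronglyMeasurable) (Eventually.of_forall fun δ => ae_of_all _ fun x => ?_) hG.norm
    ((ae_restrict_iff' hΩ.measurableSet).2 (ae_of_all _ fun x hx => ?_))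
  · have := collarCut_mem (Φ := Φ) (N := N) (δ := δ) x
    rw [norm_mul, Real.norm_of_nonneg this.1]
    exact mul_le_of_le_one_left (norm_nonneg _) this.2
  · by_cases hxN : x ∈ N
    · have hx0 : 0 < Φ x 0 := (h.mem_iff x (hNs hxN)).1 hx
      refine tendsto_const_nhds.congr' ?_
      filter_upwards [self_mem_nhdsWithin,
        mem_nhdsWithin_of_mem_nhds (Iio_mem_nhds (half_pos hx0))] with δ hδ hδ2
      rw [mem_Iio] at hδ2
      rw [collarCut, indicator_of_mem hxN, step_eq_one, one_mul]
      rw [le_div_iff₀ hδ]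
      linarith
    · simp [hG0 x hxN]

end Cut

/-! ### Product and chain rules for the linearised operator -/

section Contract

variable {n : ℕ} {u : E n → ℝ} {x : E n}

theorem contract_add (B B' : Fin n → Fin n → ℝ) :
    contract u x (fun j i => B j i + B' j i) = contract u x B + contract u x B' := by
  simp only [contract, mul_add, Finset.sum_add_distrib]

theorem contract_const_mul (c : ℝ) (B : Fin n → Fin n → ℝ) :
    contract u x (fun j i => c * B j i) = c * contract u x B := by
  simp only [contract, Finset.mul_sum]
  exact Finset.sum_congr rfl fun i _ => Finset.sum_congr rfl fun j _ => by ring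

theorem trHess_congr {ψ φ : E n → ℝ} (h : ψ =ᶠ[𝓝 x] φ) : trHess u ψ x = trHess u φ x := by
  rw [trHess, trHess, D2_congr h]

theorem trHess_mul {χ ψ : E n → ℝ} (hχ : ContDiffAt ℝ 2 χ x) (hψ : ContDiffAt ℝ 2 ψ x) :
    trHess u (fun y => χ y * ψ y) x = χ x * trHess u ψ x + ψ x * trHess u χ x +
      contract u x (fun j i => fderiv ℝ χ x (stdVec j) * fderiv ℝ ψ x (stdVec i)) +
      contract u x (fun j i => fderiv ℝ ψ x (stdVec j) * fderiv ℝ χ x (stdVec i)) := by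
  simp only [trHess, D2_mul hχ hψ, contract_add, contract_const_mul]

theorem fderiv_step_div {ξ : E n → ℝ} (hξ : ContDiffAt ℝ 2 ξ x) (δ : ℝ) :
    fderiv ℝ (fun y => step (ξ y / δ)) x = (deriv step (ξ x / δ) * δ⁻¹) • fderiv ℝ ξ x := by
  have h := fderiv_scalar_comp (h := step) (ξ := fun y => ξ y / δ) contDiff_step (hξ.div_const δ)
  rw [h, mul_smul]
  congr 1
  simp only [div_eq_inv_mul]
  rw [fderiv_const_mul (hξ.differentiableAt (by simp))]

theorem D2_div_const {ξ : E n → ℝ} (hξ : ContDiffAt ℝ 2 ξ x) (δ : ℝ) (v w : E n) :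
    D2 (fun y => ξ y / δ) x v w = δ⁻¹ * D2 ξ x v w := by
  have := D2_mul (g := fun _ => δ⁻¹) (h := ξ) contDiffAt_const hξ v w
  simp only [div_eq_inv_mul]
  rw [this]
  simp [D2]

theorem trHess_step_div {ξ : E n → ℝ} (hξ : ContDiffAt ℝ 2 ξ x) (δ : ℝ) :
    trHess u (fun y => step (ξ y / δ)) x =
      deriv (deriv step) (ξ x / δ) * (δ⁻¹) ^ 2 *
        contract u x (fun j i => fderiv ℝ ξ x (stdVec j) * fderiv ℝ ξ x (stdVec i)) +
      deriv step (ξ x / δ) * δ⁻¹ * trHess u ξ x := by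
  have hd : fderiv ℝ (fun y => ξ y / δ) x = δ⁻¹ • fderiv ℝ ξ x := by
    simp only [div_eq_inv_mul]
    rw [fderiv_const_mul (hξ.differentiableAt (by simp))]
  have h := D2_scalar_comp (h := step) (ξ := fun y => ξ y / δ) contDiff_step (hξ.div_const δ)
  rw [trHess, trHess, ← contract_const_mul, ← contract_const_mul, ← contract_add]
  congr 1
  funext j i
  rw [h, D2_div_const hξ, hd]
  simp only [_root_.smul_apply, smul_eq_mul]
  ring

end Contract

theorem exists_of_eventually_collarFilter {n : ℕ} {ξ : E n → ℝ} {T : Set (E n)} {p : E n → Prop}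
    (h : ∀ᶠ x in collarFilter ξ T, p x) : ∃ δ > 0, ∀ x ∈ T, 0 < ξ x → ξ x < δ → p x := by
  rw [collarFilter, eventually_inf_principal, eventually_comap] at h
  obtain ⟨δ, hδ, hh⟩ := mem_nhdsGT_iff_exists_Ioo_subset.1 h
  exact ⟨δ, hδ, fun x hx h1 h2 => hh ⟨h1, h2⟩ x rfl hx⟩

end Abreu

/-! ### Integrability and the boundary term of the linearised operator -/

namespace Abreu

variable {n : ℕ} [NeZero n] {Ω : Set (E n)} {s u A : E n → ℝ}

omit [NeZero n] in
theorem IsSmoothConvexDomain.isCompact_closure (hΩ : IsSmoothConvexDomain Ω) :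
    IsCompact (closure Ω) :=
  hΩ.isBounded.isCompact_closure

omit [NeZero n] in
theorem IsSmoothConvexDomain.isCompact_frontier (hΩ : IsSmoothConvexDomain Ω) :
    IsCompact (frontier Ω) :=
  hΩ.isCompact_closure.of_isClosed_subset isClosed_frontier frontier_subset_closure

omit [NeZero n] in
theorem IsSmoothConvexDomain.volume_lt_top (hΩ : IsSmoothConvexDomain Ω) : volume Ω < ⊤ :=
  hΩ.isBounded.measure_lt_top

omit [NeZero n] in
theorem IsSmoothConvexDomain.mem_or (_hΩ : IsSmoothConvexDomain Ω) (x : E n) :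
    x ∈ Ω ∨ x ∈ frontier Ω ∨ x ∈ (closure Ω)ᶜ := by
  by_cases h1 : x ∈ Ω
  · exact Or.inl h1
  by_cases h2 : x ∈ closure Ω
  · exact Or.inr (Or.inl ⟨h2, fun h => h1 (interior_subset h)⟩)
  · exact Or.inr (Or.inr h2)

/-- The inverse of the Hessian of a function of class `𝒮_{Ω,σ}` is bounded. -/
theorem ClassS.exists_bound_invHessian (hu : ClassS Ω s u) (hΩ : IsSmoothConvexDomain Ω) :
    ∃ M ≥ 0, ∀ x ∈ Ω, ∀ i j, |(hessian u x)⁻¹ i j| ≤ M := by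
  have key : ∃ M ≥ 0, ∀ x ∈ closure Ω, x ∈ Ω → ∀ i j, |(hessian u x)⁻¹ i j| ≤ M := by
    refine hΩ.isCompact_closure.induction_on
      (p := fun T => ∃ M ≥ 0, ∀ x ∈ T, x ∈ Ω → ∀ i j, |(hessian u x)⁻¹ i j| ≤ M)
      ⟨0, le_rfl, by simp⟩ ?_ ?_ ?_
    · rintro T T' hTT' ⟨M, hM, h⟩
      exact ⟨M, hM, fun x hx => h x (hTT' hx)⟩
    · rintro T T' ⟨M, hM, h⟩ ⟨M', hM', h'⟩
      refine ⟨max M M', le_max_of_le_left hM, fun x hx hxΩ i j => ?_⟩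
      rcases hx with hx | hx
      · exact (h x hx hxΩ i j).trans (le_max_left _ _)
      · exact (h' x hx hxΩ i j).trans (le_max_right _ _)
    · intro P hP
      by_cases hPΩ : P ∈ Ω
      · have hc : ∀ i j, ∀ᶠ x in 𝓝 P, |(hessian u x)⁻¹ i j| ≤
            ∑ i, ∑ j, |(hessian u P)⁻¹ i j| + 1 := by
          intro i j
          have h1 := ((contDiffOn_invHessian hΩ.isOpen hu.smooth hu.strictlyConvex i
            j).continuousOn.continuousAt (hΩ.isOpen.mem_nhds hPΩ)).abs
          refine (h1.eventually_lt_const ?_).mono fun x hx => le_of_lt hx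
          have h2 := Finset.single_le_sum (f := fun j => |(hessian u P)⁻¹ i j|)
            (fun j _ => abs_nonneg _) (Finset.mem_univ j)
          have h3 := Finset.single_le_sum (f := fun i => ∑ j, |(hessian u P)⁻¹ i j|)
            (fun i _ => Finset.sum_nonneg fun j _ => abs_nonneg _) (Finset.mem_univ i)
          linarith
        refine ⟨_, mem_nhdsWithin_of_mem_nhds (eventually_all.2 fun i => eventually_all.2 (hc i)),
          _, ?_, fun x hx _ => hx⟩
        positivity
      · have hPf : P ∈ frontier Ω := ⟨hP, fun h => hPΩ (interior_subset h)⟩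
        obtain ⟨Φ, h, hd⟩ := hu.boundary P hPf
        obtain ⟨r, hr, hr0⟩ := ((RemainderDecay.eventually_inverse (u := u) hd hu.smooth
          hu.strictlyConvex hΩ.isOpen hΩ.boundary h hPf).and self_mem_nhdsWithin).exists
        obtain ⟨δ, hδ, hδ'⟩ := exists_of_eventually_collarFilter (hr 1 one_pos)
        have hcont : ContinuousAt (fun x => Φ x 0) P :=
          (h.contDiffAt_coord_two h.mem_source).continuousAt
        refine ⟨_, mem_nhdsWithin_of_mem_nhds (inter_mem (isOpen_chartBall.mem_nhds
          (mem_chartBall_self h.mem_source hr0)) (hcont.eventually_lt_const (u := δ)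
          (by simpa only [h.coord_self hPf] using hδ))), 1, zero_le_one, fun x hx hxΩ => ?_⟩
        exact (hδ' x hx.1 ((h.mem_iff x hx.1.1).1 hxΩ) hx.2).1
  obtain ⟨M, hM, h⟩ := key
  exact ⟨M, hM, fun x hx => h x (subset_closure hx) hx⟩

theorem ClassS.integrableOn_trHess (hu : ClassS Ω s u) (hΩ : IsSmoothConvexDomain Ω)
    {ψ : E n → ℝ} (hψ : ContDiff ℝ ∞ ψ) : IntegrableOn (trHess u ψ) Ω := by
  obtain ⟨M, hM, hMx⟩ := hu.exists_bound_invHessian hΩ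
  have hc2 : ∀ i j : Fin n, Continuous fun x => D2 ψ x (stdVec j) (stdVec i) := fun i j =>
    (((hψ.fderiv_right (m := ∞) (by simp)).fderiv_right (m := ∞)
    (by simp)).continuous.clm_apply continuous_const).clm_apply continuous_const
  choose M' hM' using fun i j =>
    hΩ.isCompact_closure.exists_bound_of_continuousOn (hc2 i j).continuousOn
  have hM'' : ∀ i j, ∀ x ∈ Ω, |D2 ψ x (stdVec j) (stdVec i)| ≤ ∑ i, ∑ j, |M' i j| := by
    intro i j x hx
    have h1 := hM' i j x (subset_closure hx)
    have h2 := Finset.single_le_sum (f := fun j => |M' i j|)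
      (fun j _ => abs_nonneg _) (Finset.mem_univ j)
    have h3 := Finset.single_le_sum (f := fun i => ∑ j, |M' i j|)
      (fun i _ => Finset.sum_nonneg fun j _ => abs_nonneg _) (Finset.mem_univ i)
    rw [Real.norm_eq_abs] at h1
    linarith [le_abs_self (M' i j)]
  refine IntegrableOn.of_bound hΩ.volume_lt_top
    ((continuousOn_trHess hΩ.isOpen hu.smooth hu.strictlyConvex hψ).aestronglyMeasurable
      hΩ.isOpen.measurableSet) (n ^ 2 * M * ∑ i, ∑ j, |M' i j|) ((ae_restrict_iff' hΩ.isOpen.measurableSet).2 (ae_of_all _ ?_))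
  intro x hx
  exact abs_contract_le (hMx x hx) fun i j => hM'' j i x hx

section Chart

variable {Φ : OpenPartialHomeomorph (E n) (E n)} {P : E n}

/-- The limit of the integral of the linearised operator applied to functions that vanish in a
collar of the boundary. -/
theorem IsAdapted.eventually_tendsto_trHess (h : IsAdapted Ω s P Φ) (hd : RemainderDecay Φ u)
    (hΩ : IsSmoothConvexDomain Ω) (hs : IsSmoothPositiveDensity Ω s) (hu : ClassS Ω s u)
    (hP : P ∈ frontier Ω) :
    ∀ᶠ r in 𝓝[>] (0 : ℝ), ∀ ψ, ContDiff ℝ ∞ ψ → HasCompactSupport ψ → tsupport ψ ⊆ chartBall Φ P r →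
      Tendsto (fun δ => ∫ x in Ω, trHess u (fun y => collarCut Φ (chartBall Φ P r) δ y * ψ y) x)
        (𝓝[>] 0) (𝓝 ((∫ x in Ω, trHess u ψ x) - ∫ x, ψ x ∂boundaryMeasure Ω s)) := by
  have hle2 : (2 : WithTop ℕ∞) ≤ ∞ := WithTop.coe_le_coe.2 le_top
  set ξ : E n → ℝ := fun y => Φ y 0 with hξ
  have hξP : ContDiffAt ℝ 2 ξ P := h.contDiffAt_coord_two h.mem_source
  have hcL : ContinuousAt (fderiv ℝ ξ) P := (hξP.fderiv_right (m := 1) (by norm_num)).continuousAt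
  have hcB : ContinuousAt (D2 ξ) P :=
    ((hξP.fderiv_right (m := 1) (by norm_num)).fderiv_right (m := 0) (by norm_num)).continuousAt
  obtain ⟨M, hM0, hM⟩ : ∃ M ≥ 0, ∀ᶠ x in 𝓝 P, (∀ i, |fderiv ℝ ξ x (stdVec i)| ≤ M) ∧
      ∀ i j, |D2 ξ x (stdVec i) (stdVec j)| ≤ M := by
    refine ⟨∑ i, |fderiv ℝ ξ P (stdVec i)| + ∑ i, ∑ j, |D2 ξ P (stdVec i) (stdVec j)| + 1,
      by positivity, (eventually_all.2 fun i => ?_).and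
        (eventually_all.2 fun i => eventually_all.2 fun j => ?_)⟩
    · refine ((hcL.clm_apply continuousAt_const).abs.eventually_lt_const ?_).mono
        fun x hx => le_of_lt hx
      have h2 := Finset.single_le_sum (f := fun i => |fderiv ℝ ξ P (stdVec i)|)
        (fun i _ => abs_nonneg _) (Finset.mem_univ i)
      have h3 : 0 ≤ ∑ i, ∑ j, |D2 ξ P (stdVec i) (stdVec j)| := by positivity
      linarith
    · refine (((hcB.clm_apply continuousAt_const).clm_apply
        continuousAt_const).abs.eventually_lt_const ?_).mono fun x hx => le_of_lt hx
      have h2 := Finset.single_le_sum (f := fun j => |D2 ξ P (stdVec i) (stdVec j)|)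
        (fun j _ => abs_nonneg _) (Finset.mem_univ j)
      have h3 := Finset.single_le_sum (f := fun i => ∑ j, |D2 ξ P (stdVec i) (stdVec j)|)
        (fun i _ => Finset.sum_nonneg fun j _ => abs_nonneg _) (Finset.mem_univ i)
      have h4 : 0 ≤ ∑ i, |fderiv ℝ ξ P (stdVec i)| := by positivity
      linarith
  filter_upwards [hd.eventually_inverse hu.smooth hu.strictlyConvex hΩ.isOpen hΩ.boundary h hP,
    h.eventually_collar hΩ.isOpen hΩ.convex hs, eventually_chartBall_subset h.mem_source hM]
    with r hinv hcol hsub ψ hψ hψc hψN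
  obtain ⟨-, -, -, hcol⟩ := hcol
  set N := chartBall Φ P r with hN
  have hNo : IsOpen N := isOpen_chartBall
  have hNs : N ⊆ Φ.source := chartBall_subset_source
  have h0 : ∀ x, x ∉ tsupport ψ → ψ x = 0 := fun x hx => image_eq_zero_of_notMem_tsupport hx
  have h0' : ∀ x, x ∉ tsupport ψ → fderiv ℝ ψ x = 0 := fun x hx =>
    image_eq_zero_of_notMem_tsupport fun h => hx (tsupport_fderiv_subset ℝ h)
  have hL0 : ∀ x, x ∉ tsupport ψ → trHess u ψ x = 0 := fun x hx => by
    have : ψ =ᶠ[𝓝 x] fun _ => 0 := notMem_tsupport_iff_eventuallyEq.1 hx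
    rw [trHess_congr this]
    simp [trHess, contract, D2]
  set k : ℝ → ℝ := fun r => r * deriv (deriv step) r with hk
  have hkc : Continuous k := continuous_id.mul contDiff_deriv_deriv_step.continuous
  have hk0 : ∀ r, r ∉ Icc (1 : ℝ) 2 → k r = 0 := fun r hr => by
    simp only [hk, deriv_deriv_step_eq_zero hr, mul_zero]
  set K : ℝ → ℝ := fun r => |k r| + |deriv step r| with hK
  have hKc : Continuous K := hkc.abs.add contDiff_deriv_step.continuous.abs
  have hK0 : ∀ r, r ∉ Icc (1 : ℝ) 2 → K r = 0 := fun r hr => by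
    simp [hK, hk0 r hr, deriv_step_eq_zero hr]
  -- Together with the profile `K` this gives a majorant `δ⁻¹ K(ξ/δ) Θ` of the error terms. Its
  -- integral converges by the collar lemma, so it stays bounded as `δ → 0`.
  set Θ : E n → ℝ := fun x => |ψ x| + ‖fderiv ℝ ψ x‖ with hΘ
  have hΘc : Continuous Θ := hψ.continuous.abs.add (hψ.continuous_fderiv (by simp)).norm
  have hΘ0 : ∀ x, x ∉ tsupport ψ → Θ x = 0 := fun x hx => by
    simp only [hΘ, h0 x hx, h0' x hx]; simp
  have hΘs : tsupport Θ ⊆ tsupport ψ := closure_minimal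
    (fun x hx => by by_contra hxψ; exact hx (hΘ0 x hxψ)) (isClosed_tsupport ψ)
  have hΘcs : HasCompactSupport Θ := hψc.of_isClosed_subset (isClosed_tsupport _) hΘs
  have hkint : ∀ {q : ℝ → ℝ} {g : E n → ℝ} (δ : ℝ), Continuous q → Continuous g →
      (∀ x, x ∉ tsupport ψ → g x = 0) → Integrable (fun x => δ⁻¹ * (q (ξ x / δ) * g x))
        (volume.restrict Ω) := fun {q g} δ hq hg hg0 =>
    ((integrable_of_continuousOn_of_zero hNo hψc hψN
      ((hq.comp_continuousOn ((h.continuousOn_coord hNs).div_const δ)).mul hg.continuousOn)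
      fun x hx => by simp [hg0 x hx]).const_mul δ⁻¹).integrableOn
  set F : ℝ → E n → ℝ := fun δ x => trHess u (fun y => collarCut Φ N δ y * ψ y) x with hF
  -- The error after removing the two terms that survive. The second one is `δ⁻² step''(ξ/δ) u^{ij}
  -- ξ_i ξ_j ψ` with `u^{ij} ξ_i ξ_j` replaced by `ξ`.
  set e : ℝ → E n → ℝ := fun δ x =>
    F δ x - collarCut Φ N δ x * trHess u ψ x - δ⁻¹ * (k (ξ x / δ) * ψ x) with he
  have hFint : ∀ δ, 0 < δ → IntegrableOn (F δ) Ω := fun δ hδ =>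
    hu.integrableOn_trHess hΩ (h.contDiff_collarCut_mul hNo hNs hδ hψ hψc hψN).1
  have hCint : ∀ δ, IntegrableOn (fun x => collarCut Φ N δ x * trHess u ψ x) Ω := fun δ => by
    refine ((hu.integrableOn_trHess hΩ hψ).norm).mono'
      ((h.measurable_collarCut hNo hNs).aestronglyMeasurable.mul
        (hu.integrableOn_trHess hΩ hψ).aestronglyMeasurable) (ae_of_all _ fun x => ?_)
    have := collarCut_mem (Φ := Φ) (N := N) (δ := δ) x
    change ‖collarCut Φ N δ x * trHess u ψ x‖ ≤ _
    rw [norm_mul, Real.norm_of_nonneg this.1]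
    exact mul_le_of_le_one_left (norm_nonneg _) this.2
  -- Every remaining term carries either `u^{ij} ξ_i ξ_j - ξ = o(ξ)` or an entry `u^{ij} = o(1)`,
  -- and all are supported where `δ ≤ ξ ≤ 2 δ`.
  have hebound : ∀ ε > 0, ∀ᶠ δ in 𝓝[>] (0 : ℝ), ∀ x ∈ Ω,
      ‖e δ x‖ ≤ ε * (1 + 2 * n ^ 2 * M) * (δ⁻¹ * (K (ξ x / δ) * Θ x)) := by
    intro ε hε
    obtain ⟨δ₀, hδ₀, hE⟩ := exists_of_eventually_collarFilter (hinv ε hε)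
    filter_upwards [self_mem_nhdsWithin,
      mem_nhdsWithin_of_mem_nhds (Iio_mem_nhds (half_pos hδ₀))] with δ hδ hδ2 x hx
    replace hδ : 0 < δ := hδ
    rw [mem_Iio] at hδ2
    by_cases hxψ : x ∈ tsupport ψ
    swap
    · have h1 : (fun y => collarCut Φ N δ y * ψ y) =ᶠ[𝓝 x] fun _ => 0 := by
        have : ψ =ᶠ[𝓝 x] fun _ => 0 := notMem_tsupport_iff_eventuallyEq.1 hxψ
        filter_upwards [this] with y hy
        rw [hy, mul_zero]
      have h2 : F δ x = 0 := by
        simp only [hF]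
        rw [trHess_congr h1]
        simp [trHess, contract, D2]
      simp only [he, h2, hL0 x hxψ, h0 x hxψ, hΘ0 x hxψ]
      simp
    have hxN := hψN hxψ
    have hξx : ContDiffAt ℝ 2 ξ x := h.contDiffAt_coord_two (hNs hxN)
    have hx0 : 0 < ξ x := (h.mem_iff x (hNs hxN)).1 hx
    have hFx : F δ x = step (ξ x / δ) * trHess u ψ x + ψ x *
        (deriv (deriv step) (ξ x / δ) * (δ⁻¹) ^ 2 *
          contract u x (fun j i => fderiv ℝ ξ x (stdVec j) * fderiv ℝ ξ x (stdVec i)) +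
        deriv step (ξ x / δ) * δ⁻¹ * trHess u ξ x) +
        deriv step (ξ x / δ) * δ⁻¹ *
          contract u x (fun j i => fderiv ℝ ξ x (stdVec j) * fderiv ℝ ψ x (stdVec i)) +
        deriv step (ξ x / δ) * δ⁻¹ *
          contract u x (fun j i => fderiv ℝ ψ x (stdVec j) * fderiv ℝ ξ x (stdVec i)) := by
      simp only [hF]
      rw [trHess_congr (collarCut_mul_eventuallyEq hNo hxN), trHess_mul
        (χ := fun y => step (ξ y / δ)) ((contDiff_step.contDiffAt.of_le hle2).comp x (hξx.div_const δ))
        (hψ.contDiffAt.of_le hle2), trHess_step_div hξx, fderiv_step_div hξx]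
      simp only [_root_.smul_apply, smul_eq_mul]
      rw [← contract_const_mul (deriv step (ξ x / δ) * δ⁻¹),
        ← contract_const_mul (deriv step (ξ x / δ) * δ⁻¹)]
      congr 1
      · congr 1
        congr 1
        funext j i
        ring
      · congr 1
        funext j i
        ring
    have hcut : collarCut Φ N δ x = step (ξ x / δ) := indicator_of_mem hxN _
    set Q := contract u x (fun j i => fderiv ℝ ξ x (stdVec j) * fderiv ℝ ξ x (stdVec i)) with hQ
    set a₁ := trHess u ξ x with ha₁
    set a₂ := contract u x (fun j i => fderiv ℝ ξ x (stdVec j) * fderiv ℝ ψ x (stdVec i)) with ha₂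
    set a₃ := contract u x (fun j i => fderiv ℝ ψ x (stdVec j) * fderiv ℝ ξ x (stdVec i)) with ha₃
    have hex : e δ x = δ⁻¹ * (ψ x * (deriv (deriv step) (ξ x / δ) * δ⁻¹ * (Q - ξ x)) +
        deriv step (ξ x / δ) * (ψ x * a₁ + a₂ + a₃)) := by
      simp only [he, hFx, hcut, hk]
      field_simp
      ring
    by_cases hin : ξ x / δ ∈ Icc (1 : ℝ) 2
    swap
    · rw [hex, deriv_step_eq_zero hin, deriv_deriv_step_eq_zero hin, hK0 _ hin]
      simp
    have hξδ : ξ x < δ₀ := by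
      have := (div_le_iff₀ hδ).1 hin.2
      linarith
    obtain ⟨hU, hQb⟩ := hE x hxN hx0 hξδ
    obtain ⟨hM1, hM2⟩ := hsub hxN
    have hfψ : ∀ j, |fderiv ℝ ψ x (stdVec j)| ≤ ‖fderiv ℝ ψ x‖ := fun j => by
      have := (fderiv ℝ ψ x).le_opNorm (stdVec j)
      simpa using this
    have hb₁ : |a₁| ≤ n ^ 2 * ε * M := abs_contract_le hU fun i j => hM2 i j
    have hb₂ : |a₂| ≤ n ^ 2 * ε * (M * ‖fderiv ℝ ψ x‖) := abs_contract_le hU fun i j => by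
      rw [abs_mul]
      exact mul_le_mul (hM1 i) (hfψ j) (abs_nonneg _) hM0
    have hb₃ : |a₃| ≤ n ^ 2 * ε * (M * ‖fderiv ℝ ψ x‖) := abs_contract_le hU fun i j => by
      rw [abs_mul, mul_comm M]
      exact mul_le_mul (hfψ i) (hM1 j) (abs_nonneg _) (norm_nonneg _)
    have ht1 : |ψ x * (deriv (deriv step) (ξ x / δ) * δ⁻¹ * (Q - ξ x))| ≤
        ε * |k (ξ x / δ)| * |ψ x| := by
      have h1 : |k (ξ x / δ)| = |deriv (deriv step) (ξ x / δ)| * (δ⁻¹ * ξ x) := by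
        simp only [hk]
        rw [abs_mul, abs_of_pos (div_pos hx0 hδ)]
        ring
      rw [abs_mul, abs_mul, abs_mul, abs_of_pos (inv_pos.2 hδ), h1]
      calc |ψ x| * (|deriv (deriv step) (ξ x / δ)| * δ⁻¹ * |Q - ξ x|)
          ≤ |ψ x| * (|deriv (deriv step) (ξ x / δ)| * δ⁻¹ * (ε * ξ x)) := by gcongr
        _ = _ := by ring
    have ht2 : |deriv step (ξ x / δ) * (ψ x * a₁ + a₂ + a₃)| ≤
        |deriv step (ξ x / δ)| * (2 * n ^ 2 * M * ε * Θ x) := by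
      rw [abs_mul]
      refine mul_le_mul_of_nonneg_left ?_ (abs_nonneg _)
      have h1 : |ψ x * a₁| ≤ |ψ x| * (n ^ 2 * ε * M) := by
        rw [abs_mul]; exact mul_le_mul_of_nonneg_left hb₁ (abs_nonneg _)
      have h2 := abs_add_three (ψ x * a₁) a₂ a₃
      have h3 : 0 ≤ n ^ 2 * ε * M * |ψ x| := by positivity
      simp only [hΘ]
      linarith
    have hΘψ : |ψ x| ≤ Θ x := le_add_of_nonneg_right (norm_nonneg _)
    have hΘ0x : 0 ≤ Θ x := (abs_nonneg _).trans hΘψ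
    rw [hex, norm_mul, Real.norm_of_nonneg (inv_pos.2 hδ).le, Real.norm_eq_abs]
    calc δ⁻¹ * |_| ≤ δ⁻¹ * (ε * |k (ξ x / δ)| * Θ x +
          |deriv step (ξ x / δ)| * (2 * n ^ 2 * M * ε * Θ x)) := by
          refine mul_le_mul_of_nonneg_left ((abs_add_le _ _).trans (add_le_add (ht1.trans ?_) ht2))
            (inv_pos.2 hδ).le
          gcongr
      _ ≤ _ := by
          have h1 : 0 ≤ δ⁻¹ * ε * Θ x * |deriv step (ξ x / δ)| := by positivity
          have h2 : 0 ≤ δ⁻¹ * ε * Θ x * |k (ξ x / δ)| * (2 * n ^ 2 * M) := by positivity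
          simp only [hK]
          linarith
  have heint : Tendsto (fun δ => ∫ x in Ω, e δ x) (𝓝[>] 0) (𝓝 0) := by
    have hJ := hcol Θ hΘc hΘcs (hΘs.trans hψN) K hKc hK0
    set J := (∫ r, K r) * ∫ x, Θ x ∂boundaryMeasure Ω s with hJdef
    rw [Metric.tendsto_nhds]
    intro ε hε
    set ε' := ε / (2 * ((1 + 2 * n ^ 2 * M) * (|J| + 1))) with hε'
    have hε'0 : 0 < ε' := by positivity
    filter_upwards [hebound ε' hε'0, hJ.eventually_lt_const (u := |J| + 1)
      (by linarith [le_abs_self J])] with δ hδ hδJ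
    rw [dist_zero_right]
    have h1 : ‖∫ x in Ω, e δ x‖ ≤
        ∫ x in Ω, ε' * (1 + 2 * n ^ 2 * M) * (δ⁻¹ * (K (ξ x / δ) * Θ x)) :=
      norm_integral_le_of_norm_le ((hkint δ hKc hΘc hΘ0).const_mul _)
        ((ae_restrict_iff' hΩ.isOpen.measurableSet).2 (ae_of_all _ hδ))
    rw [integral_const_mul, integral_const_mul] at h1
    calc ‖∫ x in Ω, e δ x‖ ≤ _ := h1
      _ ≤ ε' * (1 + 2 * n ^ 2 * M) * (|J| + 1) := by gcongr
      _ = ε / 2 := by rw [hε']; field_simp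
      _ < ε := half_lt_self hε
  have hlim1 := h.tendsto_integral_collarCut_mul (N := N) hΩ.isOpen hNo hNs
    (hu.integrableOn_trHess hΩ hψ) fun x hx => hL0 x fun h' => hx (hψN h')
  have hlim2 := hcol ψ hψ.continuous hψc hψN k hkc hk0
  have hsum := (hlim1.add hlim2).add heint
  rw [integral_mul_deriv_deriv_step, add_zero, neg_one_mul, ← sub_eq_add_neg] at hsum
  refine hsum.congr' ?_
  filter_upwards [self_mem_nhdsWithin] with δ hδ
  have h1 := hkint δ hkc hψ.continuous h0
  have h2 : ∫ x in Ω, e δ x = (∫ x in Ω, F δ x) - (∫ x in Ω, collarCut Φ N δ x * trHess u ψ x)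
      - ∫ x in Ω, δ⁻¹ * (k (ξ x / δ) * ψ x) := by
    simp only [he]
    rw [← integral_sub (hFint δ hδ) (hCint δ)]
    exact integral_sub ((hFint δ hδ).sub (hCint δ)) h1
  rw [h2, integral_const_mul]
  ring

end Chart

end Abreu

/-! ### The integral identity for smooth functions up to the boundary -/

namespace Abreu

variable {n : ℕ} [NeZero n] {Ω : Set (E n)} {s u A : E n → ℝ}

/-- Compactness of the boundary reduces finiteness of its surface measure to chart balls, where it
is the Lipschitz image of a bounded set. The charts are those supplied by the class of `u`. -/
theorem IsSmoothPositiveDensity.integrableOn (hs : IsSmoothPositiveDensity Ω s)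
    (hΩ : IsSmoothConvexDomain Ω) (hu : ClassS Ω s u) :
    IntegrableOn s (frontier Ω) (Measure.euclideanHausdorffMeasure (n - 1) : Measure (E n)) := by
  have hfin : (Measure.euclideanHausdorffMeasure (n - 1) : Measure (E n)) (frontier Ω) < ⊤ := by
    refine hΩ.isCompact_frontier.measure_lt_top_of_nhdsWithin fun P hP => ?_
    obtain ⟨Φ, h, -⟩ := hu.boundary P hP
    obtain ⟨r, hr, hr0⟩ := ((h.eventually_collar hΩ.isOpen hΩ.convex hs).and
      self_mem_nhdsWithin).exists
    exact ⟨frontier Ω ∩ chartBall Φ P r, inter_mem_nhdsWithin _ (isOpen_chartBall.mem_nhds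
      (mem_chartBall_self h.mem_source hr0)), hr.2.2.1⟩
  obtain ⟨C, hC⟩ := hΩ.isCompact_frontier.exists_bound_of_continuousOn hs.smooth.continuousOn
  exact IntegrableOn.of_bound hfin
    (hs.smooth.continuousOn.aestronglyMeasurable isClosed_frontier.measurableSet) C
    ((ae_restrict_iff' isClosed_frontier.measurableSet).2 (ae_of_all _ hC))

theorem ClassS.isFiniteMeasure (hu : ClassS Ω s u) (hΩ : IsSmoothConvexDomain Ω)
    (hs : IsSmoothPositiveDensity Ω s) : IsFiniteMeasure (boundaryMeasure Ω s) :=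
  isFiniteMeasure_withDensity_ofReal (hs.integrableOn hΩ hu).2

omit [NeZero n] in
theorem ae_boundaryMeasure_mem (Ω : Set (E n)) (s : E n → ℝ) :
    ∀ᵐ x ∂boundaryMeasure Ω s, x ∈ frontier Ω :=
  (withDensity_absolutelyContinuous _ _).ae_le (ae_restrict_mem isClosed_frontier.measurableSet)

omit [NeZero n] in
theorem integral_boundaryMeasure_eq_zero {ψ : E n → ℝ} (h : ∀ x ∈ frontier Ω, ψ x = 0) :
    ∫ x, ψ x ∂boundaryMeasure Ω s = 0 :=
  integral_eq_zero_of_ae ((ae_boundaryMeasure_mem Ω s).mono fun x hx => h x hx)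

/-- The identity `∫_{∂Ω} ψ dσ - ∫_Ω A ψ = ∫_Ω u^{ij} ψ_{ij}`. -/
theorem ClassS.integral_trHess (hu : ClassS Ω s u) (hΩ : IsSmoothConvexDomain Ω)
    (hs : IsSmoothPositiveDensity Ω s) (hA : ContDiffOn ℝ ∞ A (closure Ω))
    (hAu : SolvesAbreu Ω A u) {ψ : E n → ℝ} (hψ : ContDiff ℝ ∞ ψ) (hψc : HasCompactSupport ψ) :
    (∫ x, ψ x ∂boundaryMeasure Ω s) - (∫ x in Ω, A x * ψ x) = ∫ x in Ω, trHess u ψ x := by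
  have hfm := hu.isFiniteMeasure hΩ hs
  have hAint : ∀ φ : E n → ℝ, Continuous φ → IntegrableOn (fun x => A x * φ x) Ω := fun φ hφ =>
    ((hA.continuousOn.mul hφ.continuousOn).integrableOn_compact hΩ.isCompact_closure).mono_set
      subset_closure
  have hσint : ∀ φ : E n → ℝ, Continuous φ → HasCompactSupport φ →
      Integrable φ (boundaryMeasure Ω s) := fun φ hφ hφc =>
    hφ.integrable_of_hasCompactSupport hφc
  refine smooth_local_induction (p := fun ψ => (∫ x, ψ x ∂boundaryMeasure Ω s) -
    (∫ x in Ω, A x * ψ x) = ∫ x in Ω, trHess u ψ x) ?_ ?_ hψ hψc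
  · intro ψ χ hψ hψc hχ _ h1 h2
    have hχψ : ContDiff ℝ ∞ fun x => χ x * ψ x := hχ.mul hψ
    have hχψ' : ContDiff ℝ ∞ fun x => (1 - χ x) * ψ x := (contDiff_const.sub hχ).mul hψ
    have h3 : ∀ x, ψ x = χ x * ψ x + (1 - χ x) * ψ x := fun x => by ring
    have h4 : ∀ x, trHess u ψ x =
        trHess u (fun x => χ x * ψ x) x + trHess u (fun x => (1 - χ x) * ψ x) x := fun x => by
      have hle2 : (2 : WithTop ℕ∞) ≤ ∞ := WithTop.coe_le_coe.2 le_top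
      simp only [trHess]
      rw [← contract_add]
      congr 1
      funext j i
      conv_lhs => rw [funext h3, D2_add (hχψ.contDiffAt.of_le hle2) (hχψ'.contDiffAt.of_le hle2)]
      rfl
    have e1 : ∫ x, ψ x ∂boundaryMeasure Ω s = (∫ x, χ x * ψ x ∂boundaryMeasure Ω s) +
        ∫ x, (1 - χ x) * ψ x ∂boundaryMeasure Ω s := by
      rw [← integral_add (hσint _ hχψ.continuous hψc.mul_left)
        (hσint _ hχψ'.continuous hψc.mul_left)]
      exact integral_congr_ae (ae_of_all _ h3)
    have e2 : ∫ x in Ω, A x * ψ x = (∫ x in Ω, A x * (χ x * ψ x)) +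
        ∫ x in Ω, A x * ((1 - χ x) * ψ x) := by
      rw [← integral_add (hAint _ hχψ.continuous) (hAint _ hχψ'.continuous)]
      exact integral_congr_ae (ae_of_all _ fun x => by
        change A x * ψ x = A x * (χ x * ψ x) + A x * ((1 - χ x) * ψ x)
        ring)
    have e3 : ∫ x in Ω, trHess u ψ x = (∫ x in Ω, trHess u (fun x => χ x * ψ x) x) +
        ∫ x in Ω, trHess u (fun x => (1 - χ x) * ψ x) x := by
      rw [← integral_add (hu.integrableOn_trHess hΩ hχψ) (hu.integrableOn_trHess hΩ hχψ')]
      exact integral_congr_ae (ae_of_all _ h4)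
    rw [e1, e2, e3, ← h1, ← h2]
    ring
  · intro P
    rcases hΩ.mem_or P with hP | hP | hP
    · refine ⟨Ω, hΩ.isOpen.mem_nhds hP, fun ψ hψ hψc hψΩ => ?_⟩
      rw [integral_trHess_of_tsupport_subset hΩ.isOpen hu.smooth hu.strictlyConvex hAu hψ hψc hψΩ,
        integral_boundaryMeasure_eq_zero fun x hx => ?_, zero_sub]
      refine image_eq_zero_of_notMem_tsupport fun h => ?_
      rw [frontier, hΩ.isOpen.interior_eq] at hx
      exact hx.2 (hψΩ h)
    · obtain ⟨Φ, h, hd⟩ := hu.boundary P hP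
      obtain ⟨r, hr, hr0⟩ := ((h.eventually_tendsto_trHess hd hΩ hs hu hP).and
        self_mem_nhdsWithin).exists
      refine ⟨chartBall Φ P r, isOpen_chartBall.mem_nhds (mem_chartBall_self h.mem_source hr0),
        fun ψ hψ hψc hψN => ?_⟩
      have hlim := h.tendsto_integral_collarCut_mul (N := chartBall Φ P r) hΩ.isOpen
        isOpen_chartBall chartBall_subset_source (hAint ψ hψ.continuous) fun x hx => by
          rw [image_eq_zero_of_notMem_tsupport fun h' => hx (hψN h'), mul_zero]
      -- The cut-off functions obey the interior identity. Both sides converge as `δ → 0`, and the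
      -- boundary integral appears in the limit of the right side.
      have heq : ∀ᶠ δ in 𝓝[>] (0 : ℝ), -∫ x in Ω, collarCut Φ (chartBall Φ P r) δ x * (A x * ψ x) =
          ∫ x in Ω, trHess u (fun y => collarCut Φ (chartBall Φ P r) δ y * ψ y) x := by
        filter_upwards [self_mem_nhdsWithin] with δ hδ
        obtain ⟨h1, h2, h3⟩ := h.contDiff_collarCut_mul isOpen_chartBall chartBall_subset_source hδ
          hψ hψc hψN
        rw [integral_trHess_of_tsupport_subset hΩ.isOpen hu.smooth hu.strictlyConvex hAu h1 h2 h3]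
        congr 1
        exact integral_congr_ae (ae_of_all _ fun x => mul_left_comm _ _ _)
      have := tendsto_nhds_unique (hr ψ hψ hψc hψN) (hlim.neg.congr' heq)
      linarith
    · refine ⟨(closure Ω)ᶜ, isClosed_closure.isOpen_compl.mem_nhds hP, fun ψ hψ hψc hψN => ?_⟩
      have h0 : ∀ x ∈ closure Ω, x ∉ tsupport ψ := fun x hx h' => hψN h' hx
      rw [integral_boundaryMeasure_eq_zero fun x hx =>
          image_eq_zero_of_notMem_tsupport (h0 x (frontier_subset_closure hx)),
        setIntegral_eq_zero_of_forall_eq_zero fun x hx => by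
          rw [image_eq_zero_of_notMem_tsupport (h0 x (subset_closure hx)), mul_zero],
        setIntegral_eq_zero_of_forall_eq_zero fun x hx => by
          have : ψ =ᶠ[𝓝 x] fun _ => 0 :=
            notMem_tsupport_iff_eventuallyEq.1 (h0 x (subset_closure hx))
          rw [trHess_congr this]
          simp [trHess, contract, D2], sub_zero]

/-! ### The flux of a radial field through the boundary -/

section Divergence

variable {Φ : OpenPartialHomeomorph (E n) (E n)} {P : E n}

/-- One side of the divergence theorem for `ψ(x) (x - p)`, by the collar argument with `step'`: the
limit term is `-ψ dξ(x - p)` integrated against `σ`, and `dξ` is `s⁻¹` times pairing with a unit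
vector. The inequality uses that `ψ` is nonnegative. -/
theorem IsAdapted.eventually_integral_div_le (h : IsAdapted Ω s P Φ)
    (hΩ : IsSmoothConvexDomain Ω) (hs : IsSmoothPositiveDensity Ω s)
    [IsFiniteMeasure (boundaryMeasure Ω s)] {p : E n} {C : ℝ}
    (hC : ∀ x ∈ frontier Ω, (s x)⁻¹ * ‖x - p‖ ≤ C) :
    ∀ᶠ r in 𝓝[>] (0 : ℝ), ∀ ψ : E n → ℝ, ContDiff ℝ ∞ ψ → HasCompactSupport ψ →
      tsupport ψ ⊆ chartBall Φ P r → (∀ x, 0 ≤ ψ x) →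
      ∫ x in Ω, (n * ψ x + fderiv ℝ ψ x (x - p)) ≤ C * ∫ x, ψ x ∂boundaryMeasure Ω s := by
  set ξ : E n → ℝ := fun y => Φ y 0 with hξ
  filter_upwards [h.eventually_collar hΩ.isOpen hΩ.convex hs] with r hcol ψ hψ hψc hψN hψ0
  obtain ⟨-, -, -, hcol⟩ := hcol
  set N := chartBall Φ P r with hN
  have hNo : IsOpen N := isOpen_chartBall
  have hNs : N ⊆ Φ.source := chartBall_subset_source
  have h0 : ∀ x, x ∉ tsupport ψ → ψ x = 0 := fun x hx => image_eq_zero_of_notMem_tsupport hx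
  have h0' : ∀ x, x ∉ tsupport ψ → fderiv ℝ ψ x = 0 := fun x hx =>
    image_eq_zero_of_notMem_tsupport fun h => hx (tsupport_fderiv_subset ℝ h)
  set g : E n → ℝ := fun x => ψ x * fderiv ℝ ξ x (x - p) with hg
  have hg0 : ∀ x, x ∉ tsupport ψ → g x = 0 := fun x hx => by simp only [hg, h0 x hx, zero_mul]
  have hgc : ContinuousOn g N := by
    refine hψ.continuous.continuousOn.mul (ContinuousOn.clm_apply (fun x hx => ?_)
      (continuous_id.sub continuous_const).continuousOn)
    exact ((h.contDiffAt_coord_two (hNs hx)).fderiv_right (m := 1)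
      (by norm_num)).continuousAt.continuousWithinAt
  set G : E n → ℝ := N.indicator g with hG
  have hGc : Continuous G := continuous_indicator_of_isClosed hNo (isClosed_tsupport ψ) hψN
    (fun x _ hx => hg0 x hx) hgc
  have hGs : tsupport G ⊆ tsupport ψ :=
    tsupport_indicator_subset (isClosed_tsupport ψ) (fun x _ hx => hg0 x hx)
  have hGcs : HasCompactSupport G := hψc.of_isClosed_subset (isClosed_tsupport _) hGs
  have hGg : ∀ x, G x = g x := fun x => by
    by_cases hx : x ∈ N
    · exact indicator_of_mem hx g
    · rw [hG, indicator_of_notMem hx, hg0 x fun h' => hx (hψN h')]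
  have hdivc : Continuous fun x => n * ψ x + fderiv ℝ ψ x (x - p) :=
    (continuous_const.mul hψ.continuous).add ((hψ.continuous_fderiv (by simp)).clm_apply
      (continuous_id.sub continuous_const))
  have hdivint : IntegrableOn (fun x => n * ψ x + fderiv ℝ ψ x (x - p)) Ω :=
    (hdivc.integrable_of_hasCompactSupport (hψc.of_isClosed_subset (isClosed_tsupport _)
      (closure_minimal (fun x hx => by
        by_contra hx'
        exact hx (by simp [h0 x hx', h0' x hx'])) (isClosed_tsupport ψ)))).integrableOn
  have hlim1 := h.tendsto_integral_collarCut_mul hΩ.isOpen hNo hNs hdivint fun x hx => by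
    have hx' : x ∉ tsupport ψ := fun h' => hx (hψN h')
    simp [h0 x hx', h0' x hx']
  have hlim2 := hcol G hGc hGcs (hGs.trans hψN) (deriv step) contDiff_deriv_step.continuous
    fun r hr => deriv_step_eq_zero hr
  rw [integral_deriv_step, one_mul] at hlim2
  have hsum := hlim1.add hlim2
  have hzero : ∀ᶠ δ in 𝓝[>] (0 : ℝ),
      (∫ x in Ω, collarCut Φ N δ x * (n * ψ x + fderiv ℝ ψ x (x - p))) +
        δ⁻¹ * ∫ x in Ω, deriv step (ξ x / δ) * G x = 0 := by
    filter_upwards [self_mem_nhdsWithin] with δ hδ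
    obtain ⟨h1, h2, h3⟩ := h.contDiff_collarCut_mul hNo hNs hδ hψ hψc hψN
    rw [← integral_div_of_tsupport_subset hΩ.isOpen h1 h2 h3 p, ← integral_const_mul,
      ← integral_add]
    · refine setIntegral_congr_fun hΩ.isOpen.measurableSet fun x hx => ?_
      by_cases hxψ : x ∈ tsupport ψ
      · have hxN := hψN hxψ
        have hξx : ContDiffAt ℝ 2 ξ x := h.contDiffAt_coord_two (hNs hxN)
        have hcut : collarCut Φ N δ x = step (ξ x / δ) := indicator_of_mem hxN _
        have hfd : fderiv ℝ (fun y => collarCut Φ N δ y * ψ y) x = step (ξ x / δ) • fderiv ℝ ψ x +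
            ψ x • ((deriv step (ξ x / δ) * δ⁻¹) • fderiv ℝ ξ x) := by
          rw [(collarCut_mul_eventuallyEq hNo hxN).fderiv_eq, ← fderiv_step_div hξx]
          exact fderiv_fun_mul ((contDiff_step.differentiable (by simp) _).comp x
            ((hξx.div_const δ).differentiableAt (by simp))) (hψ.differentiable (by simp) x)
        simp only [hfd, hcut, hGg, hg, add_apply, _root_.smul_apply, smul_eq_mul]
        ring
      · have h4 : (fun y => collarCut Φ N δ y * ψ y) =ᶠ[𝓝 x] fun _ => 0 := by
          have : ψ =ᶠ[𝓝 x] fun _ => 0 := notMem_tsupport_iff_eventuallyEq.1 hxψ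
          filter_upwards [this] with y hy
          rw [hy, mul_zero]
        simp [h4.fderiv_eq, h0 x hxψ, h0' x hxψ, hGg, hg0 x hxψ]
    · refine hdivint.norm.mono' ((h.measurable_collarCut hNo hNs).aestronglyMeasurable.mul
        hdivint.aestronglyMeasurable) (ae_of_all _ fun x => ?_)
      have := collarCut_mem (Φ := Φ) (N := N) (δ := δ) x
      change ‖collarCut Φ N δ x * _‖ ≤ _
      rw [norm_mul, Real.norm_of_nonneg this.1]
      exact mul_le_of_le_one_left (norm_nonneg _) this.2
    · exact ((integrable_of_continuousOn_of_zero hNo hψc hψN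
        ((contDiff_deriv_step.continuous.comp_continuousOn
          ((h.continuousOn_coord hNs).div_const δ)).mul hGc.continuousOn)
        fun x hx => by simp [hGg, hg0 x hx]).const_mul δ⁻¹).integrableOn
  have hz := tendsto_nhds_unique (hsum.congr' hzero) tendsto_const_nhds
  have hle : ∫ x, -G x ∂boundaryMeasure Ω s ≤ ∫ x, C * ψ x ∂boundaryMeasure Ω s := by
    refine integral_mono_ae (hGc.integrable_of_hasCompactSupport hGcs).neg
      ((hψ.continuous.integrable_of_hasCompactSupport hψc).const_mul C)
      ((ae_boundaryMeasure_mem Ω s).mono fun x hx => ?_)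
    change -G x ≤ C * ψ x
    by_cases hxψ : x ∈ tsupport ψ
    · obtain ⟨ν, hν, hνd⟩ := h.exists_normal hΩ.isOpen hΩ.convex (hNs (hψN hxψ)) hx
      have h1 := abs_le.1 (abs_real_inner_le_norm ν (x - p))
      rw [hν.1, one_mul] at h1
      have h2 : -(fderiv ℝ ξ x (x - p)) ≤ C := by
        refine le_trans ?_ (hC x hx)
        rw [hνd, ← mul_neg]
        exact mul_le_mul_of_nonneg_left (by linarith [h1.1]) (inv_nonneg.2 (hs.pos x hx).le)
      have h3 := mul_le_mul_of_nonneg_left h2 (hψ0 x)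
      simp only [hGg, hg]
      linarith
    · simp [hGg, hg0 x hxψ, h0 x hxψ]
  rw [integral_neg, integral_const_mul] at hle
  linarith

theorem ClassS.exists_integral_div_le (hu : ClassS Ω s u) (hΩ : IsSmoothConvexDomain Ω)
    (hs : IsSmoothPositiveDensity Ω s) (p : E n) :
    ∃ C ≥ 0, ∀ ψ : E n → ℝ, ContDiff ℝ ∞ ψ → HasCompactSupport ψ → (∀ x, 0 ≤ ψ x) →
      ∫ x in Ω, (n * ψ x + fderiv ℝ ψ x (x - p)) ≤ C * ∫ x, ψ x ∂boundaryMeasure Ω s := by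
  have hfm := hu.isFiniteMeasure hΩ hs
  obtain ⟨C, hC⟩ := hΩ.isCompact_frontier.exists_bound_of_continuousOn
    (f := fun x => (s x)⁻¹ * ‖x - p‖) ((hs.smooth.continuousOn.inv₀ fun x hx =>
      (hs.pos x hx).ne').mul (continuous_id.sub continuous_const).norm.continuousOn)
  refine ⟨|C|, abs_nonneg _, fun ψ hψ hψc => ?_⟩
  have hC' : ∀ x ∈ frontier Ω, (s x)⁻¹ * ‖x - p‖ ≤ |C| := fun x hx =>
    (le_abs_self _).trans ((hC x hx).trans (le_abs_self C))
  refine smooth_local_induction (p := fun ψ => (∀ x, 0 ≤ ψ x) →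
    ∫ x in Ω, (n * ψ x + fderiv ℝ ψ x (x - p)) ≤ |C| * ∫ x, ψ x ∂boundaryMeasure Ω s) ?_ ?_ hψ hψc
  · intro ψ χ hψ hψc hχ hχ01 h1 h2 hψ0
    specialize h1 fun x => mul_nonneg (hχ01 x).1 (hψ0 x)
    specialize h2 fun x => mul_nonneg (sub_nonneg.2 (hχ01 x).2) (hψ0 x)
    have hχψ : ContDiff ℝ ∞ fun x => χ x * ψ x := hχ.mul hψ
    have hχψ' : ContDiff ℝ ∞ fun x => (1 - χ x) * ψ x := (contDiff_const.sub hχ).mul hψ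
    have h3 : ∀ x, ψ x = χ x * ψ x + (1 - χ x) * ψ x := fun x => by ring
    have e1 : ∫ x, ψ x ∂boundaryMeasure Ω s = (∫ x, χ x * ψ x ∂boundaryMeasure Ω s) +
        ∫ x, (1 - χ x) * ψ x ∂boundaryMeasure Ω s := by
      rw [← integral_add (hχψ.continuous.integrable_of_hasCompactSupport hψc.mul_left)
        (hχψ'.continuous.integrable_of_hasCompactSupport hψc.mul_left)]
      exact integral_congr_ae (ae_of_all _ h3)
    have hint : ∀ φ : E n → ℝ, ContDiff ℝ ∞ φ →
        IntegrableOn (fun x => n * φ x + fderiv ℝ φ x (x - p)) Ω := fun φ hφ =>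
      ((((continuous_const.mul hφ.continuous).add ((hφ.continuous_fderiv (by simp)).clm_apply
        (continuous_id.sub continuous_const))).continuousOn).integrableOn_compact
        hΩ.isCompact_closure).mono_set subset_closure
    have e2 : ∫ x in Ω, (n * ψ x + fderiv ℝ ψ x (x - p)) =
        (∫ x in Ω, (n * (χ x * ψ x) + fderiv ℝ (fun x => χ x * ψ x) x (x - p))) +
        ∫ x in Ω, (n * ((1 - χ x) * ψ x) + fderiv ℝ (fun x => (1 - χ x) * ψ x) x (x - p)) := by
      rw [← integral_add (hint _ hχψ) (hint _ hχψ')]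
      refine integral_congr_ae (ae_of_all _ fun x => ?_)
      have h4 : fderiv ℝ ψ x = fderiv ℝ (fun x => χ x * ψ x) x +
          fderiv ℝ (fun x => (1 - χ x) * ψ x) x := by
        rw [← fderiv_fun_add (hχψ.differentiable (by simp) x) (hχψ'.differentiable (by simp) x)]
        congr 1
        exact funext h3
      simp only [h4, add_apply]
      ring
    rw [e1, e2, mul_add]
    exact add_le_add h1 h2
  · intro P
    rcases hΩ.mem_or P with hP | hP | hP
    · refine ⟨Ω, hΩ.isOpen.mem_nhds hP, fun ψ hψ hψc hψΩ hψ0 => ?_⟩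
      rw [integral_div_of_tsupport_subset hΩ.isOpen hψ hψc hψΩ]
      exact mul_nonneg (abs_nonneg _) (integral_nonneg hψ0)
    · obtain ⟨Φ, h, hd⟩ := hu.boundary P hP
      obtain ⟨r, hr, hr0⟩ := ((h.eventually_integral_div_le hΩ hs hC').and
        self_mem_nhdsWithin).exists
      exact ⟨chartBall Φ P r, isOpen_chartBall.mem_nhds (mem_chartBall_self h.mem_source hr0), hr⟩
    · refine ⟨(closure Ω)ᶜ, isClosed_closure.isOpen_compl.mem_nhds hP, fun ψ hψ hψc hψN hψ0 => ?_⟩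
      rw [setIntegral_eq_zero_of_forall_eq_zero fun x hx => ?_]
      · exact mul_nonneg (abs_nonneg _) (integral_nonneg hψ0)
      · have h0 : x ∉ tsupport ψ := fun h' => hψN h' (subset_closure hx)
        rw [image_eq_zero_of_notMem_tsupport h0,
          image_eq_zero_of_notMem_tsupport fun h' => h0 (tsupport_fderiv_subset ℝ h')]
        simp

end Divergence

end Abreu

/-! ### Positivity of the linearised operator on convex functions -/

namespace Abreu

section Convex

variable {n : ℕ} {S Ω : Set (E n)} {ψ u : E n → ℝ} {x y : E n}

theorem add_fderiv_le_of_convexOn (hψ : ConvexOn ℝ S ψ) (hx : x ∈ S) (hy : y ∈ S)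
    (hd : DifferentiableAt ℝ ψ x) : ψ x + fderiv ℝ ψ x (y - x) ≤ ψ y := by
  have h1 := hψ.comp_affineMap (AffineMap.lineMap x y)
  have h0 : (AffineMap.lineMap x y : ℝ →ᵃ[ℝ] E n) 0 = x := AffineMap.lineMap_apply_zero x y
  have h2 : HasDerivAt (fun t : ℝ => ψ (AffineMap.lineMap x y t)) (fderiv ℝ ψ x (y - x)) 0 := by
    have h3 : HasFDerivAt ψ (fderiv ℝ ψ x) (AffineMap.lineMap x y (0 : ℝ)) := by
      rw [h0]; exact hd.hasFDerivAt
    exact h3.comp_hasDerivAt 0 AffineMap.hasDerivAt_lineMap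
  have h3 := h1.le_slope_of_hasDerivAt (x := 0) (y := 1) (by simpa using hx) (by simpa using hy)
    one_pos h2
  simp only [slope_def_field, Function.comp_apply, AffineMap.lineMap_apply_zero,
    AffineMap.lineMap_apply_one, sub_zero, div_one] at h3
  linarith

theorem D2_nonneg_of_convexOn (hΩ : IsOpen Ω) (hψ : ConvexOn ℝ Ω ψ) (hc : ContDiff ℝ 2 ψ)
    (hx : x ∈ Ω) (v : E n) : 0 ≤ D2 ψ x v v := by
  have hline : HasDerivAt (fun t : ℝ => x + t • v) v 0 := by
    simpa using ((hasDerivAt_id (0 : ℝ)).smul_const v).const_add x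
  have h1 : HasDerivAt (fun t : ℝ => fderiv ℝ ψ (x + t • v) v) (D2 ψ x v v) 0 := by
    have h2 : HasFDerivAt (fun y => fderiv ℝ ψ y v) (fderiv ℝ (fun y => fderiv ℝ ψ y v) x)
        (x + (0 : ℝ) • v) := by
      rw [zero_smul, add_zero]
      exact ((differentiableAt_fderiv hc.contDiffAt).clm_apply
        (differentiableAt_const v)).hasFDerivAt
    exact (h2.comp_hasDerivAt 0 hline).congr_deriv (fderiv_fderiv_apply hc.contDiffAt v v)
  refine ge_of_tendsto h1.tendsto_slope_zero_right ?_
  have hev : ∀ᶠ t : ℝ in 𝓝 0, x + t • v ∈ Ω :=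
    hline.continuousAt.eventually_mem (by simpa using hΩ.mem_nhds hx)
  filter_upwards [nhdsWithin_le_nhds hev, self_mem_nhdsWithin] with t ht ht0
  replace ht0 : 0 < t := ht0
  have hd := hc.differentiable (by simp)
  have h3 := add_fderiv_le_of_convexOn hψ hx ht (hd x)
  have h4 := add_fderiv_le_of_convexOn hψ ht hx (hd _)
  simp only [add_sub_cancel_left, sub_add_cancel_left, map_smul, map_neg, smul_eq_mul] at h3 h4
  simp only [zero_add, zero_smul, add_zero, smul_eq_mul]
  have h5 : 0 ≤ t * (fderiv ℝ ψ (x + t • v) v - fderiv ℝ ψ x v) := by linarith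
  exact mul_nonneg (inv_nonneg.2 ht0.le) (nonneg_of_mul_nonneg_right h5 ht0)

open scoped MatrixOrder in
-- Writing `H = Bᴴ B`, cyclicity turns the trace into that of the positive semidefinite matrix `B U
-- Bᴴ`.
theorem trace_mul_nonneg {U H : Matrix (Fin n) (Fin n) ℝ} (hU : U.PosSemidef)
    (hH : H.PosSemidef) : 0 ≤ (U * H).trace := by
  obtain ⟨B, hB⟩ := CStarAlgebra.nonneg_iff_eq_star_mul_self.1 hH.nonneg
  rw [hB, Matrix.star_eq_conjTranspose, ← Matrix.mul_assoc, Matrix.trace_mul_comm,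
    ← Matrix.mul_assoc]
  exact (hU.mul_mul_conjTranspose_same B).trace_nonneg

theorem posSemidef_hessian (hΩ : IsOpen Ω) (hψ : ConvexOn ℝ Ω ψ) (hc : ContDiff ℝ 2 ψ)
    (hx : x ∈ Ω) : (hessian ψ x).PosSemidef := by
  refine Matrix.PosSemidef.of_dotProduct_mulVec_nonneg ?_ fun v => ?_
  · rw [Matrix.IsHermitian, Matrix.conjTranspose_eq_transpose_of_trivial]
    exact hessian_symm hc.contDiffAt
  · have h1 := D2_nonneg_of_convexOn hΩ hψ hc hx (WithLp.toLp 2 v)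
    rw [clm_eq_sum (D2 ψ x (WithLp.toLp 2 v))] at h1
    refine h1.trans_eq (Eq.symm ?_)
    simp only [dotProduct, Matrix.mulVec, Pi.star_apply, star_trivial]
    simp_rw [hessian_eq_D2 hc.contDiffAt, Finset.mul_sum]
    rw [Finset.sum_comm]
    refine Finset.sum_congr rfl fun j _ => ?_
    have h2 := clm_eq_sum ((D2 ψ x).flip (stdVec j)) (WithLp.toLp 2 v)
    simp only [ContinuousLinearMap.flip_apply] at h2
    rw [h2, Finset.mul_sum]
    exact Finset.sum_congr rfl fun i _ => by ring

theorem trHess_eq_trace (hc : ContDiff ℝ 2 ψ) (x : E n) :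
    trHess u ψ x = ((hessian u x)⁻¹ * hessian ψ x).trace := by
  simp only [trHess, contract, Matrix.trace, Matrix.diag, Matrix.mul_apply,
    hessian_eq_D2 hc.contDiffAt]

theorem trHess_nonneg (hΩ : IsOpen Ω) (hpd : ∀ x ∈ Ω, (hessian u x).PosDef)
    (hψ : ConvexOn ℝ Ω ψ) (hc : ContDiff ℝ 2 ψ) (hx : x ∈ Ω) : 0 ≤ trHess u ψ x := by
  rw [trHess_eq_trace hc]
  exact trace_mul_nonneg (hpd x hx).inv.posSemidef (posSemidef_hessian hΩ hψ hc hx)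

/-- On compact sets, the Laplacian of convex functions is controlled by the linearised operator. -/
theorem exists_laplacian_le_trHess (hΩ : IsOpen Ω) (hu : ContDiffOn ℝ ∞ u Ω)
    (hpd : ∀ x ∈ Ω, (hessian u x).PosDef) {K : Set (E n)} (hK : IsCompact K) (hKΩ : K ⊆ Ω) :
    ∃ c > 0, ∀ ψ : E n → ℝ, ConvexOn ℝ Ω ψ → ContDiff ℝ 2 ψ → ∀ x ∈ K,
      c * ∑ i, D2 ψ x (stdVec i) (stdVec i) ≤ trHess u ψ x := by
  set f : E n × E n → ℝ := fun p => ∑ i, ∑ j, (hessian u p.1)⁻¹ i j * (p.2 i * p.2 j) with hf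
  have hfq : ∀ x (v : E n), f (x, v) = v.ofLp ⬝ᵥ ((hessian u x)⁻¹.mulVec v.ofLp) := by
    intro x v
    simp only [hf, dotProduct, Matrix.mulVec, Finset.mul_sum]
    exact Finset.sum_congr rfl fun i _ => Finset.sum_congr rfl fun j _ => by ring
  have hfc : ContinuousOn f (K ×ˢ Metric.sphere 0 1) := by
    refine continuousOn_finsetSum _ fun i _ => continuousOn_finsetSum _ fun j _ => ?_
    refine (((contDiffOn_invHessian hΩ hu hpd i j).continuousOn.mono hKΩ).comp continuousOn_fst
      fun p hp => hp.1).mul (Continuous.continuousOn ?_)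
    exact ((coordL i).continuous.comp continuous_snd).mul ((coordL j).continuous.comp continuous_snd)
  have hpos : ∀ p ∈ K ×ˢ Metric.sphere (0 : E n) 1, 0 < f p := by
    rintro ⟨x, v⟩ ⟨hx, hv⟩
    rw [hfq]
    have hv0 : v.ofLp ≠ 0 := fun h => by
      have : v = 0 := by ext i; exact congrFun h i
      simp [this] at hv
    simpa using (hpd x (hKΩ hx)).inv.dotProduct_mulVec_pos hv0
  obtain ⟨c, hc, hcf⟩ : ∃ c > 0, ∀ p ∈ K ×ˢ Metric.sphere (0 : E n) 1, c ≤ f p := by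
    rcases (K ×ˢ Metric.sphere (0 : E n) 1).eq_empty_or_nonempty with he | hne
    · exact ⟨1, one_pos, by simp [he]⟩
    · obtain ⟨p, hp, hmin⟩ := (hK.prod (isCompact_sphere _ _)).exists_isMinOn hne hfc
      exact ⟨f p, hpos p hp, fun q hq => hmin hq⟩
  refine ⟨c, hc, fun ψ hψ hψc x hx => ?_⟩
  -- Since `c` is a lower bound for the form `u^{ij}` on unit vectors over `K`, subtracting `c`
  -- times the identity leaves a nonnegative form. Its trace against the Hessian of a convex
  -- function is the claim.
  have hps : ((hessian u x)⁻¹ - c • (1 : Matrix (Fin n) (Fin n) ℝ)).PosSemidef := by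
    refine Matrix.PosSemidef.of_dotProduct_mulVec_nonneg ?_ fun v => ?_
    · refine Matrix.IsHermitian.sub (hpd x (hKΩ hx)).inv.isHermitian ?_
      rw [Matrix.IsHermitian, Matrix.conjTranspose_smul, Matrix.conjTranspose_one, star_trivial]
    · have hvv : ‖WithLp.toLp 2 v‖ ^ 2 = v ⬝ᵥ v := by
        rw [EuclideanSpace.norm_sq_eq]
        simp [dotProduct, sq]
      simp only [star_trivial, Matrix.sub_mulVec, Matrix.smul_mulVec, Matrix.one_mulVec,
        dotProduct_sub, dotProduct_smul, smul_eq_mul, sub_nonneg]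
      rw [← hvv]
      by_cases hv : WithLp.toLp 2 v = (0 : E n)
      · have : v = 0 := by funext i; exact congrArg (fun w : E n => w i) hv
        simp [this]
      have hnv : 0 < ‖(WithLp.toLp 2 v : E n)‖ := norm_pos_iff.2 hv
      have h1 := hcf (x, ‖(WithLp.toLp 2 v : E n)‖⁻¹ • WithLp.toLp 2 v)
        ⟨hx, by simp [norm_smul, hnv.ne']⟩
      rw [hfq] at h1
      simp only [WithLp.ofLp_smul, Matrix.mulVec_smul, dotProduct_smul, smul_dotProduct,
        smul_eq_mul] at h1
      have h2 := mul_le_mul_of_nonneg_left h1 (sq_nonneg ‖(WithLp.toLp 2 v : E n)‖)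
      calc c * ‖(WithLp.toLp 2 v : E n)‖ ^ 2 = ‖(WithLp.toLp 2 v : E n)‖ ^ 2 * c := mul_comm _ _
        _ ≤ _ := h2
        _ = _ := by field_simp
  have h := trace_mul_nonneg hps (posSemidef_hessian hΩ hψ hψc (hKΩ hx))
  rw [Matrix.sub_mul, Matrix.trace_sub, ← trHess_eq_trace hψc, Matrix.smul_mul, Matrix.one_mul,
    Matrix.trace_smul, smul_eq_mul] at h
  have h2 : (hessian ψ x).trace = ∑ i, D2 ψ x (stdVec i) (stdVec i) := by
    simp only [Matrix.trace, Matrix.diag, hessian_eq_D2 hψc.contDiffAt]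
  rw [← h2]
  linarith

end Convex

/-! ### Mean value estimates -/

/-- A smooth function that vanishes for `y ≤ 0` and is increasing. -/
noncomputable def glue (y : ℝ) : ℝ := y * expNegInvGlue y

theorem contDiff_glue : ContDiff ℝ ∞ glue := contDiff_id.mul expNegInvGlue.contDiff

theorem glue_eq_zero {y : ℝ} (hy : y ≤ 0) : glue y = 0 := by
  rw [glue, expNegInvGlue.zero_of_nonpos hy, mul_zero]

theorem deriv_glue (y : ℝ) : deriv glue y = expNegInvGlue y + y * deriv expNegInvGlue y := by
  have h := (hasDerivAt_id y).mul (expNegInvGlue.contDiff (n := 1)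
    |>.differentiable (by simp) y).hasDerivAt
  have h2 : HasDerivAt glue (1 * expNegInvGlue y + id y * deriv expNegInvGlue y) y := h
  rw [h2.deriv, one_mul, id]

theorem deriv_glue_eq_zero {y : ℝ} (hy : y ≤ 0) : deriv glue y = 0 := by
  have h : IsLocalMin expNegInvGlue y := Eventually.of_forall fun t => by
    rw [expNegInvGlue.zero_of_nonpos hy]; exact expNegInvGlue.nonneg t
  rw [deriv_glue, h.deriv_eq_zero, expNegInvGlue.zero_of_nonpos hy, mul_zero, add_zero]

/-- The factor `y` in `glue` serves this bound: the radial weight below is this derivative, and it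
needs an explicit positive lower bound near the centre of the ball. -/
theorem expNegInvGlue_le_deriv_glue (y : ℝ) : expNegInvGlue y ≤ deriv glue y := by
  rcases le_or_gt y 0 with hy | hy
  · rw [deriv_glue_eq_zero hy, expNegInvGlue.zero_of_nonpos hy]
  · rw [deriv_glue]
    exact le_add_of_nonneg_right (mul_nonneg hy.le expNegInvGlue.monotone.deriv_nonneg)

theorem deriv_glue_nonneg (y : ℝ) : 0 ≤ deriv glue y :=
  (expNegInvGlue.nonneg y).trans (expNegInvGlue_le_deriv_glue y)

theorem monotone_glue : Monotone glue :=
  monotone_of_deriv_nonneg (contDiff_glue.differentiable (by simp)) deriv_glue_nonneg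

end Abreu

namespace Abreu

section Ball

variable {n : ℕ} {S Ω : Set (E n)} {ψ : E n → ℝ} {p q : E n} {R ρ : ℝ}

/-- Midpoint convexity for `x` and its reflection `2 q - x`, averaged over the ball, which the
reflection preserves. -/
theorem mul_volume_ball_le_integral (hψ : ConvexOn ℝ S ψ) (hc : Continuous ψ)
    (hb : Metric.ball q ρ ⊆ S) :
    ψ q * volume.real (Metric.ball q ρ) ≤ ∫ x in Metric.ball q ρ, ψ x := by
  rcases le_or_gt ρ 0 with hρ | hρ
  · simp [Metric.ball_eq_empty.2 hρ]
  have hmp := Measure.measurePreserving_sub_left (volume : Measure (E n)) (q + q)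
  have hpre : (fun x => q + q - x) ⁻¹' Metric.ball q ρ = Metric.ball q ρ := by
    ext x
    simp only [mem_preimage, Metric.mem_ball, dist_eq_norm]
    rw [show q + q - x - q = -(x - q) by abel, norm_neg]
  have h1 := hmp.setIntegral_preimage_emb (MeasurableEquiv.subLeft (q + q)).measurableEmbedding ψ
    (Metric.ball q ρ)
  rw [hpre] at h1
  have hint : ∀ f : E n → ℝ, Continuous f → IntegrableOn f (Metric.ball q ρ) := fun f hf =>
    (hf.continuousOn.integrableOn_compact (isCompact_closedBall q ρ)).mono_set
      Metric.ball_subset_closedBall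
  have hc' : Continuous fun x => ψ (q + q - x) := hc.comp (continuous_const.sub continuous_id)
  have h2 : ∫ x in Metric.ball q ρ, ψ q ≤
      ∫ x in Metric.ball q ρ, ((1 / 2) * ψ x + (1 / 2) * ψ (q + q - x)) := by
    refine setIntegral_mono_on (hint _ continuous_const)
      (hint _ ((hc.const_mul _).add (hc'.const_mul _))) measurableSet_ball fun x hx => ?_
    have hx' : q + q - x ∈ Metric.ball q ρ := by
      rw [← hpre] at hx; exact hx
    have h3 := hψ.2 (hb hx) (hb hx') (by norm_num : (0 : ℝ) ≤ 1 / 2)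
      (by norm_num : (0 : ℝ) ≤ 1 / 2) (by norm_num)
    rw [show (1 / 2 : ℝ) • x + (1 / 2 : ℝ) • (q + q - x) = q by module] at h3
    exact h3
  rw [integral_add ((hint _ hc).const_mul _) ((hint _ hc').const_mul _), integral_const_mul,
    integral_const_mul, h1, setIntegral_const, smul_eq_mul] at h2
  linarith

/-- Integration by parts against a radial weight on a ball. -/
theorem integral_radial_le (hψ : ConvexOn ℝ Ω ψ) (hc : ContDiff ℝ ∞ ψ) (hR : 0 < R)
    (hb : Metric.closedBall p R ⊆ Ω) :
    ∫ x, 2 * deriv glue (R ^ 2 - ‖x - p‖ ^ 2) * (ψ x - ψ p) ≤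
      ∫ x, glue (R ^ 2 - ‖x - p‖ ^ 2) * ∑ i, D2 ψ x (stdVec i) (stdVec i) := by
  have hle2 : (2 : WithTop ℕ∞) ≤ ∞ := WithTop.coe_le_coe.2 le_top
  -- The gradient of this weight is `-2 glue'(R² - ‖x - p‖²) (x - p)`, so one integration by parts
  -- of `w Δψ` produces the radial derivative of `ψ`, which by convexity is at least `ψ x - ψ p`.
  set w : E n → ℝ := fun x => glue (R ^ 2 - ‖x - p‖ ^ 2) with hw
  have hin : ContDiff ℝ ∞ fun x : E n => R ^ 2 - ‖x - p‖ ^ 2 :=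
    contDiff_const.sub ((contDiff_id.sub contDiff_const).norm_sq ℝ)
  have hwc : ContDiff ℝ ∞ w := contDiff_glue.comp hin
  have hout : ∀ x, x ∉ Metric.closedBall p R → R ^ 2 - ‖x - p‖ ^ 2 ≤ 0 := fun x hx => by
    rw [Metric.mem_closedBall, dist_eq_norm, not_le] at hx
    nlinarith
  have hws : HasCompactSupport w :=
    HasCompactSupport.intro (isCompact_closedBall p R) fun x hx => glue_eq_zero (hout x hx)
  have hwd : ∀ i x, pderiv i w x = -(2 * deriv glue (R ^ 2 - ‖x - p‖ ^ 2) * (x - p) i) := by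
    intro i x
    have h1 : HasFDerivAt (fun x : E n => R ^ 2 - ‖x - p‖ ^ 2) _ x :=
      (((hasFDerivAt_id x).sub_const p).norm_sq).const_sub (R ^ 2)
    have h2 : HasFDerivAt w _ x :=
      ((contDiff_glue.differentiable (by simp) _).hasDerivAt).comp_hasFDerivAt x h1
    rw [pderiv, h2.fderiv]
    simp [EuclideanSpace.inner_single_right]
    ring
  have hψi : ∀ i : Fin n, ContDiff ℝ ∞ (pderiv i ψ) := fun i =>
    (hc.fderiv_right (m := ∞) (by simp)).clm_apply contDiff_const
  have hparts : ∀ i : Fin n, ∫ x, w x * D2 ψ x (stdVec i) (stdVec i) =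
      ∫ x, 2 * deriv glue (R ^ 2 - ‖x - p‖ ^ 2) * ((x - p) i * pderiv i ψ x) := by
    intro i
    have h1 := integral_pderiv_mul isOpen_univ ((hψi i).contDiffOn.of_le (by simp))
      (hwc.of_le (by simp)) hws (subset_univ _) i
    simp only [Measure.restrict_univ, hwd] at h1
    rw [← integral_neg] at h1
    convert h1 using 1
    · refine integral_congr_ae (ae_of_all _ fun x => ?_)
      change w x * D2 ψ x (stdVec i) (stdVec i) = pderiv i (pderiv i ψ) x * w x
      rw [← hessian_eq_D2 (hc.contDiffAt.of_le hle2), mul_comm]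
      rfl
    · exact integral_congr_ae (ae_of_all _ fun x => by ring)
  have hbc : Continuous fun x : E n => 2 * deriv glue (R ^ 2 - ‖x - p‖ ^ 2) :=
    ((contDiff_glue.continuous_deriv (by simp)).comp hin.continuous).const_mul 2
  have hcpt : ∀ f : E n → ℝ, Continuous f →
      Integrable fun x => 2 * deriv glue (R ^ 2 - ‖x - p‖ ^ 2) * f x := fun f hf =>
    (hbc.mul hf).integrable_of_hasCompactSupport (HasCompactSupport.intro
      (isCompact_closedBall p R) fun x hx => by simp [deriv_glue_eq_zero (hout x hx)])
  have hcpt' : ∀ f : E n → ℝ, Continuous f → Integrable fun x => w x * f x := fun f hf =>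
    (hwc.continuous.mul hf).integrable_of_hasCompactSupport hws.mul_right
  have hc2 : ∀ i : Fin n, Continuous fun x => D2 ψ x (stdVec i) (stdVec i) := fun i =>
    (((hc.fderiv_right (m := ∞) (by simp)).fderiv_right (m := ∞)
    (by simp)).continuous.clm_apply continuous_const).clm_apply continuous_const
  have hcc : ∀ i : Fin n, Continuous fun x : E n => (x - p) i * pderiv i ψ x := fun i =>
    ((coordL i).continuous.comp (continuous_id.sub continuous_const)).mul (hψi i).continuous
  have hsum : ∫ x, w x * ∑ i, D2 ψ x (stdVec i) (stdVec i) =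
      ∫ x, 2 * deriv glue (R ^ 2 - ‖x - p‖ ^ 2) * fderiv ℝ ψ x (x - p) := by
    have e : ∀ x, fderiv ℝ ψ x (x - p) = ∑ i, (x - p) i * pderiv i ψ x := fun x =>
      clm_eq_sum _ _
    simp only [e, Finset.mul_sum]
    rw [integral_finsetSum _ fun i _ => hcpt' _ (hc2 i),
      integral_finsetSum _ fun i _ => hcpt _ (hcc i)]
    exact Finset.sum_congr rfl fun i _ => hparts i
  rw [hsum]
  refine integral_mono (hcpt _ (hc.continuous.sub continuous_const))
    (hcpt _ ((hc.continuous_fderiv (by simp)).clm_apply (continuous_id.sub continuous_const)))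
    fun x => ?_
  by_cases hx : x ∈ Metric.closedBall p R
  · have h1 := add_fderiv_le_of_convexOn hψ (hb hx) (hb (Metric.mem_closedBall_self hR.le))
      (hc.differentiable (by simp) x)
    rw [← neg_sub x p, map_neg] at h1
    exact mul_le_mul_of_nonneg_left (by linarith) (mul_nonneg zero_le_two (deriv_glue_nonneg _))
  · simp [deriv_glue_eq_zero (hout x hx)]

end Ball

/-- Smooth functions with compact support that are convex on the closure of `Ω`, nonnegative, and
vanish at `p₀`. -/
structure IsTest {n : ℕ} (Ω : Set (E n)) (p₀ : E n) (ψ : E n → ℝ) : Prop where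
  contDiff : ContDiff ℝ ∞ ψ
  hasCompactSupport : HasCompactSupport ψ
  nonneg : ∀ x, 0 ≤ ψ x
  convexOn : ConvexOn ℝ (closure Ω) ψ
  eq_zero : ψ p₀ = 0

/-! ### Interior bounds by propagation along balls -/

section Chain

variable {n : ℕ} [NeZero n] {Ω : Set (E n)} {s u : E n → ℝ} {p₀ p : E n}

omit [NeZero n] in
theorem IsTest.convexOn' {ψ : E n → ℝ} (h : IsTest Ω p₀ ψ) (hΩ : IsSmoothConvexDomain Ω) :
    ConvexOn ℝ Ω ψ :=
  h.convexOn.subset subset_closure hΩ.convex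

omit [NeZero n] in
theorem IsTest.contDiff_two {ψ : E n → ℝ} (h : IsTest Ω p₀ ψ) : ContDiff ℝ 2 ψ :=
  h.contDiff.of_le (WithTop.coe_le_coe.2 le_top : ((2 : ℕ∞) : WithTop ℕ∞) ≤ _)

theorem IsTest.integral_trHess_nonneg {ψ : E n → ℝ} (h : IsTest Ω p₀ ψ)
    (hΩ : IsSmoothConvexDomain Ω) (hu : ClassS Ω s u) : 0 ≤ ∫ x in Ω, trHess u ψ x :=
  setIntegral_nonneg hΩ.isOpen.measurableSet fun _ hx =>
    trHess_nonneg hΩ.isOpen hu.strictlyConvex (h.convexOn' hΩ) h.contDiff_two hx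

/-- Propagation of bounds for test functions from the centre of a ball to a smaller ball. -/
theorem ClassS.exists_bound_ball (hu : ClassS Ω s u) (hΩ : IsSmoothConvexDomain Ω) {R C : ℝ}
    (hR : 0 < R) (hb : Metric.closedBall p R ⊆ Ω)
    (hC : ∀ ψ, IsTest Ω p₀ ψ → ψ p ≤ C * ∫ x in Ω, trHess u ψ x) :
    ∃ C' : ℝ, ∀ ψ, IsTest Ω p₀ ψ → ∀ q ∈ Metric.ball p (R / 4),
      ψ q ≤ C' * ∫ x in Ω, trHess u ψ x := by
  obtain ⟨c, hc, hcK⟩ := exists_laplacian_le_trHess hΩ.isOpen hu.smooth hu.strictlyConvex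
    (isCompact_closedBall p R) hb
  set b : E n → ℝ := fun x => 2 * deriv glue (R ^ 2 - ‖x - p‖ ^ 2) with hbdef
  have hin : Continuous fun x : E n => R ^ 2 - ‖x - p‖ ^ 2 := by fun_prop
  have hout : ∀ x, x ∉ Metric.closedBall p R → R ^ 2 - ‖x - p‖ ^ 2 ≤ 0 := fun x hx => by
    rw [Metric.mem_closedBall, dist_eq_norm, not_le] at hx
    nlinarith
  have hbc : Continuous b := ((contDiff_glue.continuous_deriv (by simp)).comp hin).const_mul 2
  have hb0 : ∀ x, 0 ≤ b x := fun x => mul_nonneg zero_le_two (deriv_glue_nonneg _)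
  have hint : ∀ f : E n → ℝ, Continuous f → Integrable fun x => b x * f x := fun f hf =>
    (hbc.mul hf).integrable_of_hasCompactSupport (HasCompactSupport.intro
      (isCompact_closedBall p R) fun x hx => by simp [hbdef, deriv_glue_eq_zero (hout x hx)])
  set e := 2 * expNegInvGlue (R ^ 2 / 2) with he
  have he0 : 0 < e := mul_pos two_pos (expNegInvGlue.pos_of_pos (by positivity))
  have hbe : ∀ x ∈ Metric.ball p (R / 2), e ≤ b x := fun x hx => by
    rw [Metric.mem_ball, dist_eq_norm] at hx
    refine mul_le_mul_of_nonneg_left ((expNegInvGlue.monotone ?_).trans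
      (expNegInvGlue_le_deriv_glue _)) zero_le_two
    nlinarith [norm_nonneg (x - p)]
  set B := ∫ x, b x with hB
  set V := volume.real (Metric.ball (0 : E n) (R / 4)) with hV
  have hV0 : 0 < V := ENNReal.toReal_pos (Metric.measure_ball_pos _ _ (by positivity)).ne'
    measure_ball_lt_top.ne
  -- The numerator bounds `∫ b ψ`: the Laplacian term contributes `glue (R ^ 2) / c` and the value
  -- at the centre `C B`. Dividing by `e ≤ b` passes to the plain integral over the half ball, and
  -- dividing by `V` to the value at `q`, by the mean value inequality on the ball of radius `R /
  -- 4`.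
  refine ⟨(glue (R ^ 2) * c⁻¹ + C * B) / e / V, fun ψ hψ q hq => ?_⟩
  set L := ∫ x in Ω, trHess u ψ x with hL
  have hψc := hψ.contDiff.continuous
  have h1 := integral_radial_le (hψ.convexOn' hΩ) hψ.contDiff hR hb
  have hlap : ∫ x, glue (R ^ 2 - ‖x - p‖ ^ 2) * ∑ i, D2 ψ x (stdVec i) (stdVec i) ≤
      glue (R ^ 2) * c⁻¹ * L := by
    have hnn : ∀ x ∈ Ω, 0 ≤ trHess u ψ x := fun x hx =>
      trHess_nonneg hΩ.isOpen hu.strictlyConvex (hψ.convexOn' hΩ) hψ.contDiff_two hx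
    have hti := hu.integrableOn_trHess hΩ hψ.contDiff
    rw [← setIntegral_eq_integral_of_forall_compl_eq_zero (s := Metric.closedBall p R)
      fun x hx => by rw [glue_eq_zero (hout x hx), zero_mul], ← integral_const_mul]
    refine le_trans (setIntegral_mono_on ((Continuous.continuousOn ?_).integrableOn_compact
      (isCompact_closedBall p R))
      ((hti.mono_set hb).const_mul _) measurableSet_closedBall fun x hx => ?_)
      (setIntegral_mono_set (hti.const_mul _)
        ((ae_restrict_iff' hΩ.isOpen.measurableSet).2 (ae_of_all _ fun x hx => ?_)) hb.eventuallyLE)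
    · refine (contDiff_glue.continuous.comp hin).mul (continuous_finsetSum _ fun i _ => ?_)
      exact (((hψ.contDiff.fderiv_right (m := ∞) (by simp)).fderiv_right (m := ∞)
        (by simp)).continuous.clm_apply continuous_const).clm_apply continuous_const
    · have h2 := hcK ψ (hψ.convexOn' hΩ) hψ.contDiff_two x hx
      have h3 : ∑ i, D2 ψ x (stdVec i) (stdVec i) ≤ c⁻¹ * trHess u ψ x := by
        rwa [← div_eq_inv_mul, le_div_iff₀ hc, mul_comm]
      have h4 : 0 ≤ c⁻¹ * trHess u ψ x := mul_nonneg (inv_pos.2 hc).le (hnn x (hb hx))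
      have h5 : 0 ≤ R ^ 2 - ‖x - p‖ ^ 2 := by
        rw [Metric.mem_closedBall, dist_eq_norm] at hx
        nlinarith [norm_nonneg (x - p)]
      rw [mul_assoc]
      refine (mul_le_mul_of_nonneg_left h3 ?_).trans (mul_le_mul_of_nonneg_right ?_ h4)
      · rw [← glue_eq_zero le_rfl]; exact monotone_glue h5
      · exact monotone_glue (by nlinarith [sq_nonneg ‖x - p‖])
    · refine mul_nonneg (mul_nonneg ?_ (inv_pos.2 hc).le) (hnn x hx)
      rw [← glue_eq_zero le_rfl]; exact monotone_glue (sq_nonneg R)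
  have h2 : ∫ x, b x * (ψ x - ψ p) = (∫ x, b x * ψ x) - ψ p * B := by
    simp only [mul_sub]
    rw [integral_sub (hint ψ hψc) (hint _ continuous_const), integral_mul_const, mul_comm B]
  have hBnn : 0 ≤ B := integral_nonneg hb0
  have h3 : ∫ x, b x * ψ x ≤ (glue (R ^ 2) * c⁻¹ + C * B) * L := by
    have h4 := mul_le_mul_of_nonneg_right (hC ψ hψ) hBnn
    have h5 : ∫ x, b x * (ψ x - ψ p) ≤ _ := h1.trans hlap
    rw [h2] at h5
    linarith
  have hon : ∀ T : Set (E n), Bornology.IsBounded T → IntegrableOn ψ T := fun T hT =>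
    (hψc.continuousOn.integrableOn_compact hT.isCompact_closure).mono_set subset_closure
  have h4 : e * ∫ x in Metric.ball p (R / 2), ψ x ≤ ∫ x, b x * ψ x := by
    rw [← integral_const_mul]
    refine le_trans (setIntegral_mono_on ((hon _ Metric.isBounded_ball).const_mul _)
      (hint ψ hψc).integrableOn measurableSet_ball fun x hx =>
      mul_le_mul_of_nonneg_right (hbe x hx) (hψ.nonneg x))
      (setIntegral_le_integral (hint ψ hψc) (ae_of_all _ fun x => mul_nonneg (hb0 x) (hψ.nonneg x)))
  have hsub : Metric.ball q (R / 4) ⊆ Metric.ball p (R / 2) :=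
    Metric.ball_subset_ball' (by rw [Metric.mem_ball] at hq; linarith)
  have hsubΩ : Metric.ball p (R / 2) ⊆ Ω :=
    (Metric.ball_subset_closedBall.trans (Metric.closedBall_subset_closedBall (by linarith))).trans
      hb
  have h5 := mul_volume_ball_le_integral (hψ.convexOn' hΩ) hψc (hsub.trans hsubΩ)
  have hVq : volume.real (Metric.ball q (R / 4)) = V := by
    rw [hV, Measure.real, Measure.real, Measure.addHaar_ball_center]
  rw [hVq] at h5
  have h6 : ∫ x in Metric.ball q (R / 4), ψ x ≤ ∫ x in Metric.ball p (R / 2), ψ x :=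
    setIntegral_mono_set (hon _ Metric.isBounded_ball) (ae_of_all _ hψ.nonneg) hsub.eventuallyLE
  rw [div_mul_eq_mul_div, le_div_iff₀ hV0, div_mul_eq_mul_div, le_div_iff₀ he0]
  calc ψ q * V * e ≤ (∫ x in Metric.ball p (R / 2), ψ x) * e :=
        mul_le_mul_of_nonneg_right (h5.trans h6) he0.le
    _ = e * ∫ x in Metric.ball p (R / 2), ψ x := mul_comm _ _
    _ ≤ _ := h4.trans h3

/-- On compact subsets of `Ω`, test functions are bounded by the integral of the linearised
operator. -/
theorem ClassS.exists_bound_compact (hu : ClassS Ω s u) (hΩ : IsSmoothConvexDomain Ω)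
    (hp₀ : p₀ ∈ Ω) {K : Set (E n)} (hK : IsCompact K) (hKΩ : K ⊆ Ω) :
    ∃ C ≥ 0, ∀ ψ, IsTest Ω p₀ ψ → ∀ q ∈ K, ψ q ≤ C * ∫ x in Ω, trHess u ψ x := by
  -- Connectedness: this set contains `p₀` with constant `0`, and propagation to smaller balls makes
  -- it open and relatively closed in `Ω`.
  set S : Set (E n) := {p | p ∈ Ω ∧ ∃ C : ℝ, ∀ ψ, IsTest Ω p₀ ψ →
    ψ p ≤ C * ∫ x in Ω, trHess u ψ x} with hS
  have hloc : ∀ p ∈ S, ∃ ρ > 0, ∃ C : ℝ, ∀ ψ, IsTest Ω p₀ ψ → ∀ q ∈ Metric.ball p ρ, q ∈ Ω ∧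
      ψ q ≤ C * ∫ x in Ω, trHess u ψ x := by
    rintro p ⟨hp, C, hC⟩
    obtain ⟨R, hR, hb⟩ := Metric.nhds_basis_closedBall.mem_iff.1 (hΩ.isOpen.mem_nhds hp)
    obtain ⟨C', hC'⟩ := hu.exists_bound_ball hΩ hR hb hC
    refine ⟨R / 4, by positivity, C', fun ψ hψ q hq => ⟨hb ?_, hC' ψ hψ q hq⟩⟩
    exact Metric.closedBall_subset_closedBall (by linarith) (Metric.ball_subset_closedBall hq)
  have hball : ∀ p ∈ Ω, ∃ R > 0, Metric.closedBall p R ⊆ Ω := fun p hp =>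
    Metric.nhds_basis_closedBall.mem_iff.1 (hΩ.isOpen.mem_nhds hp)
  have hopen : IsOpen S := by
    rw [Metric.isOpen_iff]
    rintro p ⟨hp, C, hC⟩
    obtain ⟨R, hR, hb⟩ := hball p hp
    obtain ⟨C', hC'⟩ := hu.exists_bound_ball hΩ hR hb hC
    refine ⟨R / 4, by positivity, fun q hq => ⟨hb ?_, C', fun ψ hψ => hC' ψ hψ q hq⟩⟩
    exact Metric.closedBall_subset_closedBall (by linarith) (Metric.ball_subset_closedBall hq)
  have hclosed : closure S ∩ Ω ⊆ S := by
    rintro q ⟨hqS, hqΩ⟩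
    obtain ⟨R, hR, hb⟩ := hball q hqΩ
    -- Being within `R / 16` of `q` keeps the ball of radius `R / 2` around `p` inside `Ω` and puts
    -- `q` into its quarter, of radius `R / 8`.
    obtain ⟨p, hpS, hpq⟩ := Metric.mem_closure_iff.1 hqS (R / 16) (by positivity)
    have hbp : Metric.closedBall p (R / 2) ⊆ Ω :=
      (Metric.closedBall_subset_closedBall' (by rw [dist_comm]; linarith)).trans hb
    obtain ⟨-, C, hC⟩ := hpS
    obtain ⟨C', hC'⟩ := hu.exists_bound_ball hΩ (by positivity) hbp hC
    exact ⟨hqΩ, C', fun ψ hψ => hC' ψ hψ q (by rw [Metric.mem_ball]; linarith)⟩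
  have hSΩ : Ω ⊆ S := hΩ.convex.isPreconnected.subset_of_closure_inter_subset hopen
    ⟨p₀, hp₀, hp₀, 0, fun ψ hψ => by rw [hψ.eq_zero, zero_mul]⟩ hclosed
  refine hK.induction_on (p := fun T => ∃ C ≥ 0, ∀ ψ, IsTest Ω p₀ ψ → ∀ q ∈ T,
    ψ q ≤ C * ∫ x in Ω, trHess u ψ x) ⟨0, le_rfl, by simp⟩ ?_ ?_ ?_
  · rintro T T' hTT' ⟨C, hC, h⟩
    exact ⟨C, hC, fun ψ hψ q hq => h ψ hψ q (hTT' hq)⟩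
  · rintro T T' ⟨C, hC, h⟩ ⟨C', hC', h'⟩
    refine ⟨max C C', le_max_of_le_left hC, fun ψ hψ q hq => ?_⟩
    have hL := hψ.integral_trHess_nonneg hΩ hu
    rcases hq with hq | hq
    · exact (h ψ hψ q hq).trans (mul_le_mul_of_nonneg_right (le_max_left _ _) hL)
    · exact (h' ψ hψ q hq).trans (mul_le_mul_of_nonneg_right (le_max_right _ _) hL)
  · intro p hp
    obtain ⟨ρ, hρ, C, hC⟩ := hloc p (hSΩ (hKΩ hp))
    refine ⟨Metric.ball p ρ, mem_nhdsWithin_of_mem_nhds (Metric.ball_mem_nhds p hρ), max C 0,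
      le_max_right _ _, fun ψ hψ q hq => (hC ψ hψ q hq).2.trans ?_⟩
    exact mul_le_mul_of_nonneg_right (le_max_left _ _) (hψ.integral_trHess_nonneg hΩ hu)

end Chain

end Abreu

/-! ### Dilations about the base point -/

namespace Abreu

section Dilation

variable {n : ℕ} {Ω : Set (E n)} {p₀ x : E n} {t : ℝ}

/-- The dilation with centre `p₀` and factor `t`. -/
noncomputable def dil (p₀ : E n) (t : ℝ) (x : E n) : E n := p₀ + t • (x - p₀)

theorem continuous_dil (p₀ : E n) (t : ℝ) : Continuous (dil p₀ t) :=
  continuous_const.add ((continuous_id.sub continuous_const).const_smul t)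

theorem contDiff_dil (p₀ : E n) (t : ℝ) : ContDiff ℝ ∞ (dil p₀ t) :=
  contDiff_const.add ((contDiff_id.sub contDiff_const).const_smul t)

theorem dil_self (p₀ : E n) (t : ℝ) : dil p₀ t p₀ = p₀ := by simp [dil]

theorem dil_dil (p₀ x : E n) (a b : ℝ) : dil p₀ a (dil p₀ b x) = dil p₀ (a * b) x := by
  simp [dil, mul_smul]

theorem dil_eq (p₀ x : E n) (t : ℝ) : dil p₀ t x = (1 - t) • p₀ + t • x := by
  rw [dil]; module

theorem tendsto_dil {ι : Type*} {l : Filter ι} {t : ι → ℝ} (ht : Tendsto t l (𝓝 1)) (p₀ x : E n) :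
    Tendsto (fun i => dil p₀ (t i) x) l (𝓝 x) := by
  have h := (ht.smul_const (x - p₀)).const_add p₀
  simpa [dil] using h

theorem dil_mem (hΩ : IsOpen Ω) (hc : Convex ℝ Ω) (hp₀ : p₀ ∈ Ω) (ht0 : 0 ≤ t) (ht1 : t < 1)
    (hx : x ∈ closure Ω) : dil p₀ t x ∈ Ω := by
  rw [dil_eq, ← hΩ.interior_eq]
  exact hc.combo_interior_closure_mem_interior (by rwa [hΩ.interior_eq]) hx (by linarith) ht0
    (by ring)

/-- A nonnegative convex function vanishing at `p₀` increases along rays from `p₀`. All monotone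
approximations below rely on this. -/
theorem dil_le {S : Set (E n)} {φ : E n → ℝ} (hφ : ConvexOn ℝ S φ) (h0 : ∀ x ∈ S, 0 ≤ φ x)
    (hp₀ : p₀ ∈ S) (hz : φ p₀ = 0) (ht0 : 0 ≤ t) (ht1 : t ≤ 1) (hx : x ∈ S) :
    φ (dil p₀ t x) ≤ φ x := by
  rw [dil_eq]
  have h1 := hφ.2 hp₀ hx (sub_nonneg.2 ht1) ht0 (by ring)
  rw [hz, smul_zero, zero_add, smul_eq_mul] at h1
  exact h1.trans (mul_le_of_le_one_left (h0 x hx) ht1)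

theorem convexOn_comp_dil (hΩ : IsOpen Ω) (hc : Convex ℝ Ω) (hp₀ : p₀ ∈ Ω) (ht0 : 0 ≤ t)
    (ht1 : t < 1) {φ : E n → ℝ} (hφ : ConvexOn ℝ Ω φ) :
    ConvexOn ℝ (closure Ω) fun x => φ (dil p₀ t x) := by
  have h1 := (hφ.comp_affineMap (AffineMap.homothety p₀ t)).subset
    (s := closure Ω) (fun x hx => ?_) hc.closure
  · refine h1.congr fun x _ => ?_
    simp [dil, AffineMap.homothety_apply, add_comm]
  · have := dil_mem hΩ hc hp₀ ht0 ht1 hx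
    simpa [dil, AffineMap.homothety_apply, add_comm] using this

end Dilation

/-! ### Uniform stability on the class `𝒞~` -/

section Stability

variable {n : ℕ} [NeZero n] {Ω : Set (E n)} {s u A : E n → ℝ} {p₀ : E n}

/-- The tangent plane at `x`, evaluated at `p₀`, gives `ψ x ≤ dψ(x)(x - p₀)`. The flux estimate
bounds the integral of the right side, since the term `n ψ` in the divergence is nonnegative. -/
theorem ClassS.exists_integral_le (hu : ClassS Ω s u) (hΩ : IsSmoothConvexDomain Ω)
    (hs : IsSmoothPositiveDensity Ω s) (hp₀ : p₀ ∈ Ω) :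
    ∃ C ≥ 0, ∀ ψ, IsTest Ω p₀ ψ → (∫ x in Ω, ψ x ≤ C * ∫ x, ψ x ∂boundaryMeasure Ω s) ∧
      ∫ x in Ω, fderiv ℝ ψ x (x - p₀) ≤ C * ∫ x, ψ x ∂boundaryMeasure Ω s := by
  obtain ⟨C, hC, h⟩ := hu.exists_integral_div_le hΩ hs p₀
  refine ⟨C, hC, fun ψ hψ => ?_⟩
  have hint : ∀ f : E n → ℝ, Continuous f → IntegrableOn f Ω := fun f hf =>
    (hf.continuousOn.integrableOn_compact hΩ.isCompact_closure).mono_set subset_closure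
  have hψc := hψ.contDiff.continuous
  have hdc : Continuous fun x => fderiv ℝ ψ x (x - p₀) :=
    (hψ.contDiff.continuous_fderiv (by simp)).clm_apply (continuous_id.sub continuous_const)
  have hd : ∀ x ∈ Ω, ψ x ≤ fderiv ℝ ψ x (x - p₀) := fun x hx => by
    have h1 := add_fderiv_le_of_convexOn (hψ.convexOn' hΩ) hx hp₀
      (hψ.contDiff.differentiable (by simp) x)
    rw [← neg_sub x p₀, map_neg, hψ.eq_zero] at h1
    linarith
  have h1 := h ψ hψ.contDiff hψ.hasCompactSupport hψ.nonneg
  have h2 : ∫ x in Ω, fderiv ℝ ψ x (x - p₀) ≤ ∫ x in Ω, (n * ψ x + fderiv ℝ ψ x (x - p₀)) :=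
    integral_mono (hint _ hdc) (hint _ ((hψc.const_mul _).add hdc)) fun x =>
      le_add_of_nonneg_left (mul_nonneg n.cast_nonneg (hψ.nonneg x))
  have h3 : ∫ x in Ω, ψ x ≤ ∫ x in Ω, fderiv ℝ ψ x (x - p₀) :=
    setIntegral_mono_on (hint _ hψc) (hint _ hdc) hΩ.isOpen.measurableSet hd
  exact ⟨h3.trans (h2.trans h1), h2.trans h1⟩

omit [NeZero n] in
theorem exists_abs_le (hΩ : IsSmoothConvexDomain Ω) (hA : ContDiffOn ℝ ∞ A (closure Ω)) :
    ∃ a > 0, ∀ x ∈ closure Ω, |A x| ≤ a := by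
  obtain ⟨a, ha⟩ := hΩ.isCompact_closure.exists_bound_of_continuousOn hA.continuousOn
  exact ⟨|a| + 1, by positivity, fun x hx => (ha x hx).trans (by linarith [le_abs_self a])⟩

/-- The boundary norm of a test function is controlled by the integral of the linearised
operator. -/
theorem ClassS.exists_boundary_le (hu : ClassS Ω s u) (hΩ : IsSmoothConvexDomain Ω)
    (hs : IsSmoothPositiveDensity Ω s) (hA : ContDiffOn ℝ ∞ A (closure Ω))
    (hAu : SolvesAbreu Ω A u) (hp₀ : p₀ ∈ Ω) :
    ∃ l > 0, ∀ ψ, IsTest Ω p₀ ψ → l * ∫ x, ψ x ∂boundaryMeasure Ω s ≤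
      (∫ x, ψ x ∂boundaryMeasure Ω s) - ∫ x in Ω, A x * ψ x := by
  obtain ⟨C, hC, hCψ⟩ := hu.exists_integral_le hΩ hs hp₀
  obtain ⟨a, ha, haA⟩ := exists_abs_le hΩ hA
  -- Chosen so that `a τ C ≤ 1/2`, which lets the boundary term be absorbed, and so that `τ < 1`,
  -- which makes the dilated closure a compact subset of `Ω`.
  set τ := 1 / (2 * (a * C + 1)) with hτ
  have hτ0 : 0 < τ := by positivity
  have hτ1 : τ ≤ 1 / 2 := by
    rw [hτ]
    exact one_div_le_one_div_of_le two_pos (by nlinarith)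
  have hτC : a * (τ * C) ≤ 1 / 2 := by
    rw [hτ, ← mul_assoc, mul_comm a, mul_assoc, one_div_mul_eq_div,
      div_le_div_iff₀ (by positivity) two_pos]
    linarith
  have hKΩ : dil p₀ (1 - τ) '' closure Ω ⊆ Ω := by
    rintro _ ⟨x, hx, rfl⟩
    exact dil_mem hΩ.isOpen hΩ.convex hp₀ (by linarith) (by linarith) hx
  obtain ⟨D, hD, hDψ⟩ := hu.exists_bound_compact hΩ hp₀
    (hΩ.isCompact_closure.image (continuous_dil p₀ (1 - τ))) hKΩ
  set v := volume.real Ω with hv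
  have hv0 : 0 ≤ v := measureReal_nonneg
  -- The constant comes from `b = L + ∫ A ψ ≤ L + a (v D L + τ C b) ≤ (1 + a v D) L + b / 2`.
  refine ⟨1 / (2 * (1 + a * (v * D))), by positivity, fun ψ hψ => ?_⟩
  rw [hu.integral_trHess hΩ hs hA hAu hψ.contDiff hψ.hasCompactSupport]
  have hid := hu.integral_trHess hΩ hs hA hAu hψ.contDiff hψ.hasCompactSupport
  set L := ∫ x in Ω, trHess u ψ x with hL
  set b := ∫ x, ψ x ∂boundaryMeasure Ω s with hb
  have hint : ∀ f : E n → ℝ, Continuous f → IntegrableOn f Ω := fun f hf =>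
    (hf.continuousOn.integrableOn_compact hΩ.isCompact_closure).mono_set subset_closure
  have hψc := hψ.contDiff.continuous
  have hdc : Continuous fun x => fderiv ℝ ψ x (x - p₀) :=
    (hψ.contDiff.continuous_fderiv (by simp)).clm_apply (continuous_id.sub continuous_const)
  -- The tangent plane at `x` lies below `ψ` at the dilated point, where `ψ ≤ D L`.
  have h1 : ∫ x in Ω, ψ x ≤ ∫ x in Ω, (D * L + τ * fderiv ℝ ψ x (x - p₀)) := by
    refine setIntegral_mono_on (hint _ hψc) (hint _ (continuous_const.add (hdc.const_mul τ)))
      hΩ.isOpen.measurableSet fun x hx => ?_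
    have h2 := add_fderiv_le_of_convexOn (hψ.convexOn' hΩ) hx
      (hKΩ (mem_image_of_mem _ (subset_closure hx))) (hψ.contDiff.differentiable (by simp) x)
    have h3 := hDψ ψ hψ _ (mem_image_of_mem _ (subset_closure hx))
    rw [show dil p₀ (1 - τ) x - x = -(τ • (x - p₀)) by rw [dil]; module, map_neg, map_smul,
      smul_eq_mul] at h2
    linarith
  rw [integral_add (hint _ continuous_const) ((hint _ hdc).const_mul τ), setIntegral_const,
    integral_const_mul, smul_eq_mul] at h1
  have h2 : ∫ x in Ω, A x * ψ x ≤ a * ∫ x in Ω, ψ x := by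
    rw [← integral_const_mul]
    refine setIntegral_mono_on (((hA.continuousOn.mul hψc.continuousOn).integrableOn_compact
      hΩ.isCompact_closure).mono_set subset_closure) ((hint _ hψc).const_mul a)
      hΩ.isOpen.measurableSet fun x hx => ?_
    exact mul_le_mul_of_nonneg_right ((le_abs_self _).trans (haA x (subset_closure hx)))
      (hψ.nonneg x)
  have h3 := mul_le_mul_of_nonneg_left (hCψ ψ hψ).2 hτ0.le
  have h4 := mul_le_mul_of_nonneg_left (h1.trans (add_le_add_right h3 _)) ha.le
  have hb0 : 0 ≤ b := integral_nonneg hψ.nonneg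
  have h5 := mul_le_mul_of_nonneg_right hτC hb0
  rw [one_div_mul_eq_div, div_le_iff₀ (by positivity)]
  linarith

omit [NeZero n] in
/-- Dilations of functions of class `𝒞~` agree with test functions on the closure of `Ω`. -/
theorem ClassCTilde.exists_isTest {φ : E n → ℝ} (hφ : ClassCTilde Ω p₀ φ)
    (hΩ : IsSmoothConvexDomain Ω) (hp₀ : p₀ ∈ Ω) {t : ℝ} (ht0 : 0 ≤ t) (ht1 : t < 1) :
    ∃ ψ, IsTest Ω p₀ ψ ∧ ∀ x ∈ closure Ω, ψ x = φ (dil p₀ t x) := by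
  have hUo : IsOpen (dil p₀ t ⁻¹' Ω) := hΩ.isOpen.preimage (continuous_dil p₀ t)
  have hΩU : closure Ω ⊆ dil p₀ t ⁻¹' Ω := fun x hx =>
    dil_mem hΩ.isOpen hΩ.convex hp₀ ht0 ht1 hx
  obtain ⟨χ, hχ, hχc, hχU, hχ1, hχ01⟩ := exists_smooth_cutoff hΩ.isCompact_closure hUo hΩU
  have hχ0 : ∀ x, x ∉ tsupport χ → χ x = 0 := fun x hx => image_eq_zero_of_notMem_tsupport hx
  have hcl : ∀ x ∈ closure Ω, χ x * φ (dil p₀ t x) = φ (dil p₀ t x) := fun x hx => by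
    rw [hχ1.self_of_nhdsSet x hx, one_mul]
  refine ⟨fun x => χ x * φ (dil p₀ t x), ⟨?_, hχc.mul_right, fun x => ?_, ?_, ?_⟩, hcl⟩
  · have h1 := contDiff_indicator (k := ∞) hUo (isClosed_tsupport χ) hχU
      (g := fun x => χ x * φ (dil p₀ t x)) (fun x _ hx => by rw [hχ0 x hx, zero_mul])
      (hχ.contDiffOn.mul (hφ.classCInf.smooth.comp (contDiff_dil p₀ t).contDiffOn
        fun x hx => hx))
    convert h1 using 1
    funext x
    by_cases hx : x ∈ dil p₀ t ⁻¹' Ω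
    · rw [indicator_of_mem hx]
    · rw [indicator_of_notMem hx, hχ0 x fun h => hx (hχU h), zero_mul]
  · by_cases hx : x ∈ tsupport χ
    · exact mul_nonneg (hχ01 x).1 (hφ.nonneg _ (subset_closure (hχU hx)))
    · rw [hχ0 x hx, zero_mul]
  · exact (convexOn_comp_dil hΩ.isOpen hΩ.convex hp₀ ht0 ht1
      (hφ.classCInf.convexOn.subset subset_closure hΩ.convex)).congr fun x hx => (hcl x hx).symm
  · rw [dil_self, hφ.eq_zero, mul_zero]

omit [NeZero n] in
/-- Integrals of uniformly bounded sequences of continuous functions converge. -/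
theorem tendsto_integrals (hΩ : IsSmoothConvexDomain Ω) [IsFiniteMeasure (boundaryMeasure Ω s)]
    (hA : ContDiffOn ℝ ∞ A (closure Ω)) {f : ℕ → E n → ℝ} {g : E n → ℝ} {B : ℝ}
    (hf : ∀ k, ContinuousOn (f k) (closure Ω)) (hB : ∀ k, ∀ x ∈ closure Ω, |f k x| ≤ B)
    (hlim : ∀ x ∈ closure Ω, Tendsto (fun k => f k x) atTop (𝓝 (g x))) :
    Tendsto (fun k => ∫ x, f k x ∂boundaryMeasure Ω s) atTop
        (𝓝 (∫ x, g x ∂boundaryMeasure Ω s)) ∧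
      Tendsto (fun k => ∫ x in Ω, A x * f k x) atTop (𝓝 (∫ x in Ω, A x * g x)) ∧
      Tendsto (fun k => ∫ x in Ω, f k x) atTop (𝓝 (∫ x in Ω, g x)) := by
  obtain ⟨a, ha, haA⟩ := exists_abs_le hΩ hA
  have hσ : ∀ᵐ x ∂boundaryMeasure Ω s, x ∈ closure Ω :=
    (ae_boundaryMeasure_mem Ω s).mono fun x hx => frontier_subset_closure hx
  have hfin : IsFiniteMeasure (volume.restrict Ω) := ⟨by simpa using hΩ.volume_lt_top⟩
  have hΩm := hΩ.isOpen.measurableSet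
  have hfm : ∀ k, AEStronglyMeasurable (f k) (boundaryMeasure Ω s) := fun k => by
    rw [← Measure.restrict_eq_self_of_ae_mem hσ]
    exact (hf k).aestronglyMeasurable isClosed_closure.measurableSet
  have hfm' : ∀ k, AEStronglyMeasurable (f k) (volume.restrict Ω) := fun k =>
    ((hf k).mono subset_closure).aestronglyMeasurable hΩm
  refine ⟨tendsto_integral_of_dominated_convergence (fun _ => B) hfm (integrable_const B)
    (fun k => hσ.mono fun x hx => hB k x hx) (hσ.mono fun x hx => hlim x hx),
    tendsto_integral_of_dominated_convergence (fun _ => a * B) (fun k =>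
      ((hA.continuousOn.mono subset_closure).aestronglyMeasurable hΩm).mul (hfm' k))
      (integrable_const _) (fun k => (ae_restrict_iff' hΩm).2 (ae_of_all _ fun x hx => ?_))
      ((ae_restrict_iff' hΩm).2 (ae_of_all _ fun x hx =>
        (hlim x (subset_closure hx)).const_mul _)),
    tendsto_integral_of_dominated_convergence (fun _ => B) hfm' (integrable_const B)
      (fun k => (ae_restrict_iff' hΩm).2 (ae_of_all _ fun x hx => hB k x (subset_closure hx)))
      ((ae_restrict_iff' hΩm).2 (ae_of_all _ fun x hx => hlim x (subset_closure hx)))⟩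
  rw [norm_mul]
  exact mul_le_mul (haA x (subset_closure hx)) (hB k x (subset_closure hx)) (norm_nonneg _) ha.le

/-- The sequence of dilation factors `1 - 1 / (m + 2)`. -/
noncomputable def factor (m : ℕ) : ℝ := 1 - 1 / ((m : ℝ) + 2)

theorem factor_pos (m : ℕ) : 0 < factor m := by
  rw [factor, sub_pos, div_lt_one (by positivity)]
  linarith [(m.cast_nonneg : (0 : ℝ) ≤ m)]

theorem factor_lt_one (m : ℕ) : factor m < 1 := by
  rw [factor]
  linarith [show (0 : ℝ) < 1 / ((m : ℝ) + 2) by positivity]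

theorem monotone_factor : Monotone factor := fun a b hab => by
  have h : (a : ℝ) ≤ b := Nat.cast_le.2 hab
  exact sub_le_sub_left (one_div_le_one_div_of_le (by positivity) (by linarith)) _

theorem tendsto_factor : Tendsto factor atTop (𝓝 1) := by
  have h : Tendsto (fun m : ℕ => 1 / ((m : ℝ) + 2)) atTop (𝓝 0) :=
    tendsto_const_nhds.div_atTop
      (tendsto_atTop_add_const_right _ _ tendsto_natCast_atTop_atTop)
  have h1 := h.const_sub 1
  rwa [sub_zero] at h1

/-- The two estimates that hold for all functions of class `𝒞~`. -/
theorem ClassS.exists_stable (hu : ClassS Ω s u) (hΩ : IsSmoothConvexDomain Ω)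
    (hs : IsSmoothPositiveDensity Ω s) (hA : ContDiffOn ℝ ∞ A (closure Ω))
    (hAu : SolvesAbreu Ω A u) (hp₀ : p₀ ∈ Ω) :
    ∃ l > 0, ∃ C ≥ 0, ∀ φ, ClassCTilde Ω p₀ φ →
      (l * ∫ x, φ x ∂boundaryMeasure Ω s ≤
        (∫ x, φ x ∂boundaryMeasure Ω s) - ∫ x in Ω, A x * φ x) ∧
      ∫ x in Ω, φ x ≤ C * ∫ x, φ x ∂boundaryMeasure Ω s := by
  have hfm := hu.isFiniteMeasure hΩ hs
  obtain ⟨l, hl, hlψ⟩ := hu.exists_boundary_le hΩ hs hA hAu hp₀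
  obtain ⟨C, hC, hCψ⟩ := hu.exists_integral_le hΩ hs hp₀
  refine ⟨l, hl, C, hC, fun φ hφ => ?_⟩
  obtain ⟨B, hB⟩ := hΩ.isCompact_closure.exists_bound_of_continuousOn hφ.classCInf.continuousOn
  have hmem : ∀ m, ∀ x ∈ closure Ω, dil p₀ (factor m) x ∈ Ω := fun m x hx =>
    dil_mem hΩ.isOpen hΩ.convex hp₀ (factor_pos m).le (factor_lt_one m) hx
  obtain ⟨h1, h2, h3⟩ := tendsto_integrals (s := s) hΩ hA
    (f := fun m x => φ (dil p₀ (factor m) x)) (g := φ) (B := B)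
    (fun m => hφ.classCInf.continuousOn.comp (continuous_dil _ _).continuousOn
      fun x hx => subset_closure (hmem m x hx))
    (fun m x hx => hB _ (subset_closure (hmem m x hx)))
    fun x hx => ((hφ.classCInf.continuousOn x hx).tendsto).comp (tendsto_nhdsWithin_iff.2
      ⟨tendsto_dil tendsto_factor p₀ x, Eventually.of_forall fun m =>
        subset_closure (hmem m x hx)⟩)
  have hm : ∀ m, (l * ∫ x, φ (dil p₀ (factor m) x) ∂boundaryMeasure Ω s ≤
        (∫ x, φ (dil p₀ (factor m) x) ∂boundaryMeasure Ω s) -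
          ∫ x in Ω, A x * φ (dil p₀ (factor m) x)) ∧
      ∫ x in Ω, φ (dil p₀ (factor m) x) ≤
        C * ∫ x, φ (dil p₀ (factor m) x) ∂boundaryMeasure Ω s := by
    intro m
    obtain ⟨ψ, hψ, hψφ⟩ := hφ.exists_isTest hΩ hp₀ (factor_pos m).le (factor_lt_one m)
    have e1 : ∫ x, φ (dil p₀ (factor m) x) ∂boundaryMeasure Ω s =
        ∫ x, ψ x ∂boundaryMeasure Ω s :=
      integral_congr_ae ((ae_boundaryMeasure_mem Ω s).mono fun x hx =>
        (hψφ x (frontier_subset_closure hx)).symm)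
    have e2 : ∫ x in Ω, A x * φ (dil p₀ (factor m) x) = ∫ x in Ω, A x * ψ x :=
      setIntegral_congr_fun hΩ.isOpen.measurableSet fun x hx => by
        simp only [hψφ x (subset_closure hx)]
    have e3 : ∫ x in Ω, φ (dil p₀ (factor m) x) = ∫ x in Ω, ψ x :=
      setIntegral_congr_fun hΩ.isOpen.measurableSet fun x hx => (hψφ x (subset_closure hx)).symm
    rw [e1, e2, e3]
    exact ⟨hlψ ψ hψ, (hCψ ψ hψ).1⟩
  exact ⟨le_of_tendsto_of_tendsto' (h1.const_mul l) (h1.sub h2) fun m => (hm m).1,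
    le_of_tendsto_of_tendsto' h3 (h1.const_mul C) fun m => (hm m).2⟩

end Stability

end Abreu

/-! ### Monotone sequences with bounded integrals -/

namespace Abreu

section Monotone

variable {X : Type*} [MeasurableSpace X] {μ : Measure X} {f : ℕ → X → ℝ} {C : ℝ}

theorem lintegral_ofReal_le (hf : ∀ m, Integrable (f m) μ) (h0 : ∀ m, ∀ᵐ x ∂μ, 0 ≤ f m x)
    (hC : ∀ m, ∫ x, f m x ∂μ ≤ C) (m : ℕ) : ∫⁻ x, ENNReal.ofReal (f m x) ∂μ ≤ ENNReal.ofReal C := by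
  rw [← ofReal_integral_eq_lintegral_ofReal (hf m) (h0 m)]
  exact ENNReal.ofReal_le_ofReal (hC m)

/-- An increasing sequence of nonnegative functions with bounded integrals converges almost
everywhere. -/
theorem ae_exists_tendsto_of_monotone (hf : ∀ m, Integrable (f m) μ)
    (h0 : ∀ m, ∀ᵐ x ∂μ, 0 ≤ f m x) (hmono : ∀ᵐ x ∂μ, Monotone fun m => f m x)
    (hC : ∀ m, ∫ x, f m x ∂μ ≤ C) : ∀ᵐ x ∂μ, ∃ L, Tendsto (fun m => f m x) atTop (𝓝 L) := by
  have hmeas : ∀ m, AEMeasurable (fun x => ENNReal.ofReal (f m x)) μ := fun m =>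
    (hf m).aestronglyMeasurable.aemeasurable.ennreal_ofReal
  have hsup : ∫⁻ x, ⨆ m, ENNReal.ofReal (f m x) ∂μ ≤ ENNReal.ofReal C := by
    rw [lintegral_iSup' hmeas (hmono.mono fun x hx a b hab => ENNReal.ofReal_le_ofReal (hx hab))]
    exact iSup_le (lintegral_ofReal_le hf h0 hC)
  have hlt := ae_lt_top' (AEMeasurable.iSup hmeas) (hsup.trans_lt ENNReal.ofReal_lt_top).ne
  filter_upwards [hlt, hmono, ae_all_iff.2 h0] with x hx hxm hx0
  refine ⟨_, tendsto_atTop_ciSup hxm ⟨(⨆ m, ENNReal.ofReal (f m x)).toReal, ?_⟩⟩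
  rintro _ ⟨m, rfl⟩
  rw [← ENNReal.ofReal_le_iff_le_toReal hx.ne]
  exact le_iSup (fun m => ENNReal.ofReal (f m x)) m

/-- Fatou's lemma and the bound `C` give integrability of the limit, after which monotone
convergence applies to real-valued integrals. -/
theorem tendsto_integral_of_monotone {F : X → ℝ} (hf : ∀ m, Integrable (f m) μ)
    (h0 : ∀ m, ∀ᵐ x ∂μ, 0 ≤ f m x) (hmono : ∀ᵐ x ∂μ, Monotone fun m => f m x)
    (hC : ∀ m, ∫ x, f m x ∂μ ≤ C) (hF : ∀ᵐ x ∂μ, Tendsto (fun m => f m x) atTop (𝓝 (F x))) :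
    Integrable F μ ∧ Tendsto (fun m => ∫ x, f m x ∂μ) atTop (𝓝 (∫ x, F x ∂μ)) := by
  have hFi : Integrable F μ := by
    refine ⟨aestronglyMeasurable_of_tendsto_ae _ (fun m => (hf m).aestronglyMeasurable) hF, ?_⟩
    have h1 : ∫⁻ x, ‖F x‖ₑ ∂μ = ∫⁻ x, liminf (fun m => ‖f m x‖ₑ) atTop ∂μ :=
      lintegral_congr_ae (hF.mono fun x hx => hx.enorm.liminf_eq.symm)
    rw [HasFiniteIntegral, h1]
    refine (lintegral_liminf_le' fun m => (hf m).aestronglyMeasurable.aemeasurable.enorm).trans_lt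
      (lt_of_le_of_lt (liminf_le_of_frequently_le' (Frequently.of_forall fun m => ?_))
      (ENNReal.ofReal_lt_top (r := C)))
    refine le_trans (le_of_eq (lintegral_congr_ae ?_)) (lintegral_ofReal_le hf h0 hC m)
    filter_upwards [h0 m] with x hx using Real.enorm_of_nonneg hx
  exact ⟨hFi, integral_tendsto_of_tendsto_of_monotone hf hFi hmono hF⟩

end Monotone

/-! ### Boundary values and the class `𝒞_*` -/

section Extend

variable {n : ℕ} {Ω : Set (E n)} {w : E n → ℝ} {p₀ q : E n} {L : ℝ}

theorem extend_of_mem (hq : q ∈ Ω) : extend Ω w q = w q := by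
  rw [extend, if_pos hq]

/-- At a boundary point, the extension is the limit along the segment that ends there. -/
theorem extend_eq_of_tendsto (hΩ : IsOpen Ω) (hc : Convex ℝ Ω) (hp₀ : p₀ ∈ Ω)
    (hwc : ContinuousOn w Ω) (hdil : ∀ t, 0 ≤ t → t ≤ 1 → ∀ x ∈ Ω, w (dil p₀ t x) ≤ w x)
    (hq : q ∈ frontier Ω) (hL : Tendsto (fun m => w (dil p₀ (factor m) q)) atTop (𝓝 L)) :
    extend Ω w q = L := by
  have hqΩ : q ∉ Ω := by rw [frontier, hΩ.interior_eq] at hq; exact hq.2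
  have hqc := frontier_subset_closure hq
  have hne : (𝓝[Ω] q).NeBot := mem_closure_iff_nhdsWithin_neBot.1 hqc
  have hmem : ∀ m, ∀ x ∈ closure Ω, dil p₀ (factor m) x ∈ Ω := fun m x hx =>
    dil_mem hΩ hc hp₀ (factor_pos m).le (factor_lt_one m) hx
  have hL' : Tendsto (fun m => ((w (dil p₀ (factor m) q) : ℝ) : EReal)) atTop (𝓝 (L : EReal)) :=
    (continuous_coe_real_ereal.tendsto L).comp hL
  -- The dilated function is continuous at `q` and lies below `w` on `Ω`, so each radial value is at
  -- most the lower limit. Conversely the radial points are themselves an admissible approach to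
  -- `q`.
  have hlow : ∀ m, ((w (dil p₀ (factor m) q) : ℝ) : EReal) ≤
      liminf (fun x => (w x : EReal)) (𝓝[Ω] q) := by
    intro m
    have h1 : Tendsto (fun x => ((w (dil p₀ (factor m) x) : ℝ) : EReal)) (𝓝[Ω] q)
        (𝓝 ((w (dil p₀ (factor m) q) : ℝ) : EReal)) := by
      refine (continuous_coe_real_ereal.tendsto _).comp ?_
      exact ((hwc.continuousAt (hΩ.mem_nhds (hmem m q hqc))).tendsto.comp
        ((continuous_dil p₀ (factor m)).tendsto q)).mono_left nhdsWithin_le_nhds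
    rw [← h1.liminf_eq]
    refine liminf_le_liminf ?_
    filter_upwards [self_mem_nhdsWithin] with x hx
    exact EReal.coe_le_coe_iff.2 (hdil _ (factor_pos m).le (factor_lt_one m).le x hx)
  have hup : liminf (fun x => (w x : EReal)) (𝓝[Ω] q) ≤ L := by
    have h1 : Tendsto (fun m => dil p₀ (factor m) q) atTop (𝓝[Ω] q) :=
      tendsto_nhdsWithin_iff.2 ⟨tendsto_dil tendsto_factor p₀ q,
        Eventually.of_forall fun m => hmem m q hqc⟩
    rw [← hL'.liminf_eq]
    exact h1.liminf_le_liminf_comp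
  rw [extend, if_neg hqΩ, le_antisymm hup (le_of_tendsto' hL' hlow), EReal.toReal_coe]

end Extend

variable {n : ℕ} {Ω : Set (E n)} {s A : E n → ℝ} {p₀ : E n}

/-- Properties of locally uniform limits of functions of class `𝒞~`. -/
theorem ClassCStar.properties {w : E n → ℝ} {σ : Measure (E n)} (hw : ClassCStar Ω σ p₀ w)
    (hΩ : IsSmoothConvexDomain Ω) (hp₀ : p₀ ∈ Ω) :
    ContinuousOn w Ω ∧ ConvexOn ℝ Ω w ∧ (∀ x ∈ Ω, 0 ≤ w x) ∧ w p₀ = 0 := by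
  obtain ⟨C, v, -, hv, hlim⟩ := hw
  have hpt : ∀ x ∈ Ω, Tendsto (fun k => v k x) atTop (𝓝 (w x)) := fun x hx => hlim.tendsto_at hx
  refine ⟨hlim.continuousOn (Frequently.of_forall fun k =>
    (hv k).1.classCInf.continuousOn.mono subset_closure), ⟨hΩ.convex, ?_⟩, fun x hx =>
    ge_of_tendsto' (hpt x hx) fun k => (hv k).1.nonneg x (subset_closure hx),
    tendsto_nhds_unique (hpt p₀ hp₀) (by simp only [(hv _).1.eq_zero]; exact tendsto_const_nhds)⟩
  intro x hx y hy a b ha hb hab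
  refine le_of_tendsto_of_tendsto' (hpt _ (hΩ.convex hx hy ha hb hab))
    (((hpt x hx).const_smul a).add ((hpt y hy).const_smul b)) fun k => ?_
  exact (hv k).1.classCInf.convexOn.2 (subset_closure hx) (subset_closure hy) ha hb hab

/-- The estimates for functions of class `𝒞~` pass to the dilations of functions of class `𝒞_*`. -/
theorem ClassCStar.exists_dil_le {w : E n → ℝ}
    (hw : ClassCStar Ω (boundaryMeasure Ω s) p₀ w) (hΩ : IsSmoothConvexDomain Ω)
    [IsFiniteMeasure (boundaryMeasure Ω s)] (hA : ContDiffOn ℝ ∞ A (closure Ω)) (hp₀ : p₀ ∈ Ω)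
    {l C : ℝ} (hlC : ∀ φ, ClassCTilde Ω p₀ φ →
      (l * ∫ x, φ x ∂boundaryMeasure Ω s ≤
        (∫ x, φ x ∂boundaryMeasure Ω s) - ∫ x in Ω, A x * φ x) ∧
      ∫ x in Ω, φ x ≤ C * ∫ x, φ x ∂boundaryMeasure Ω s) :
    ∃ D, ∀ m, (∫ x, w (dil p₀ (factor m) x) ∂boundaryMeasure Ω s ≤ D) ∧
      (l * ∫ x, w (dil p₀ (factor m) x) ∂boundaryMeasure Ω s ≤
        (∫ x, w (dil p₀ (factor m) x) ∂boundaryMeasure Ω s) -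
          ∫ x in Ω, A x * w (dil p₀ (factor m) x)) ∧
      ∫ x in Ω, w (dil p₀ (factor m) x) ≤
        C * ∫ x, w (dil p₀ (factor m) x) ∂boundaryMeasure Ω s := by
  obtain ⟨hwc, -⟩ := hw.properties hΩ hp₀
  obtain ⟨D, v, -, hv, hlim⟩ := hw
  refine ⟨D, fun m => ?_⟩
  have hmem : ∀ x ∈ closure Ω, dil p₀ (factor m) x ∈ Ω := fun x hx =>
    dil_mem hΩ.isOpen hΩ.convex hp₀ (factor_pos m).le (factor_lt_one m) hx
  -- For a fixed factor the values of `w` are only used on this compact subset of `Ω`, where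
  -- convergence is uniform; the dilated approximants stay in `𝒞~`.
  set K := dil p₀ (factor m) '' closure Ω with hK
  have hKc : IsCompact K := hΩ.isCompact_closure.image (continuous_dil _ _)
  have hKΩ : K ⊆ Ω := by rintro _ ⟨x, hx, rfl⟩; exact hmem x hx
  have hunif : TendstoUniformlyOn v w atTop K :=
    (tendstoLocallyUniformlyOn_iff_forall_isCompact hΩ.isOpen).1 hlim K hKΩ hKc
  obtain ⟨B, hB⟩ := hKc.exists_bound_of_continuousOn (hwc.mono hKΩ)
  -- From `k₀` on the approximants are within `1` of `w` on `K`. The sequence is shifted by `k₀` so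
  -- that the single bound `B + 1` dominates every term.
  obtain ⟨k₀, hk₀⟩ := eventually_atTop.1 (Metric.tendstoUniformlyOn_iff.1 hunif 1 one_pos)
  have hvt : ∀ k, ClassCTilde Ω p₀ fun x => v k (dil p₀ (factor m) x) := fun k =>
    ⟨⟨(hv k).1.classCInf.continuousOn.comp (continuous_dil _ _).continuousOn
        fun x hx => subset_closure (hmem x hx),
      convexOn_comp_dil hΩ.isOpen hΩ.convex hp₀ (factor_pos m).le (factor_lt_one m)
        ((hv k).1.classCInf.convexOn.subset subset_closure hΩ.convex),
      (hv k).1.classCInf.smooth.comp (contDiff_dil _ _).contDiffOn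
        fun x hx => hmem x (subset_closure hx)⟩,
      fun x hx => (hv k).1.nonneg _ (subset_closure (hmem x hx)), by
        simp only [dil_self, (hv k).1.eq_zero]⟩
  obtain ⟨h1, h2, h3⟩ := tendsto_integrals (s := s) hΩ hA
    (f := fun k x => v (k + k₀) (dil p₀ (factor m) x)) (g := fun x => w (dil p₀ (factor m) x))
    (B := B + 1) (fun k => (hvt _).classCInf.continuousOn) (fun k x hx => by
      have h4 := hk₀ (k + k₀) (Nat.le_add_left _ _) _ (mem_image_of_mem _ hx)
      have h5 := hB _ (mem_image_of_mem (dil p₀ (factor m)) hx)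
      rw [Real.dist_eq, abs_sub_comm] at h4
      rw [Real.norm_eq_abs] at h5
      have h6 := abs_sub_abs_le_abs_sub (v (k + k₀) (dil p₀ (factor m) x))
        (w (dil p₀ (factor m) x))
      linarith) fun x hx =>
      ((hunif.tendsto_at (mem_image_of_mem _ hx)).comp (tendsto_add_atTop_nat k₀))
  have hσint : ∀ φ, ClassCTilde Ω p₀ φ → Integrable φ (boundaryMeasure Ω s) := by
    intro φ hφ
    have hσ : ∀ᵐ x ∂boundaryMeasure Ω s, x ∈ closure Ω :=
      (ae_boundaryMeasure_mem Ω s).mono fun x hx => frontier_subset_closure hx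
    obtain ⟨B, hB⟩ := hΩ.isCompact_closure.exists_bound_of_continuousOn hφ.classCInf.continuousOn
    refine Integrable.of_bound ?_ B (hσ.mono fun x hx => hB x hx)
    rw [← Measure.restrict_eq_self_of_ae_mem hσ]
    exact hφ.classCInf.continuousOn.aestronglyMeasurable isClosed_closure.measurableSet
  refine ⟨le_of_tendsto' h1 fun k => ?_,
    le_of_tendsto_of_tendsto' (h1.const_mul l) (h1.sub h2) fun k => (hlC _ (hvt _)).1,
    le_of_tendsto_of_tendsto' h3 (h1.const_mul C) fun k => (hlC _ (hvt _)).2⟩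
  -- Dilating only decreases the approximants, so their bound in `‖·‖_b` is inherited independently
  -- of the factor.
  refine le_trans (integral_mono_ae (hσint _ (hvt _)) (hσint _ (hv (k + k₀)).1) ?_)
    (hv (k + k₀)).2.le
  filter_upwards [ae_boundaryMeasure_mem Ω s] with x hx
  exact dil_le (hv (k + k₀)).1.classCInf.convexOn (hv (k + k₀)).1.nonneg (subset_closure hp₀)
    (hv (k + k₀)).1.eq_zero (factor_pos m).le (factor_lt_one m).le (frontier_subset_closure hx)

/-- The estimates for functions of class `𝒞~` hold for the extensions of functions of class
`𝒞_*`. -/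
theorem ClassCStar.stable {w : E n → ℝ}
    (hw : ClassCStar Ω (boundaryMeasure Ω s) p₀ w) (hΩ : IsSmoothConvexDomain Ω)
    [IsFiniteMeasure (boundaryMeasure Ω s)] (hA : ContDiffOn ℝ ∞ A (closure Ω)) (hp₀ : p₀ ∈ Ω)
    {l C : ℝ} (hC : 0 ≤ C) (hlC : ∀ φ, ClassCTilde Ω p₀ φ →
      (l * ∫ x, φ x ∂boundaryMeasure Ω s ≤
        (∫ x, φ x ∂boundaryMeasure Ω s) - ∫ x in Ω, A x * φ x) ∧
      ∫ x in Ω, φ x ≤ C * ∫ x, φ x ∂boundaryMeasure Ω s) :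
    0 ≤ ∫ x, extend Ω w x ∂boundaryMeasure Ω s ∧
    l * ∫ x, extend Ω w x ∂boundaryMeasure Ω s ≤
      linFunctional Ω (boundaryMeasure Ω s) A (extend Ω w) ∧
    IntegrableOn w Ω ∧ ∫ x in Ω, w x ≤ C * ∫ x, extend Ω w x ∂boundaryMeasure Ω s := by
  obtain ⟨hwc, hwconv, hw0, hwp⟩ := hw.properties hΩ hp₀
  obtain ⟨D, hD⟩ := hw.exists_dil_le hΩ hA hp₀ hlC
  obtain ⟨a, ha, haA⟩ := exists_abs_le hΩ hA
  set g : ℕ → E n → ℝ := fun m x => w (dil p₀ (factor m) x) with hg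
  have hmem : ∀ m, ∀ x ∈ closure Ω, dil p₀ (factor m) x ∈ Ω := fun m x hx =>
    dil_mem hΩ.isOpen hΩ.convex hp₀ (factor_pos m).le (factor_lt_one m) hx
  have hdil : ∀ t, 0 ≤ t → t ≤ 1 → ∀ x ∈ Ω, w (dil p₀ t x) ≤ w x := fun t ht0 ht1 x hx =>
    dil_le hwconv hw0 hp₀ hwp ht0 ht1 hx
  -- A smaller dilation is a further dilation, by the quotient of the factors, of a point already
  -- inside `Ω`; this gives monotonicity even at boundary points.
  have hgmono : ∀ x ∈ closure Ω, Monotone fun m => g m x := fun x hx i j hij => by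
    have h1 : factor i = factor i / factor j * factor j :=
      (div_mul_cancel₀ _ (factor_pos j).ne').symm
    simp only [hg]
    rw [h1, ← dil_dil]
    exact hdil _ (div_nonneg (factor_pos i).le (factor_pos j).le)
      ((div_le_one (factor_pos j)).2 (monotone_factor hij)) _ (hmem j x hx)
  have hg0 : ∀ m, ∀ x ∈ closure Ω, 0 ≤ g m x := fun m x hx => hw0 _ (hmem m x hx)
  have hgc : ∀ m, ContinuousOn (g m) (closure Ω) := fun m =>
    hwc.comp (continuous_dil _ _).continuousOn fun x hx => hmem m x hx
  have hσ : ∀ᵐ x ∂boundaryMeasure Ω s, x ∈ closure Ω :=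
    (ae_boundaryMeasure_mem Ω s).mono fun x hx => frontier_subset_closure hx
  have hΩm := hΩ.isOpen.measurableSet
  have hae : ∀ {p : E n → Prop}, (∀ x ∈ Ω, p x) → ∀ᵐ x ∂volume.restrict Ω, p x := fun hp =>
    (ae_restrict_iff' hΩm).2 (ae_of_all _ hp)
  have hgint : ∀ m, IntegrableOn (g m) Ω := fun m =>
    ((hgc m).integrableOn_compact hΩ.isCompact_closure).mono_set subset_closure
  have hgσ : ∀ m, Integrable (g m) (boundaryMeasure Ω s) := fun m => by
    obtain ⟨B, hB⟩ := hΩ.isCompact_closure.exists_bound_of_continuousOn (hgc m)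
    refine Integrable.of_bound ?_ B (hσ.mono fun x hx => hB x hx)
    rw [← Measure.restrict_eq_self_of_ae_mem hσ]
    exact (hgc m).aestronglyMeasurable isClosed_closure.measurableSet
  have hgmonoσ : ∀ᵐ x ∂boundaryMeasure Ω s, Monotone fun m => g m x :=
    hσ.mono fun x hx => hgmono x hx
  have hg0σ : ∀ m, ∀ᵐ x ∂boundaryMeasure Ω s, 0 ≤ g m x := fun m =>
    hσ.mono fun x hx => hg0 m x hx
  -- Bounded integrals make the increasing radial values converge to a finite limit almost
  -- everywhere. Hence the default value that `toReal` gives at an infinite lower limit occurs only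
  -- on a null set.
  have hlimσ : ∀ᵐ x ∂boundaryMeasure Ω s, Tendsto (fun m => g m x) atTop (𝓝 (extend Ω w x)) := by
    filter_upwards [ae_exists_tendsto_of_monotone hgσ hg0σ hgmonoσ fun m => (hD m).1,
      ae_boundaryMeasure_mem Ω s] with x ⟨L, hL⟩ hx
    rwa [extend_eq_of_tendsto hΩ.isOpen hΩ.convex hp₀ hwc hdil hx hL]
  obtain ⟨-, hT1⟩ := tendsto_integral_of_monotone hgσ hg0σ hgmonoσ (fun m => (hD m).1) hlimσ
  have hlimΩ : ∀ x ∈ Ω, Tendsto (fun m => g m x) atTop (𝓝 (w x)) := fun x hx =>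
    (hwc.continuousAt (hΩ.isOpen.mem_nhds hx)).tendsto.comp (tendsto_dil tendsto_factor p₀ x)
  obtain ⟨hwint, hT2⟩ := tendsto_integral_of_monotone (F := w) hgint
    (fun m => hae fun x hx => hg0 m x (subset_closure hx))
    (hae fun x hx => hgmono x (subset_closure hx)) (C := C * D)
    (fun m => (hD m).2.2.trans (mul_le_mul_of_nonneg_left (hD m).1 hC)) (hae hlimΩ)
  -- As `A` may change sign, monotone convergence is replaced by domination by `a w`, integrable by
  -- the preceding step.
  have hT3 : Tendsto (fun m => ∫ x in Ω, A x * g m x) atTop (𝓝 (∫ x in Ω, A x * w x)) := by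
    refine tendsto_integral_of_dominated_convergence (fun x => a * w x) (fun m =>
      ((hA.continuousOn.mono subset_closure).aestronglyMeasurable hΩm).mul
        (hgint m).aestronglyMeasurable) (hwint.const_mul a) (fun m => hae fun x hx => ?_)
      (hae fun x hx => (hlimΩ x hx).const_mul _)
    rw [norm_mul, Real.norm_of_nonneg (hg0 m x (subset_closure hx))]
    exact mul_le_mul (haA x (subset_closure hx))
      (hdil _ (factor_pos m).le (factor_lt_one m).le x hx) (hg0 m x (subset_closure hx)) ha.le
  refine ⟨ge_of_tendsto' hT1 fun m => integral_nonneg_of_ae (hg0σ m), ?_, hwint,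
    le_of_tendsto_of_tendsto' hT2 (hT1.const_mul C) fun m => (hD m).2.2⟩
  have h1 : linFunctional Ω (boundaryMeasure Ω s) A (extend Ω w) =
      (∫ x, extend Ω w x ∂boundaryMeasure Ω s) - ∫ x in Ω, A x * w x := by
    rw [linFunctional]
    congr 1
    exact setIntegral_congr_fun hΩm fun x hx => by simp only [extend_of_mem hx]
  rw [h1]
  exact le_of_tendsto_of_tendsto' (hT1.const_mul l) (hT1.sub hT3) fun m => (hD m).2.1

end Abreu

theorem mainTheorem6 {n : ℕ} [NeZero n] (Ω : Set (Abreu.E n)) (hΩ : Abreu.IsSmoothConvexDomain Ω)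
    (s : Abreu.E n → ℝ) (hs : Abreu.IsSmoothPositiveDensity Ω s)
    (A : Abreu.E n → ℝ) (hA : ContDiffOn ℝ ∞ A (closure Ω))
    (hsol : ∃ u : Abreu.E n → ℝ, Abreu.ClassS Ω s u ∧ Abreu.SolvesAbreu Ω A u)
    (p₀ : Abreu.E n) (hp₀ : p₀ ∈ Ω) :
    (∀ P : ℝ, 0 < P → Abreu.RelativelyStrongStable Ω (Abreu.boundaryMeasure Ω s) A p₀ P) ∧
      Abreu.UniformlyStable Ω (Abreu.boundaryMeasure Ω s) A p₀ := by
  obtain ⟨u, hu, hAu⟩ := hsol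
  have hfm := hu.isFiniteMeasure hΩ hs
  obtain ⟨l, hl, C, hC, hlC⟩ := hu.exists_stable hΩ hs hA hAu hp₀
  refine ⟨fun P _ => ⟨fun w hw => ?_, ?_⟩, l, hl, fun φ hφ => (hlC φ hφ).1⟩
  · obtain ⟨h0, h1, -⟩ := hw.1.stable hΩ hA hp₀ hC hlC
    exact (mul_nonneg hl.le h0).trans h1
  · rintro ⟨w, hw, hw0, hna⟩
    obtain ⟨h0, h1, hint, h2⟩ := hw.1.stable hΩ hA hp₀ hC hlC
    obtain ⟨hwc, -, hwnn, -⟩ := hw.1.properties hΩ hp₀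
    rw [hw0] at h1
    -- For an extremal `w` the coercive estimate reads `l ∫ w dσ ≤ 0`. Once the boundary integral
    -- vanishes, so does the integral over `Ω`, and the continuous nonnegative function `w` is zero
    -- there, in particular affine.
    have h3 : ∫ x, Abreu.extend Ω w x ∂Abreu.boundaryMeasure Ω s = 0 :=
      le_antisymm (nonpos_of_mul_nonpos_right h1 hl) h0
    rw [h3, mul_zero] at h2
    have hnn : 0 ≤ᵐ[volume.restrict Ω] w :=
      (ae_restrict_iff' hΩ.isOpen.measurableSet).2 (ae_of_all _ hwnn)
    have h4 : w =ᵐ[volume.restrict Ω] 0 :=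
      (integral_eq_zero_iff_of_nonneg_ae hnn hint).1
        (le_antisymm h2 (integral_nonneg_of_ae hnn))
    refine hna ⟨0, fun x hx => ?_⟩
    simpa using Measure.eqOn_open_of_ae_eq h4 hΩ.isOpen hwc continuousOn_const hx
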